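/- In the problem Token Sliding, an instance $(G,k,I_s,I_t)$ consists of a finite simple undirected graph $G$ on $n$ vertices, an integer $k\ge 1$ and two independent sets $I_s,I_t$ of $G$, each of size $k$. It is a yes-instance if there is a sequence $I_0,I_1,\dots,I_\ell$ of independent sets of $G$ of size $k$ with $I_0=I_s$, $I_\ell=I_t$ and $I_i\,\triangle\, I_{i+1}=\{u,v\}\in E(G)$ for all $0\le i<\ell$. The girth of $G$ is the length of a shortest cycle of $G$, and $\infty$ if $G$ is a forest. Algorithms are programs of a unit-cost random access machine (with addition, truncated subtraction, indirect reading and writing, and branches and loops on zero tests); the graph is given by $n$ and its adjacency matrix, the sets by their characteristic vectors. **Theorem.** Token Sliding, parameterized by the number $k$ of tokens, is fixed-parameter tractable on graphs of girth at least five: there are an algorithm, a computable function $f:\mathbb N\to\mathbb N$ and a polynomial $q$ such that the algorithm decides every instance $(G,k,I_s,I_t)$ in which $G$ has girth at least five in time at most $f(k)\cdot q(n)$. More precisely: 1. There are an algorithm, a constant $C$ and a computable function $g$ such that the algorithm decides every instance $(G,k,I_s,I_t)$ with $G$ of girth at least five in time at most $C\,k\,n^3+g(k)$. 2. There are an algorithm,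 a constant $C$ and a computable function $g$ such that the algorithm transforms every instance $(G,k,I_s,I_t)$ with $G$ of girth at least five, in time at most $C\,k\,n^3+g(k)$, into an instance $(G',k,I_s',I_t')$ with the same $k$, where $G'$ has girth at least five and at most $2^{k^{Ck^3}}$ vertices, such that $(G',k,I_s',I_t')$ is a yes-instance if and only if $(G,k,I_s,I_t)$ is. -/

import Mathlib

/-! ### The problem Token Sliding -/

/-- An instance `(G, k, I_s, I_t)` of Token Sliding: a finite simple graph `G` (with vertex set
`{0, …, n - 1}`) and two independent sets `I_s`, `I_t` of `G`, both of size `k ≥ 1`. -/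
structure TokenSlidingInstance where
  n : ℕ
  G : SimpleGraph (Fin n)
  k : ℕ
  k_pos : 1 ≤ k
  source : Finset (Fin n)
  target : Finset (Fin n)
  source_indep : G.IsNIndepSet k source
  target_indep : G.IsNIndepSet k target

/-- `I` and `J` differ by one slide of a token along an edge: `I ∆ J = {u, v} ∈ E(G)`. -/
def TokenSlide {n : ℕ} (G : SimpleGraph (Fin n)) (I J : Finset (Fin n)) : Prop :=
  ∃ u v : Fin n, G.Adj u v ∧ symmDiff I J = {u, v}

/-- The instance is a yes-instance: there is a sequence `⟨I_0, …, I_ℓ⟩` of independent sets of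
size `k` from `I_s` to `I_t` in which consecutive sets differ by one token slide. -/
def TokenSlidingInstance.IsYes (x : TokenSlidingInstance) : Prop :=
  ∃ (l : ℕ) (I : ℕ → Finset (Fin x.n)), I 0 = x.source ∧ I l = x.target ∧
    (∀ i ≤ l, x.G.IsNIndepSet x.k (I i)) ∧ (∀ i < l, TokenSlide x.G (I i) (I (i + 1)))

/-! ### The machine model: a random access machine with unit-cost instructions -/

/-- The memory of the machine: registers, and arrays `0, 1, 2, …`, all holding natural numbers.
(A program names its registers and arrays explicitly, so it uses finitely many of each.) -/
structure RamState where
  reg : ℕ → ℕ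
  arr : ℕ → ℕ → ℕ

/-- Write a value to a register. -/
def RamState.setReg (s : RamState) (r v : ℕ) : RamState :=
  { s with reg := Function.update s.reg r v }

/-- Write a value to a cell of an array. -/
def RamState.setArr (s : RamState) (a i v : ℕ) : RamState :=
  { s with arr := Function.update s.arr a (Function.update (s.arr a) i v) }

/-- Programs of the machine. The arithmetic instructions are addition and truncated subtraction
only, so that the unit-cost measure is polynomially equivalent to Turing machine time. -/
inductive RamProg where
  /-- do nothing -/
  | skip : RamProg
  /-- `r := c` for a constant `c` -/
  | const (r c : ℕ) : RamProg
  /-- `r := r₁ + r₂` -/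
  | add (r r₁ r₂ : ℕ) : RamProg
  /-- `r := r₁ - r₂` (zero if `r₁ < r₂`) -/
  | sub (r r₁ r₂ : ℕ) : RamProg
  /-- `r := a[r₁]`, indirect read from the array named `a` -/
  | load (r a r₁ : ℕ) : RamProg
  /-- `a[r₁] := r₂`, indirect write to the array named `a` -/
  | store (a r₁ r₂ : ℕ) : RamProg
  /-- sequential composition -/
  | seq (p q : RamProg) : RamProg
  /-- `if r ≠ 0 then p else q` -/
  | ite (r : ℕ) (p q : RamProg) : RamProg
  /-- `while r ≠ 0 do p` -/
  | loop (r : ℕ) (p : RamProg) : RamProg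

/-- `RamRuns p s t s'`: started in state `s`, the program `p` halts in state `s'` after exactly
`t` steps. Each basic instruction and each evaluation of a branch or loop test is one step. -/
inductive RamRuns : RamProg → RamState → ℕ → RamState → Prop where
  | skip (s : RamState) : RamRuns .skip s 1 s
  | const (s : RamState) (r c : ℕ) : RamRuns (.const r c) s 1 (s.setReg r c)
  | add (s : RamState) (r r₁ r₂ : ℕ) :
      RamRuns (.add r r₁ r₂) s 1 (s.setReg r (s.reg r₁ + s.reg r₂))
  | sub (s : RamState) (r r₁ r₂ : ℕ) :
      RamRuns (.sub r r₁ r₂) s 1 (s.setReg r (s.reg r₁ - s.reg r₂))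
  | load (s : RamState) (r a r₁ : ℕ) :
      RamRuns (.load r a r₁) s 1 (s.setReg r (s.arr a (s.reg r₁)))
  | store (s : RamState) (a r₁ r₂ : ℕ) :
      RamRuns (.store a r₁ r₂) s 1 (s.setArr a (s.reg r₁) (s.reg r₂))
  | seq {p q : RamProg} {s s₁ s₂ : RamState} {t₁ t₂ : ℕ} :
      RamRuns p s t₁ s₁ → RamRuns q s₁ t₂ s₂ → RamRuns (.seq p q) s (t₁ + t₂) s₂
  | ite_true {r : ℕ} {p q : RamProg} {s s' : RamState} {t : ℕ} :
      s.reg r ≠ 0 → RamRuns p s t s' → RamRuns (.ite r p q) s (t + 1) s'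
  | ite_false {r : ℕ} {p q : RamProg} {s s' : RamState} {t : ℕ} :
      s.reg r = 0 → RamRuns q s t s' → RamRuns (.ite r p q) s (t + 1) s'
  | loop_exit {r : ℕ} {p : RamProg} {s : RamState} :
      s.reg r = 0 → RamRuns (.loop r p) s 1 s
  | loop_next {r : ℕ} {p : RamProg} {s s₁ s₂ : RamState} {t₁ t₂ : ℕ} :
      s.reg r ≠ 0 → RamRuns p s t₁ s₁ → RamRuns (.loop r p) s₁ t₂ s₂ →
      RamRuns (.loop r p) s (t₁ + t₂ + 1) s₂

/-- From the initial state `s`, the program `p` halts after at most `T` steps, with `1` in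
register `0` if `yes` holds and with `0` in register `0` if it does not. -/
def RamDecidesIn (p : RamProg) (s : RamState) (yes : Prop) (T : ℕ) : Prop :=
  ∃ (t : ℕ) (s' : RamState), RamRuns p s t s' ∧ t ≤ T ∧
    (yes → s'.reg 0 = 1) ∧ (¬ yes → s'.reg 0 = 0)

/-! ### Fixed-parameter tractability -/

/-- A parameterized decision problem with set of instances `X`: `input` is the initial memory
that presents an instance to the machine, `size` the size of an instance, `param` its parameter
and `yes` the set of yes-instances. It is fixed-parameter tractable if it is decided by one
algorithm in time `f(param) * poly(size)`, for some computable function `f`. -/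
def FixedParameterTractable {X : Type} (input : X → RamState) (size param : X → ℕ)
    (yes : X → Prop) : Prop :=
  ∃ (p : RamProg) (f : ℕ → ℕ) (q : Polynomial ℕ), Computable f ∧
    ∀ x : X, RamDecidesIn p (input x) (yes x) (f (param x) * q.eval (size x))

/-! ### Instances of Token Sliding as inputs and outputs of the machine -/

open Classical in
/-- The initial memory for an instance: register `0` holds `n`, register `1` holds `k`, array `0`
holds the adjacency matrix of the graph (row by row, the entry `(i, j)` in cell `i * n + j`),
arrays `1` and `2` hold the characteristic vectors of the two independent sets, and everything
else is `0`. -/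
noncomputable def TokenSlidingInstance.encode (x : TokenSlidingInstance) : RamState where
  reg r := if r = 0 then x.n else if r = 1 then x.k else 0
  arr a c :=
    if a = 0 then
      if ∃ i j : Fin x.n, x.G.Adj i j ∧ c = (i : ℕ) * x.n + (j : ℕ) then 1 else 0
    else if a = 1 then if ∃ i ∈ x.source, c = (i : ℕ) then 1 else 0
    else if a = 2 then if ∃ i ∈ x.target, c = (i : ℕ) then 1 else 0
    else 0

/-- The memory `s` contains the instance `x` in the format of `encode`; the contents of the cells
that are not part of this description of `x` are irrelevant. -/
def TokenSlidingInstance.IsOutput (x : TokenSlidingInstance) (s : RamState) : Prop :=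
  s.reg 0 = x.n ∧ s.reg 1 = x.k ∧
    (∀ c < x.n * x.n, s.arr 0 c = x.encode.arr 0 c) ∧
    (∀ c < x.n, s.arr 1 c = x.encode.arr 1 c) ∧
    (∀ c < x.n, s.arr 2 c = x.encode.arr 2 c)

/-- The instances of Token Sliding whose graph has girth at least five (the girth of a forest
is `∞`). -/
abbrev GirthFiveInstance : Type := {x : TokenSlidingInstance // 5 ≤ x.G.egirth}

/-! ### Sliding multisets of tokens under a conflict relation -/

open Relation

section Sliding

variable {V : Type*}

/-- The relation `F` is symmetric. -/
abbrev SymmRel (F : V → V → Prop) : Prop := ∀ ⦃u v⦄, F u v → F v u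

/-- No two tokens of the multiset `m` are in conflict. -/
def ConflictFree (F : V → V → Prop) (m : Multiset V) : Prop :=
  ∀ u v r, m = u ::ₘ v ::ₘ r → ¬ F u v

/-- One token slides from `u` to `v` with `A u v`, between conflict-free multisets. -/
def SlideStep (A F : V → V → Prop) (m m' : Multiset V) : Prop :=
  ∃ u v r, m = u ::ₘ r ∧ m' = v ::ₘ r ∧ A u v ∧ ConflictFree F m ∧ ConflictFree F m'

/-- Reachability by slides. -/
def Slides (A F : V → V → Prop) : Multiset V → Multiset V → Prop :=
  ReflTransGen (SlideStep A F)

/-- The restriction of a relation to a set. -/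
def Within (A : V → V → Prop) (U : Set V) (u v : V) : Prop := A u v ∧ u ∈ U ∧ v ∈ U

theorem conflictFree_zero (F : V → V → Prop) : ConflictFree F 0 := by
  intro u v r h
  exact absurd h.symm (Multiset.cons_ne_zero)

theorem conflictFree_cons {F : V → V → Prop} (hF : SymmRel F) {x : V} {m : Multiset V} :
    ConflictFree F (x ::ₘ m) ↔ ConflictFree F m ∧ ∀ y ∈ m, ¬ F x y := by
  constructor
  · intro h
    refine ⟨fun u v r hm => h u v (x ::ₘ r) ?_, fun y hy => ?_⟩
    · rw [hm, Multiset.cons_swap x u, Multiset.cons_swap x v]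
    · obtain ⟨r, rfl⟩ := Multiset.exists_cons_of_mem hy
      exact h x y r rfl
  · rintro ⟨h1, h2⟩ u v r hm
    rcases Multiset.cons_eq_cons.1 hm with ⟨rfl, h⟩ | ⟨hne, cs, h, h'⟩
    · exact h2 v (h ▸ Multiset.mem_cons_self _ _)
    · rcases Multiset.cons_eq_cons.1 h' with ⟨rfl, h''⟩ | ⟨hne', ds, h'', h'''⟩
      · intro hf
        exact h2 u (h ▸ Multiset.mem_cons_self _ _) (hF hf)
      · exact h1 u v ds (by rw [h, h'''])

theorem conflictFree_singleton (F : V → V → Prop) (x : V) : ConflictFree F {x} := by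
  intro u v r h
  have := congrArg Multiset.card h
  simp at this

theorem conflictFree_add {F : V → V → Prop} (hF : SymmRel F) {m o : Multiset V} :
    ConflictFree F (m + o) ↔
      ConflictFree F m ∧ ConflictFree F o ∧ ∀ x ∈ m, ∀ y ∈ o, ¬ F x y := by
  induction m using Multiset.induction with
  | empty => simp [conflictFree_zero]
  | cons a m ih =>
    rw [Multiset.cons_add, conflictFree_cons hF, ih, conflictFree_cons hF]
    simp only [Multiset.mem_add, Multiset.mem_cons]
    grind

theorem ConflictFree.mono {F F' : V → V → Prop} (h : ∀ u v, F' u v → F u v) {m : Multiset V}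
    (hm : ConflictFree F m) : ConflictFree F' m :=
  fun u v r e hf => hm u v r e (h u v hf)

theorem ConflictFree.of_le {F : V → V → Prop} (hF : SymmRel F) {m o : Multiset V} (hle : o ≤ m)
    (hm : ConflictFree F m) : ConflictFree F o := by
  obtain ⟨r, rfl⟩ := Multiset.le_iff_exists_add.1 hle
  exact ((conflictFree_add hF).1 hm).1

theorem ConflictFree.map {W : Type*} {F : V → V → Prop} {F' : W → W → Prop} {f : V → W}
    (hF : SymmRel F) (hF' : SymmRel F')
    (h : ∀ u v, F' (f u) (f v) → F u v) {m : Multiset V} (hm : ConflictFree F m) :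
    ConflictFree F' (m.map f) := by
  induction m using Multiset.induction with
  | empty => simpa using conflictFree_zero F'
  | cons a m ih =>
    rw [conflictFree_cons hF] at hm
    rw [Multiset.map_cons, conflictFree_cons hF']
    refine ⟨ih hm.1, fun y hy => ?_⟩
    obtain ⟨z, hz, rfl⟩ := Multiset.mem_map.1 hy
    exact fun hc => hm.2 z hz (h _ _ hc)

namespace Slides

variable {A A' F F' : V → V → Prop} {m m' m'' : Multiset V}

theorem refl (m : Multiset V) : Slides A F m m := ReflTransGen.refl

theorem trans (h : Slides A F m m') (h' : Slides A F m' m'') : Slides A F m m'' :=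
  ReflTransGen.trans h h'

theorem single {u v : V} {r : Multiset V} (h : A u v) (h1 : ConflictFree F (u ::ₘ r))
    (h2 : ConflictFree F (v ::ₘ r)) : Slides A F (u ::ₘ r) (v ::ₘ r) :=
  ReflTransGen.single ⟨u, v, r, rfl, rfl, h, h1, h2⟩

theorem symm (hA : SymmRel A) (h : Slides A F m m') : Slides A F m' m := by
  induction h with
  | refl => exact refl _
  | tail _ h ih =>
    obtain ⟨u, v, r, h1, h2, h3, h4, h5⟩ := h
    exact ReflTransGen.head ⟨v, u, r, h2, h1, hA h3, h5, h4⟩ ih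

theorem card_eq (h : Slides A F m m') : m'.card = m.card := by
  induction h with
  | refl => rfl
  | tail _ h ih =>
    obtain ⟨u, v, r, rfl, rfl, -⟩ := h
    simpa using ih

theorem conflictFree (h : Slides A F m m') (hm : ConflictFree F m) : ConflictFree F m' := by
  cases h with
  | refl => exact hm
  | tail _ h =>
    obtain ⟨u, v, r, -, -, -, -, h⟩ := h
    exact h

theorem mono (hA : ∀ u v, A u v → A' u v) (hF : ∀ u v, F' u v → F u v) (h : Slides A F m m') :
    Slides A' F' m m' :=
  ReflTransGen.mono (fun _ _ ⟨u, v, r, h1, h2, h3, h4, h5⟩ =>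
    ⟨u, v, r, h1, h2, hA _ _ h3, h4.mono hF, h5.mono hF⟩) _ _ h

theorem map {W : Type*} {B E : W → W → Prop} {f : V → W} (hF : SymmRel F) (hE : SymmRel E)
    (hA : ∀ u v, A u v → B (f u) (f v)) (h : ∀ u v, E (f u) (f v) → F u v)
    (hs : Slides A F m m') : Slides B E (m.map f) (m'.map f) := by
  induction hs with
  | refl => exact refl _
  | tail _ hst ih =>
    obtain ⟨u, v, r, rfl, rfl, huv, h1, h2⟩ := hst
    refine ih.trans (ReflTransGen.single ⟨f u, f v, r.map f, by simp, by simp, hA _ _ huv, ?_, ?_⟩)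
    · exact h1.map hF hE h
    · exact h2.map hF hE h

theorem mem_of_within {U : Set V} (h : Slides (Within A U) F m m') (hm : ∀ x ∈ m, x ∈ U) :
    ∀ x ∈ m', x ∈ U := by
  induction h with
  | refl => exact hm
  | tail _ hst ih =>
    obtain ⟨u, v, r, rfl, rfl, huv, h1, h2⟩ := hst
    intro x hx
    rcases Multiset.mem_cons.1 hx with rfl | hx
    · exact huv.2.2
    · exact ih x (Multiset.mem_cons_of_mem hx)

/-- Slides inside `U` are still possible in the presence of tokens `o` that are not in conflict
with any vertex of `U`. -/
theorem frame {U : Set V} (h : Slides (Within A U) F m m') (hm : ∀ x ∈ m, x ∈ U)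
    (hF' : SymmRel F') (hFF : ∀ u v, F' u v → F u v) {o : Multiset V} (ho : ConflictFree F' o)
    (hoU : ∀ x ∈ o, ∀ u ∈ U, ¬ F' x u) : Slides A F' (m + o) (m' + o) := by
  have key : ∀ p : Multiset V, (∀ x ∈ p, x ∈ U) → ConflictFree F p → ConflictFree F' (p + o) :=
    fun p hp hpf => (conflictFree_add hF').2
      ⟨hpf.mono hFF, ho, fun x hx y hy hxy => hoU y hy x (hp x hx) (hF' hxy)⟩
  induction h with
  | refl => exact refl _
  | tail hs hst ih =>
    have hmem := mem_of_within hs hm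
    have hmem' := mem_of_within (hs.tail hst) hm
    obtain ⟨u, v, r, rfl, rfl, huv, h1, h2⟩ := hst
    refine ih.trans ?_
    have h1' := key _ hmem h1
    have h2' := key _ hmem' h2
    rw [Multiset.cons_add] at h1' h2' ⊢
    rw [Multiset.cons_add]
    exact single huv.1 h1' h2'

/-- If every slide out of a set `K` of vertices can be brought back into `K` by a symmetry that
fixes the tokens of the present and of the target configuration, then the slides can be confined
to `K`. -/
theorem confine {K : Set V} (hF : SymmRel F) {s t : Multiset V} (hs : ∀ x ∈ s, x ∈ K)
    (hsF : ConflictFree F s) 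
    (hK : ∀ m : Multiset V, (∀ x ∈ m, x ∈ K) → ConflictFree F m → m.card = s.card → ∀ u ∈ m,
      ∀ v ∉ K, A u v → ∃ σ : V → V, (∀ x y, A x y → A (σ x) (σ y)) ∧
        (∀ x y, F (σ x) (σ y) → F x y) ∧ (∀ x ∈ m, σ x = x) ∧ (∀ x ∈ t, σ x = x) ∧ σ v ∈ K)
    (h : Slides A F s t) : Slides (Within A K) F s t := by
  -- The run is transported by a symmetry `σ` that is updated on the way: whenever the transported
  -- slide would leave `K`, `σ` is composed with the symmetry that `hK` provides. All these
  -- symmetries fix `t`, so the transported run still ends in `t`.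
  have main : ∀ m, Slides A F s m → ∃ σ : V → V, (∀ x y, A x y → A (σ x) (σ y)) ∧
      (∀ x y, F (σ x) (σ y) → F x y) ∧ (∀ x ∈ t, σ x = x) ∧
      Slides (Within A K) F s (m.map σ) := by
    intro m hm
    induction hm with
    | refl => exact ⟨id, fun _ _ => id, fun _ _ => id, fun _ _ => rfl, by simpa using refl _⟩
    | tail hs1 hst ih =>
      obtain ⟨σ, hσA, hσF, hσt, hσs⟩ := ih
      have hmem := mem_of_within hσs hs
      have hcf := conflictFree hσs hsF
      have hcard := card_eq hσs
      obtain ⟨u, v, r, rfl, rfl, huv, h1, h2⟩ := hst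
      rw [Multiset.map_cons] at hσs hmem hcf hcard
      by_cases hv : σ v ∈ K
      · refine ⟨σ, hσA, hσF, hσt, hσs.trans ?_⟩
        rw [Multiset.map_cons]
        refine single ⟨hσA _ _ huv, hmem _ (Multiset.mem_cons_self _ _), hv⟩ hcf ?_
        have := h2.map hF hF hσF
        rwa [Multiset.map_cons] at this
      · obtain ⟨τ, hτA, hτF, hτm, hτt, hτv⟩ := hK _ hmem hcf hcard (σ u)
          (Multiset.mem_cons_self _ _) (σ v) hv (hσA _ _ huv)
        -- As `τ` fixes all tokens present before the slide, the part of the run already transported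
        -- is unaffected; only the destination of this slide changes.
        have hr : r.map (fun x => τ (σ x)) = r.map σ := Multiset.map_congr rfl fun x hx =>
          hτm _ (Multiset.mem_cons_of_mem (Multiset.mem_map_of_mem _ hx))
        have hu : τ (σ u) = σ u := hτm _ (Multiset.mem_cons_self _ _)
        refine ⟨fun x => τ (σ x), fun x y h => hτA _ _ (hσA _ _ h),
          fun x y h => hσF _ _ (hτF _ _ h), fun x hx => by simp only [hσt x hx, hτt x hx],
          hσs.trans ?_⟩
        have h2' := (h2.map hF hF hσF).map hF hF hτF
        rw [Multiset.map_cons, hr]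
        rw [Multiset.map_cons, Multiset.map_cons, Multiset.map_map] at h2'
        have hr' : r.map (τ ∘ σ) = r.map σ := hr
        rw [hr'] at h2'
        refine single ⟨?_, hmem _ (Multiset.mem_cons_self _ _), hτv⟩ hcf h2'
        have := hτA _ _ (hσA _ _ huv)
        rwa [hu] at this
  obtain ⟨σ, -, -, hσt, hσ⟩ := main t h
  rwa [Multiset.map_congr rfl hσt, Multiset.map_id'] at hσ

/-- Tokens step aside one after the other. -/
theorem asides (hF : SymmRel F) (L : Multiset V) (l : List (V × V)) :
    ∀ (_ : ConflictFree F (L + ((l.map Prod.fst : List V) : Multiset V)))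
    (_ : ∀ p ∈ l, A p.1 p.2 ∧ ∀ y ∈ L, ¬ F p.2 y)
    (_ : l.Pairwise fun p q => ¬ F p.2 q.2 ∧ ¬ F p.2 q.1 ∧
      ¬ F q.2 p.1),
    Slides A F (L + ((l.map Prod.fst : List V) : Multiset V))
      (L + ((l.map Prod.snd : List V) : Multiset V)) := by
  induction l generalizing L with
  | nil => intro _ _ _; exact Slides.refl _
  | cons p l ih =>
    intro h1 h2 h3
    rw [List.pairwise_cons] at h3
    have hp := h2 p (by simp)
    rw [List.map_cons, List.map_cons, ← Multiset.cons_coe, ← Multiset.cons_coe,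
      Multiset.add_cons, Multiset.add_cons, ← Multiset.cons_add, ← Multiset.cons_add]
    rw [List.map_cons, ← Multiset.cons_coe, Multiset.add_cons] at h1
    have h1' := (conflictFree_cons hF).1 h1
    have h4 : ConflictFree F (p.2 ::ₘ (L + ((l.map Prod.fst : List V) :
        Multiset V))) := by
      refine (conflictFree_cons hF).2 ⟨h1'.1, fun y hy => ?_⟩
      rcases Multiset.mem_add.1 hy with hy | hy
      · exact hp.2 y hy
      · obtain ⟨q, hq, rfl⟩ := List.mem_map.1 (Multiset.mem_coe.1 hy)
        exact (h3.1 q hq).2.1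
    -- A token that has stepped aside counts as one of the resting tokens `L` for the remaining
    -- ones.
    refine (show Slides _ _ _ (p.2 ::ₘ L + ((l.map Prod.fst : List V) : Multiset V)) from ?_).trans
      (ih (p.2 ::ₘ L) ?_ ?_ h3.2)
    · rw [Multiset.cons_add, Multiset.cons_add]
      exact Slides.single hp.1 h1 h4
    · rwa [Multiset.cons_add]
    · intro q hq
      refine ⟨(h2 q (by simp [hq])).1, fun y hy => ?_⟩
      rcases Multiset.mem_cons.1 hy with rfl | hy
      · exact fun h => (h3.1 q hq).1 (hF h)
      · exact (h2 q (by simp [hq])).2 y hy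

end Slides

theorem conflictFree_map_val {ι : Type*} {F : V → V → Prop} (hF : SymmRel F) (f : ι → V)
    (I : Finset ι) (h : ∀ i ∈ I, ∀ j ∈ I, i ≠ j → ¬ F (f i) (f j)) :
    ConflictFree F (I.val.map f) := by
  classical
  induction I using Finset.induction with
  | empty => simpa using conflictFree_zero F
  | insert a I ha ih =>
    rw [Finset.insert_val_of_notMem ha, Multiset.map_cons, conflictFree_cons hF]
    refine ⟨ih fun i hi j hj => h i (by simp [hi]) j (by simp [hj]), fun y hy => ?_⟩
    obtain ⟨j, hj, rfl⟩ := Multiset.mem_map.1 hy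
    have hj : j ∈ I := by simpa using hj
    exact h a (by simp) j (by simp [hj]) fun e => ha (e ▸ hj)

end Sliding

/-! ### Absorbers: sets of vertices on which conflicts may be ignored -/

section Absorbing

variable {V : Type*}

/-- Two tokens clash if they are on equal or adjacent vertices, except that tokens on vertices of
`H` clash with no token. -/
def Clash (A : V → V → Prop) (H : Set V) (u v : V) : Prop := u ∉ H ∧ v ∉ H ∧ (u = v ∨ A u v)

theorem Clash.symmRel {A : V → V → Prop} (hA : SymmRel A) (H : Set V) : SymmRel (Clash A H) :=
  fun _ _ h => ⟨h.2.1, h.1, h.2.2.elim (fun h => Or.inl h.symm) fun h => Or.inr (hA h)⟩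

theorem Clash.anti {A : V → V → Prop} {H H' : Set V} (h : H ⊆ H') (u v : V)
    (hc : Clash A H' u v) : Clash A H u v :=
  ⟨fun hu => hc.1 (h hu), fun hv => hc.2.1 (h hv), hc.2.2⟩

/-- Equality is part of `Clash`, so off `H` a conflict-free multiset is a set; with `H = ∅` one
recovers independent sets. -/
theorem ConflictFree.nodup {A : V → V → Prop} (hA : SymmRel A) {H : Set V} {m : Multiset V}
    (h : ConflictFree (Clash A H) m) (hm : ∀ x ∈ m, x ∉ H) : m.Nodup := by
  induction m using Multiset.induction with
  | empty => exact Multiset.nodup_zero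
  | cons a m ih =>
    rw [conflictFree_cons (Clash.symmRel hA H)] at h
    refine Multiset.nodup_cons.2 ⟨fun ha => h.2 a ha ?_, ih h.1 fun x hx =>
      hm x (Multiset.mem_cons_of_mem hx)⟩
    exact ⟨hm a (Multiset.mem_cons_self _ _), hm a (Multiset.mem_cons_self _ _), Or.inl rfl⟩

/-- A set `C` of vertices that can absorb up to `k` tokens: they are parked on a small subset `W`
of `C`, and a further token that arrives at a vertex `v` of `C` or next to `C` can be parked, too,
using only the vertices of `W` and of a path that starts in `v`. -/
structure Absorber (G : SimpleGraph V) (C : Set V) (k w : ℕ) where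
  W : Finset V
  W_sub : ∀ x ∈ W, x ∈ C
  W_card : W.card ≤ w
  park : ℕ → Multiset V
  park_mem : ∀ j ≤ k, ∀ x ∈ park j, x ∈ W
  park_card : ∀ j ≤ k, (park j).card = j
  park_free : ∀ j ≤ k, ConflictFree (Clash G.Adj ∅) (park j)
  path : V → Set V
  path_sub : ∀ v, ∀ p ∈ path v, p ∈ C ∨ p = v
  mem_path : ∀ v, v ∈ path v
  -- There are two phases because a token that comes from outside enters `v` between them: the
  -- parked tokens move to `m`, away from the closed neighbourhood of `v`, using `W` only; after the
  -- slide to `v`, the token is taken in along its path.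
  room : ∀ v ∉ W, (v ∈ C ∨ ∃ x ∈ C, G.Adj v x) → ∀ j < k, ∃ m : Multiset V,
    (∀ x ∈ m, x ∈ W) ∧ (∀ x ∈ m, v ≠ x ∧ ¬ G.Adj v x) ∧
    Slides (Within G.Adj W) (Clash G.Adj ∅) (park j) m ∧
    Slides (Within G.Adj (W ∪ path v)) (Clash G.Adj ∅) (v ::ₘ m) (park (j + 1))
  -- The last four fields allow several waiting tokens to be absorbed in order of increasing level.
  -- A waiting token `y` of at least the level of `x` cannot obstruct the path of `x` once it is
  -- away from `x` and from its successor `next x`, since the rest of the path lies at least two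
  -- levels below.
  level : V → ℕ
  next : V → V
  next_mem : ∀ x ∈ C, x ∉ W → next x ∈ C
  geo : ∀ x ∈ C, x ∉ W → ∀ y ∈ C, level x ≤ level y → y ≠ x → ¬ G.Adj y x → y ≠ next x →
    ¬ G.Adj y (next x) → ∀ p ∈ path x, y ≠ p ∧ ¬ G.Adj y p

namespace Absorber

variable {G : SimpleGraph V} {C H : Set V} {k w : ℕ}

/-- The closed neighbourhood of `C`. -/
def reach (G : SimpleGraph V) (C : Set V) : Set V := {v | v ∈ C ∨ ∃ x ∈ C, G.Adj v x}

open Classical in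
/-- The tokens in the closed neighbourhood of `C` are parked. -/
noncomputable def norm (B : Absorber G C k w) (a : Multiset V) : Multiset V :=
  a.filter (· ∉ reach G C) + B.park (a.filter (· ∈ reach G C)).card

open Classical in
theorem norm_cons_of_mem (B : Absorber G C k w) {u : V} (r : Multiset V) (hu : u ∈ reach G C) :
    B.norm (u ::ₘ r) = r.filter (· ∉ reach G C) +
      B.park ((r.filter (· ∈ reach G C)).card + 1) := by
  simp [norm, hu]

open Classical in
theorem norm_cons_of_notMem (B : Absorber G C k w) {u : V} (r : Multiset V)
    (hu : u ∉ reach G C) : B.norm (u ::ₘ r) = (u ::ₘ r.filter (· ∉ reach G C)) +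
      B.park (r.filter (· ∈ reach G C)).card := by
  simp [norm, hu]

theorem conflictFree_of_notMem {m : Multiset V} (h : ConflictFree (Clash G.Adj (H ∪ C)) m)
    (hm : ∀ x ∈ m, x ∉ C) : ConflictFree (Clash G.Adj H) m := by
  intro u v r e hc
  have hu := hm u (by simp [e])
  have hv := hm v (by simp [e])
  exact h u v r e ⟨by simp [hu, hc.1], by simp [hv, hc.2.1], hc.2.2⟩

theorem symmRel_adj : SymmRel G.Adj := fun _ _ h => h.symm

theorem symmRel_clash : SymmRel (Clash G.Adj H) := Clash.symmRel symmRel_adj H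

theorem not_clash_of_notMem_reach {x y : V} (hx : x ∉ reach G C) (hy : y ∈ C) :
    ¬ Clash G.Adj H x y := by
  rintro ⟨-, -, rfl | h⟩
  · exact hx (Or.inl hy)
  · exact hx (Or.inr ⟨y, hy, h⟩)

open Classical in
-- The only slide that costs work. Since `u` is outside the closed neighbourhood of `C`, the vertex
-- `v` is next to `C` but not in it. The parked tokens make room, `u` slides to `v`, and the token
-- is absorbed; the tokens of `r` outside the closed neighbourhood are a frame that conflicts with
-- nothing in `C`, nor with `v`.
theorem enter (B : Absorber G C k w) {u v : V} {r : Multiset V} (huv : G.Adj u v)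
    (hu : u ∉ reach G C) (hv : v ∈ reach G C)
    (h1 : ConflictFree (Clash G.Adj (H ∪ C)) (u ::ₘ r))
    (h2 : ConflictFree (Clash G.Adj (H ∪ C)) (v ::ₘ r)) (hr : r.card < k) :
    Slides G.Adj (Clash G.Adj H) (B.norm (u ::ₘ r)) (B.norm (v ::ₘ r)) := by
  have hvC : v ∉ C := fun h => hu (Or.inr ⟨v, h, huv⟩)
  have hvW : v ∉ B.W := fun h => hvC (B.W_sub v h)
  rw [norm_cons_of_notMem B r hu, norm_cons_of_mem B r hv]
  set r0 := r.filter (· ∉ reach G C) with hr0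
  set j := (r.filter (· ∈ reach G C)).card with hj
  have hjk : j < k := lt_of_le_of_lt (Multiset.card_le_card (Multiset.filter_le _ _)) hr
  have hr0m : ∀ x ∈ r0, x ∉ reach G C := fun x hx => (Multiset.mem_filter.1 hx).2
  have hC : ∀ x ∈ r0, x ∉ C := fun x hx h => hr0m x hx (Or.inl h)
  have hle : r0 ≤ r := Multiset.filter_le _ _
  have e1 : ConflictFree (Clash G.Adj H) (u ::ₘ r0) := by
    refine conflictFree_of_notMem (h1.of_le symmRel_clash (Multiset.cons_le_cons u hle)) ?_
    intro x hx
    rcases Multiset.mem_cons.1 hx with rfl | hx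
    · exact fun h => hu (Or.inl h)
    · exact hC x hx
  have e2 : ConflictFree (Clash G.Adj H) (v ::ₘ r0) := by
    refine conflictFree_of_notMem (h2.of_le symmRel_clash (Multiset.cons_le_cons v hle)) ?_
    intro x hx
    rcases Multiset.mem_cons.1 hx with rfl | hx
    · exact hvC
    · exact hC x hx
  have hanti : ∀ x y, Clash G.Adj H x y → Clash G.Adj ∅ x y := Clash.anti (Set.empty_subset _)
  obtain ⟨m, hmW, hmv, hm1, hm2⟩ := B.room v hvW hv j hjk
  have f1 := hm1.frame (F' := Clash G.Adj H) (o := u ::ₘ r0) (B.park_mem j hjk.le) symmRel_clash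
    hanti e1 (by
      intro x hx y hy
      have hy := B.W_sub y hy
      rcases Multiset.mem_cons.1 hx with rfl | hx
      · exact not_clash_of_notMem_reach hu hy
      · exact not_clash_of_notMem_reach (hr0m x hx) hy)
  have f3 := hm2.frame (F' := Clash G.Adj H) (o := r0)
    (by
      intro x hx
      rcases Multiset.mem_cons.1 hx with rfl | hx
      · exact Or.inr (B.mem_path _)
      · exact Or.inl (hmW x hx)) symmRel_clash hanti ((conflictFree_cons symmRel_clash).1 e2).1 (by
      intro x hx y hy
      have hyC : y ∈ C ∨ y = v := by
        rcases hy with hy | hy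
        · exact Or.inl (B.W_sub y hy)
        · exact B.path_sub v y hy
      rcases hyC with hy | rfl
      · exact not_clash_of_notMem_reach (hr0m x hx) hy
      · exact fun hc => ((conflictFree_cons symmRel_clash).1 e2).2 x hx (symmRel_clash hc))
  have g1 : ConflictFree (Clash G.Adj H) (m + u ::ₘ r0) :=
    f1.conflictFree ((conflictFree_add symmRel_clash).2 ⟨(B.park_free j hjk.le).mono hanti, e1, by
      intro x hx y hy hc
      have hx := B.W_sub x (B.park_mem j hjk.le x hx)
      rcases Multiset.mem_cons.1 hy with rfl | hy
      · exact not_clash_of_notMem_reach hu hx (symmRel_clash hc)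
      · exact not_clash_of_notMem_reach (hr0m y hy) hx (symmRel_clash hc)⟩)
  have g2 : ConflictFree (Clash G.Adj H) (m + v ::ₘ r0) := by
    have g1' := (conflictFree_add symmRel_clash).1 g1
    refine (conflictFree_add symmRel_clash).2 ⟨g1'.1, e2, ?_⟩
    intro x hx y hy hc
    rcases Multiset.mem_cons.1 hy with rfl | hy
    · have := hmv x hx
      rcases hc.2.2 with h | h
      · exact this.1 h.symm
      · exact this.2 h.symm
    · exact not_clash_of_notMem_reach (hr0m y hy) (B.W_sub x (hmW x hx)) (symmRel_clash hc)
  rw [Multiset.add_cons] at g1 g2 f1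
  rw [Multiset.add_cons] at f1
  have f2 := Slides.single huv g1 g2
  rw [Multiset.cons_add] at f3
  have := (f1.trans f2).trans f3
  rwa [add_comm, add_comm _ r0, ← Multiset.cons_add] at this

/-- A slide inside the closed neighbourhood of `C` leaves `B.norm` unchanged, a slide outside it is
not disturbed by the parked tokens, and leaving is entering in reverse. -/
theorem norm_slides (B : Absorber G C k w) {a a' : Multiset V} (ha : a.card = k)
    (h : SlideStep G.Adj (Clash G.Adj (H ∪ C)) a a') :
    Slides G.Adj (Clash G.Adj H) (B.norm a) (B.norm a') := by
  classical
  obtain ⟨u, v, r, rfl, rfl, huv, h1, h2⟩ := h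
  have hr : r.card < k := by rw [← ha, Multiset.card_cons]; omega
  by_cases hu : u ∈ reach G C <;> by_cases hv : v ∈ reach G C
  · rw [norm_cons_of_mem B r hu, norm_cons_of_mem B r hv]
    exact Slides.refl _
  · exact (B.enter huv.symm hv hu h2 h1 hr).symm symmRel_adj
  · exact B.enter huv hu hv h1 h2 hr
  · rw [norm_cons_of_notMem B r hu, norm_cons_of_notMem B r hv]
    have hjk : (r.filter (· ∈ reach G C)).card ≤ k :=
      (Multiset.card_le_card (Multiset.filter_le _ _)).trans hr.le
    have key : ∀ x, x ∉ reach G C → ConflictFree (Clash G.Adj (H ∪ C)) (x ::ₘ r) →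
        ConflictFree (Clash G.Adj H) (x ::ₘ (r.filter (· ∉ reach G C) +
          B.park (r.filter (· ∈ reach G C)).card)) := by
      intro x hx hc
      rw [← Multiset.cons_add, conflictFree_add symmRel_clash]
      have hmem : ∀ y ∈ x ::ₘ r.filter (· ∉ reach G C), y ∉ reach G C := by
        intro y hy
        rcases Multiset.mem_cons.1 hy with rfl | hy
        · exact hx
        · exact (Multiset.mem_filter.1 hy).2
      refine ⟨conflictFree_of_notMem (hc.of_le symmRel_clash
        (Multiset.cons_le_cons x (Multiset.filter_le _ _))) fun y hy h => hmem y hy (Or.inl h),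
        (B.park_free _ hjk).mono (Clash.anti (Set.empty_subset _)), ?_⟩
      intro y hy z hz
      exact not_clash_of_notMem_reach (hmem y hy) (B.W_sub z (B.park_mem _ hjk z hz))
    rw [Multiset.cons_add, Multiset.cons_add]
    exact Slides.single huv (key u hu h1) (key v hv h2)

theorem norm_slides_of_slides (B : Absorber G C k w) {a a' : Multiset V} (ha : a.card = k)
    (h : Slides G.Adj (Clash G.Adj (H ∪ C)) a a') :
    Slides G.Adj (Clash G.Adj H) (B.norm a) (B.norm a') := by
  induction h with
  | refl => exact Slides.refl _
  | tail hs hst ih => exact ih.trans (B.norm_slides ((Slides.card_eq hs).trans ha) hst)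

open Classical in
/-- A vertex of large degree has a neighbour off `Z` that is away from the vertices of `Φ`. -/
theorem exists_aside [Fintype V] (h4 : ∀ a b c d, a ≠ c → G.Adj a b → G.Adj b c → G.Adj a d →
    G.Adj d c → b = d) (Z Φ : Finset V) (b : V) (hb : Z.card + 2 * Φ.card < G.degree b) :
    ∃ x, G.Adj b x ∧ x ∉ Z ∧ ∀ f ∈ Φ, f ≠ b → x ≠ f ∧ ¬ G.Adj x f := by
  by_contra! hcon
  -- A bad neighbour of `b` is in `Z`, in `Φ`, or a common neighbour of `b` and some `f ∈ Φ`. By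
  -- `h4` there is at most one of the last kind for each `f`, whence the bound `Z.card + 2 *
  -- Φ.card`.
  have hsub : G.neighborFinset b ⊆ Z ∪ (Φ ∪ Φ.biUnion fun f =>
      (G.neighborFinset b).filter fun x => f ≠ b ∧ G.Adj x f) := by
    intro x hx
    rw [SimpleGraph.mem_neighborFinset] at hx
    by_cases hxZ : x ∈ Z
    · simp [hxZ]
    obtain ⟨f, hf, hfb, h⟩ := hcon x hx hxZ
    by_cases hxf : x = f
    · simp [hxf, hf]
    · simp only [Finset.mem_union, Finset.mem_biUnion, Finset.mem_filter,
        SimpleGraph.mem_neighborFinset]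
      exact Or.inr (Or.inr ⟨f, hf, hx, hfb, h hxf⟩)
  have h1 := Finset.card_le_card hsub
  have h2 := Finset.card_union_le Z (Φ ∪ Φ.biUnion fun f =>
      (G.neighborFinset b).filter fun x => f ≠ b ∧ G.Adj x f)
  have h3 := Finset.card_union_le Φ (Φ.biUnion fun f =>
      (G.neighborFinset b).filter fun x => f ≠ b ∧ G.Adj x f)
  have h5 : (Φ.biUnion fun f =>
      (G.neighborFinset b).filter fun x => f ≠ b ∧ G.Adj x f).card ≤ Φ.card * 1 := by
    refine Finset.card_biUnion_le_card_mul _ _ _ fun f _ => Finset.card_le_one.2 ?_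
    intro x hx y hy
    simp only [Finset.mem_filter, SimpleGraph.mem_neighborFinset] at hx hy
    exact h4 b x f y hx.2.1.symm hx.1 hx.2.2 hy.1 hy.2.2
  rw [SimpleGraph.card_neighborFinset_eq_degree] at h1
  omega

open Classical in
/-- The tokens on the vertices of large degree in `R` can step aside, to places from which they can
be absorbed one after the other. -/
theorem exists_asides [Fintype V] (h4 : ∀ a b c d, a ≠ c → G.Adj a b → G.Adj b c → G.Adj a d →
    G.Adj d c → b = d) (B : Absorber G C k w) (Z : Finset V) (hCZ : ∀ x ∈ C, x ∉ Z) (n : ℕ) :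
    ∀ (R : Multiset V) (Φ : Finset V), R.card = n → B.W ⊆ Φ →
      (∀ b ∈ R, b ∈ Z ∧ Z.card + 2 * (Φ.card + 2 * n) < G.degree b) →
      ∃ l : List (V × V), ((l.map Prod.fst : List V) : Multiset V) = R ∧
        (∀ p ∈ l, G.Adj p.1 p.2 ∧ p.2 ∉ Z ∧ ∀ f ∈ Φ, f ≠ p.1 → p.2 ≠ f ∧ ¬ G.Adj p.2 f) ∧
        l.Pairwise fun p q => q.2 ≠ p.2 ∧ ¬ G.Adj q.2 p.2 ∧
          (p.2 ∈ C → q.2 ∈ C → ∀ y ∈ B.path p.2, q.2 ≠ y ∧ ¬ G.Adj q.2 y) := by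
  induction n with
  | zero =>
    intro R Φ hR _ _
    exact ⟨[], by simpa using (Multiset.card_eq_zero.1 hR).symm, by simp, List.Pairwise.nil⟩
  | succ n ih =>
    intro R Φ hR hW hdeg
    let cand : Finset (V × V) := Finset.univ.filter fun p => p.1 ∈ R ∧ G.Adj p.1 p.2 ∧ p.2 ∉ Z ∧
      ∀ f ∈ Φ, f ≠ p.1 → p.2 ≠ f ∧ ¬ G.Adj p.2 f
    have hne : cand.Nonempty := by
      obtain ⟨b, hb⟩ := Multiset.card_pos_iff_exists_mem.1 (by omega : 0 < R.card)
      obtain ⟨x, h1, h2, h3⟩ := exists_aside h4 Z Φ b (by have := (hdeg b hb).2; omega)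
      exact ⟨(b, x), by simpa [cand] using ⟨hb, h1, h2, h3⟩⟩
    -- A candidate of least level goes first, with level zero off `C`. Enlarging `Φ` by `x` and
    -- `B.next x` keeps all later positions away from both, at a cost of two per token; as these
    -- positions were candidates already, their levels are no smaller. These are the hypotheses of
    -- `B.geo`.
    obtain ⟨⟨b, x⟩, hp, hmin⟩ := cand.exists_min_image
      (fun p => if p.2 ∈ C then B.level p.2 else 0) hne
    simp only [cand, Finset.mem_filter, Finset.mem_univ, true_and, Prod.forall] at hp hmin
    obtain ⟨hbR, hbx, hxZ, hxΦ⟩ := hp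
    have hcard : (insert x (insert (B.next x) Φ)).card ≤ Φ.card + 2 :=
      (Finset.card_insert_le _ _).trans (Nat.succ_le_succ (Finset.card_insert_le _ _))
    obtain ⟨l, hl1, hl2, hl3⟩ := ih (R.erase b) (insert x (insert (B.next x) Φ))
      (by rw [Multiset.card_erase_of_mem hbR, hR]; rfl)
      (hW.trans fun y hy => Finset.mem_insert_of_mem (Finset.mem_insert_of_mem hy))
      (fun b' hb' => by
        have := hdeg b' (Multiset.mem_of_mem_erase hb')
        exact ⟨this.1, by omega⟩)
    have hmemR : ∀ p ∈ l, p.1 ∈ R := by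
      intro p hp
      have : p.1 ∈ ((l.map Prod.fst : List V) : Multiset V) :=
        Multiset.mem_coe.2 (List.mem_map_of_mem hp)
      rw [hl1] at this
      exact Multiset.mem_of_mem_erase this
    refine ⟨(b, x) :: l, ?_, ?_, ?_⟩
    · rw [List.map_cons, ← Multiset.cons_coe, hl1, Multiset.cons_erase hbR]
    · intro p hp
      rcases List.mem_cons.1 hp with rfl | hp
      · exact ⟨hbx, hxZ, hxΦ⟩
      · obtain ⟨h1, h2, h3⟩ := hl2 p hp
        exact ⟨h1, h2, fun f hf => h3 f (by simp [hf])⟩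
    · refine List.pairwise_cons.2 ⟨?_, hl3⟩
      intro q hq
      obtain ⟨h1, h2, h3⟩ := hl2 q hq
      have hqR := hmemR q hq
      have hqZ := (hdeg _ hqR).1
      have hx : q.2 ≠ x ∧ ¬ G.Adj q.2 x := h3 x (by simp) fun h => hxZ (h ▸ hqZ)
      refine ⟨hx.1, hx.2, fun hxC hqC => ?_⟩
      have hxW : x ∉ B.W := fun h =>
        (hxΦ x (hW h) fun h' => hxZ (h' ▸ (hdeg b hbR).1)).1 rfl
      have hnext := h3 (B.next x) (by simp) fun h =>
        hCZ _ (B.next_mem x hxC hxW) (h ▸ hqZ)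
      refine B.geo x hxC hxW q.2 hqC ?_ hx.1 hx.2 hnext.1 hnext.2
      have := hmin q.1 q.2 ⟨hqR, h1, h2, fun f hf => h3 f (by simp [hf])⟩
      simpa only [if_pos hxC, if_pos hqC] using this

open Classical in
/-- Tokens that have stepped aside are absorbed one after the other. -/
theorem slides_absorb (B : Absorber G C k w) (Z : Set V)
    (hN : ∀ x ∈ C, ∀ y, G.Adj x y → y ∈ C ∨ y ∈ Z) (xs : List V) :
    ∀ (E : Multiset V) (j : ℕ), j + (xs.filter (· ∈ C)).length ≤ k →
      ConflictFree (Clash G.Adj H) (E + (xs : Multiset V)) →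
      (∀ e ∈ E, e ∉ reach G C) →
      (∀ x ∈ xs, x ∉ Z ∧ ∀ y ∈ B.W, x ≠ y ∧ ¬ G.Adj x y) →
      (xs.Pairwise fun x q => x ∈ C → q ∈ C → ∀ y ∈ B.path x, q ≠ y ∧ ¬ G.Adj q y) →
      Slides G.Adj (Clash G.Adj H) (E + (xs : Multiset V) + B.park j)
        (E + (xs.filter (· ∉ C) : List V) + B.park (j + (xs.filter (· ∈ C)).length)) := by
  induction xs with
  | nil => intro E j _ _ _ _ _; simpa using Slides.refl _
  | cons x xs ih =>
    intro E j hj hcf hE hxs hpw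
    rw [List.pairwise_cons] at hpw
    have hx := hxs x (by simp)
    have hanti : ∀ x y, Clash G.Adj H x y → Clash G.Adj ∅ x y := Clash.anti (Set.empty_subset _)
    have hout : ∀ y, y ∉ Z → y ∉ C → y ∉ reach G C := by
      rintro y hyZ hyC (h | ⟨z, hz, hzy⟩)
      · exact hyC h
      · exact (hN z hz y hzy.symm).elim hyC hyZ
    -- A token on `C` is absorbed past the waiting ones. A token off `C` is also off `Z`, hence
    -- outside the closed neighbourhood of `C`, and joins the passive tokens `E`.
    by_cases hxC : x ∈ C
    · have e1 : (x :: xs).filter (· ∈ C) = x :: xs.filter (· ∈ C) :=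
        List.filter_cons_of_pos (by simpa using hxC)
      have e2 : (x :: xs).filter (· ∉ C) = xs.filter (· ∉ C) :=
        List.filter_cons_of_neg (by simpa using hxC)
      rw [e1, List.length_cons] at hj
      rw [e1, e2, List.length_cons]
      have hxW : x ∉ B.W := fun h => (hx.2 x h).1 rfl
      rw [← Multiset.cons_coe, Multiset.add_cons] at hcf
      have hcf' := (conflictFree_cons symmRel_clash).1 hcf
      have hih := ih E (j + 1) (by omega) hcf'.1 hE
        (fun y hy => hxs y (by simp [hy])) hpw.2
      rw [show j + 1 + (xs.filter (· ∈ C)).length = j + ((xs.filter (· ∈ C)).length + 1) by omega]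
        at hih
      refine Slides.trans ?_ hih
      obtain ⟨m, hmW, hmv, hm1, hm2⟩ := B.room x hxW (Or.inl hxC) j (by omega)
      have f1 := hm1.frame (F' := Clash G.Adj H) (o := x ::ₘ (E + (xs : Multiset V)))
        (B.park_mem j (by omega)) symmRel_clash hanti hcf (by
          intro y hy u hu
          rcases Multiset.mem_cons.1 hy with rfl | hy
          · rintro ⟨-, -, h | h⟩
            · exact (hx.2 u hu).1 h
            · exact (hx.2 u hu).2 h
          rcases Multiset.mem_add.1 hy with hy | hy
          · exact not_clash_of_notMem_reach (hE y hy) (B.W_sub u hu)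
          · have := (hxs y (List.mem_cons_of_mem _ hy)).2 u hu
            rintro ⟨-, -, h | h⟩
            · exact this.1 h
            · exact this.2 h)
      have f2 := hm2.frame (F' := Clash G.Adj H) (o := E + (xs : Multiset V)) (by
          intro y hy
          rcases Multiset.mem_cons.1 hy with rfl | hy
          · exact Or.inr (B.mem_path _)
          · exact Or.inl (hmW y hy)) symmRel_clash hanti hcf'.1 (by
          intro y hy u hu
          have huC : u ∈ C := by
            rcases hu with hu | hu
            · exact B.W_sub u hu
            · exact (B.path_sub x u hu).elim id fun h => h ▸ hxC
          rcases Multiset.mem_add.1 hy with hy | hy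
          · exact not_clash_of_notMem_reach (hE y hy) huC
          have hyx := hxs y (List.mem_cons_of_mem _ hy)
          by_cases hyC : y ∈ C
          · have : y ≠ u ∧ ¬ G.Adj y u := by
              rcases hu with hu | hu
              · exact hyx.2 u hu
              · exact hpw.1 y hy hxC hyC u hu
            rintro ⟨-, -, h | h⟩
            · exact this.1 h
            · exact this.2 h
          · exact not_clash_of_notMem_reach (hout y hyx.1 hyC) huC)
      rw [← Multiset.cons_coe, Multiset.add_cons, add_comm, add_comm _ (B.park (j + 1))]
      refine f1.trans ?_
      rwa [Multiset.add_cons, ← Multiset.cons_add]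
    · have e1 : (x :: xs).filter (· ∈ C) = xs.filter (· ∈ C) :=
        List.filter_cons_of_neg (by simpa using hxC)
      have e2 : (x :: xs).filter (· ∉ C) = x :: xs.filter (· ∉ C) :=
        List.filter_cons_of_pos (by simpa using hxC)
      rw [e1] at hj
      rw [e1, e2]
      rw [← Multiset.cons_coe, Multiset.add_cons, ← Multiset.cons_add] at hcf
      rw [← Multiset.cons_coe, ← Multiset.cons_coe, Multiset.add_cons, Multiset.add_cons,
        ← Multiset.cons_add, ← Multiset.cons_add]
      refine ih (x ::ₘ E) j hj hcf ?_ (fun y hy => hxs y (by simp [hy])) hpw.2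
      intro e he
      rcases Multiset.mem_cons.1 he with rfl | he
      · exact hout e hx.1 hxC
      · exact hE e he

open Classical in
/-- A configuration on `Z` whose tokens next to `C` are on vertices of large degree can be
transformed into one in which these tokens have been absorbed. -/
theorem exists_slides_norm [Fintype V] (h4 : ∀ a b c d, a ≠ c → G.Adj a b → G.Adj b c →
    G.Adj a d → G.Adj d c → b = d) (B : Absorber G C k w) (Z : Finset V)
    (hCZ : ∀ x ∈ C, x ∉ Z) (hN : ∀ x ∈ C, ∀ y, G.Adj x y → y ∈ C ∨ y ∈ Z)
    (hHZ : ∀ x ∈ H, x ∉ Z) {s : Multiset V} (hs : s.card = k) (hsZ : ∀ x ∈ s, x ∈ Z)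
    (hsF : ConflictFree (Clash G.Adj H) s)
    (hdeg : ∀ b ∈ s, b ∈ reach G C → Z.card + 2 * (k + w + 2 * k) < G.degree b) :
    ∃ a, Slides G.Adj (Clash G.Adj H) s a ∧ Slides G.Adj (Clash G.Adj H) a (B.norm a) := by
  set R := s.filter (· ∈ reach G C) with hR
  set L := s.filter (· ∉ reach G C) with hL
  have hRs : R ≤ s := Multiset.filter_le _ _
  have hRk : R.card ≤ k := hs ▸ Multiset.card_le_card hRs
  have hLR : L + R = s := by rw [add_comm]; exact Multiset.filter_add_not _ _
  set Φ := s.toFinset ∪ B.W with hΦ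
  have hΦc : Φ.card ≤ k + w := (Finset.card_union_le _ _).trans
    (add_le_add ((Multiset.toFinset_card_le s).trans hs.le) B.W_card)
  obtain ⟨l, hl1, hl2, hl3⟩ := exists_asides h4 B Z hCZ R.card R Φ rfl Finset.subset_union_right
    (fun b hb => ⟨hsZ b (Multiset.mem_of_le hRs hb), by
      have := hdeg b (Multiset.mem_of_le hRs hb) (Multiset.mem_filter.1 hb).2
      omega⟩)
  have hfst : ∀ p ∈ l, p.1 ∈ R := fun p hp => by
    rw [← hl1]; exact Multiset.mem_coe.2 (List.mem_map_of_mem hp)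
  have hsn : s.Nodup := hsF.nodup symmRel_adj fun x hx h => hHZ x h (hsZ x hx)
  have hRn : (l.map Prod.fst).Nodup := by
    rw [← Multiset.coe_nodup, hl1]; exact Multiset.nodup_of_le hRs hsn
  have hne : l.Pairwise fun p q => p.1 ≠ q.1 := List.pairwise_map.1 hRn
  have haway : ∀ p ∈ l, ∀ f ∈ Φ, f ≠ p.1 → ¬ Clash G.Adj H p.2 f := by
    rintro p hp f hf hfp ⟨-, -, h | h⟩
    · exact ((hl2 p hp).2.2 f hf hfp).1 h
    · exact ((hl2 p hp).2.2 f hf hfp).2 h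
  have hsΦ : ∀ x ∈ s, x ∈ Φ := fun x hx => by simp [hΦ, hx]
  have hpw : l.Pairwise fun p q => ¬ Clash G.Adj H p.2 q.2 ∧ ¬ Clash G.Adj H p.2 q.1 ∧
      ¬ Clash G.Adj H q.2 p.1 := by
    refine (List.Pairwise.and hl3 hne).imp_of_mem ?_
    intro p q hp hq h
    refine ⟨?_, haway p hp _ (hsΦ _ (Multiset.mem_of_le hRs (hfst q hq))) h.2.symm,
      haway q hq _ (hsΦ _ (Multiset.mem_of_le hRs (hfst p hp))) h.2⟩
    rintro ⟨-, -, h' | h'⟩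
    · exact h.1.1 h'.symm
    · exact h.1.2.1 h'.symm
  have step1 := Slides.asides symmRel_clash L l (by rw [hl1, hLR]; exact hsF)
    (fun p hp => ⟨(hl2 p hp).1, fun y hy => haway p hp y (hsΦ y (Multiset.mem_of_mem_filter hy))
      (by
        rintro rfl
        exact (Multiset.mem_filter.1 hy).2 (Multiset.mem_filter.1 (hfst p hp)).2)⟩) hpw
  rw [hl1, hLR] at step1
  refine ⟨_, step1, ?_⟩
  have hxs : ∀ x ∈ l.map Prod.snd, x ∉ Z ∧ ∀ y ∈ B.W, x ≠ y ∧ ¬ G.Adj x y := by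
    intro x hx
    obtain ⟨p, hp, rfl⟩ := List.mem_map.1 hx
    refine ⟨(hl2 p hp).2.1, fun y hy => (hl2 p hp).2.2 y (by simp [hΦ, hy]) ?_⟩
    rintro rfl
    exact hCZ _ (B.W_sub _ hy) (hsZ _ (Multiset.mem_of_le hRs (hfst p hp)))
  have hLout : ∀ e ∈ L, e ∉ reach G C := fun e he => (Multiset.mem_filter.1 he).2
  have hlen : ((l.map Prod.snd).filter (· ∈ C)).length ≤ k := by
    refine (List.length_filter_le _ _).trans ?_
    have := congrArg Multiset.card hl1
    simp only [Multiset.coe_card, List.length_map] at this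
    rw [List.length_map, this]
    exact hRk
  have step2 := B.slides_absorb (H := H) Z hN (l.map Prod.snd) L 0 (by rwa [zero_add])
    (step1.conflictFree hsF) hLout hxs
    (List.pairwise_map.2 (hl3.imp fun h => h.2.2))
  have hp0 : B.park 0 = 0 := Multiset.card_eq_zero.1 (B.park_card 0 (Nat.zero_le _))
  rw [hp0, add_zero, zero_add] at step2
  -- The new positions avoid `Z`, and all neighbours of `C` outside `C` are in `Z`. So the tokens
  -- that `norm` parks are exactly those standing on `C`.
  have hiff : ∀ x ∈ l.map Prod.snd, (x ∈ reach G C ↔ x ∈ C) := by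
    intro x hx
    refine ⟨?_, Or.inl⟩
    rintro (h | ⟨z, hz, hzy⟩)
    · exact h
    · exact (hN z hz x hzy.symm).elim id fun h => absurd h (hxs x hx).1
  have e1 : (L + ((l.map Prod.snd : List V) : Multiset V)).filter (· ∉ reach G C) =
      L + ((l.map Prod.snd).filter (· ∉ C) : List V) := by
    rw [Multiset.filter_add, Multiset.filter_eq_self.2 hLout, Multiset.filter_coe]
    congr 2
    exact List.filter_congr fun x hx => by simp [hiff x hx]
  have e2 : ((L + ((l.map Prod.snd : List V) : Multiset V)).filter (· ∈ reach G C)).card =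
      ((l.map Prod.snd).filter (· ∈ C)).length := by
    rw [Multiset.filter_add, Multiset.filter_eq_nil.2 hLout, Multiset.filter_coe, zero_add,
      Multiset.coe_card]
    congr 1
    exact List.filter_congr fun x hx => by simp [hiff x hx]
  rw [norm, e1, e2]
  exact step2

open Classical in
/-- Between configurations on `Z` whose tokens next to `C` are on vertices of large degree, slides
in which the tokens on `C` clash with no token can be replaced by slides without this licence. -/
theorem slides_of_slides_union [Fintype V] (h4 : ∀ a b c d, a ≠ c → G.Adj a b → G.Adj b c →
    G.Adj a d → G.Adj d c → b = d) (B : Absorber G C k w) (Z : Finset V)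
    (hCZ : ∀ x ∈ C, x ∉ Z) (hN : ∀ x ∈ C, ∀ y, G.Adj x y → y ∈ C ∨ y ∈ Z)
    (hHZ : ∀ x ∈ H, x ∉ Z) {s t : Multiset V} (hs : s.card = k) (hsZ : ∀ x ∈ s, x ∈ Z)
    (hsF : ConflictFree (Clash G.Adj H) s) (ht : t.card = k) (htZ : ∀ x ∈ t, x ∈ Z)
    (htF : ConflictFree (Clash G.Adj H) t)
    (hdeg : ∀ b, b ∈ s ∨ b ∈ t → b ∈ reach G C → Z.card + 2 * (k + w + 2 * k) < G.degree b)
    (h : Slides G.Adj (Clash G.Adj (H ∪ C)) s t) : Slides G.Adj (Clash G.Adj H) s t := by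
  obtain ⟨a, ha1, ha2⟩ := B.exists_slides_norm h4 Z hCZ hN hHZ hs hsZ hsF
    fun b hb => hdeg b (Or.inl hb)
  obtain ⟨c, hc1, hc2⟩ := B.exists_slides_norm h4 Z hCZ hN hHZ ht htZ htF
    fun b hb => hdeg b (Or.inr hb)
  have hanti : ∀ x y, Clash G.Adj (H ∪ C) x y → Clash G.Adj H x y :=
    Clash.anti Set.subset_union_left
  -- With the licence, `a` reaches `c` by way of `s` and `t`. Applying `norm` to this run removes
  -- the licence, and `a` and `c` are linked to their normal forms by honest slides.
  have hac : Slides G.Adj (Clash G.Adj (H ∪ C)) a c :=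
    ((ha1.symm symmRel_adj).mono (fun _ _ => id) hanti).trans
      (h.trans (hc1.mono (fun _ _ => id) hanti))
  have hacard : a.card = k := ha1.card_eq.trans hs
  exact ha1.trans (ha2.trans ((B.norm_slides_of_slides hacard hac).trans
    ((hc2.symm symmRel_adj).trans (hc1.symm symmRel_adj))))

end Absorber

end Absorbing

/-! ### Shortest paths towards a parking place -/

section Levels

variable {V : Type*} (G : SimpleGraph V)

/-- The vertices from which `Θ` can be reached in at most `n` steps inside `U`. -/
def layer (U Θ : Set V) : ℕ → Set V
  | 0 => Θ
  | n + 1 => layer U Θ n ∪ {x | x ∈ U ∧ ∃ y ∈ layer U Θ n, G.Adj x y}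

/-- The distance to `Θ` inside `U`. -/
noncomputable def level (U Θ : Set V) (x : V) : ℕ := sInf {n | x ∈ layer G U Θ n}

variable {G} {U U' Θ : Set V}

theorem layer_mono {m n : ℕ} (h : m ≤ n) : layer G U Θ m ⊆ layer G U Θ n := by
  induction h with
  | refl => exact subset_rfl
  | step _ ih => exact ih.trans Set.subset_union_left

theorem layer_mono_left (h : U ⊆ U') (n : ℕ) : layer G U Θ n ⊆ layer G U' Θ n := by
  induction n with
  | zero => exact subset_rfl
  | succ n ih =>
    rintro x (hx | ⟨hx, y, hy, hxy⟩)
    · exact Or.inl (ih hx)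
    · exact Or.inr ⟨h hx, y, ih hy, hxy⟩

/-- As `sInf ∅ = 0`, the level is a distance only for vertices that lie in some layer; hence the
membership hypotheses here and below. -/
theorem mem_layer_level {x : V} {n : ℕ} (h : x ∈ layer G U Θ n) :
    x ∈ layer G U Θ (level G U Θ x) :=
  Nat.sInf_mem (s := {n | x ∈ layer G U Θ n}) ⟨n, h⟩

theorem level_le {x : V} {n : ℕ} (h : x ∈ layer G U Θ n) : level G U Θ x ≤ n := Nat.sInf_le h

theorem level_le_succ {x y : V} {n : ℕ} (hx : x ∈ U) (hxy : G.Adj x y) (hy : y ∈ layer G U Θ n) :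
    level G U Θ x ≤ level G U Θ y + 1 :=
  level_le (Or.inr ⟨hx, y, mem_layer_level hy, hxy⟩)

theorem exists_level_pred {x : V} {n m : ℕ} (hx : x ∈ layer G U Θ m)
    (hn : level G U Θ x = n + 1) :
    x ∈ U ∧ ∃ y, y ∈ layer G U Θ n ∧ level G U Θ y = n ∧ G.Adj x y := by
  have h := mem_layer_level hx
  rw [hn] at h
  rcases h with h | ⟨hU, y, hy, hxy⟩
  · have := level_le h
    omega
  · refine ⟨hU, y, hy, le_antisymm (level_le hy) ?_, hxy⟩
    have := level_le_succ hU hxy hy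
    omega

/-- A shortest path towards `Θ`, stopped at its vertex `q` of level one; `f` is the vertex after
`v`, or `v` itself if there is none. Levels strictly decrease along it, so everything after `f` lies
at least two levels below `v`, and `q` is the only vertex of level one. -/
theorem exists_path_levels (n : ℕ) : ∀ v m, v ∈ layer G U Θ m → level G U Θ v = n + 1 →
    ∃ (π : Set V) (q f : V), v ∈ π ∧ q ∈ π ∧ f ∈ π ∧
      (∀ p ∈ π, p ∈ U ∧ p ∈ layer G U Θ (n + 1) ∧ 1 ≤ level G U Θ p ∧
        (p = v ∨ level G U Θ p < level G U Θ v) ∧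
        (p = v ∨ p = f ∨ level G U Θ p + 2 ≤ level G U Θ v) ∧
        (level G U Θ p = 1 → p = q) ∧ (level G U Θ p = 2 → G.Adj p q)) ∧
      level G U Θ q = 1 ∧ Slides (Within G.Adj π) (Clash G.Adj ∅) {v} {q} := by
  induction n with
  | zero =>
    intro v m hv hlv
    obtain ⟨hvU, -⟩ := exists_level_pred hv hlv
    refine ⟨{v}, v, v, rfl, rfl, rfl, ?_, hlv, Slides.refl _⟩
    rintro p rfl
    exact ⟨hvU, hlv ▸ mem_layer_level hv, by omega, Or.inl rfl, Or.inl rfl, fun _ => rfl,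
      fun h => by omega⟩
  | succ n ih =>
    intro v m hv hlv
    obtain ⟨hvU, y, hy, hly, hvy⟩ := exists_level_pred hv hlv
    obtain ⟨π, q, f, hyπ, hqπ, hfπ, hπ, hq, hs⟩ := ih y _ hy hly
    refine ⟨insert v π, q, y, Set.mem_insert _ _, Set.mem_insert_of_mem _ hqπ,
      Set.mem_insert_of_mem _ hyπ, ?_, hq, ?_⟩
    · rintro p (rfl | hp)
      · refine ⟨hvU, hlv ▸ mem_layer_level hv, by omega, Or.inl rfl, Or.inl rfl,
          fun h => by omega, fun h => ?_⟩
        have := (hπ y hyπ).2.2.2.2.2.1 (by omega)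
        exact this ▸ hvy
      · obtain ⟨h1, h2, h3, h4, h5, h6, h7⟩ := hπ p hp
        refine ⟨h1, layer_mono (Nat.le_succ _) h2, h3, Or.inr ?_, ?_, h6, h7⟩
        · rcases h4 with rfl | h4 <;> omega
        · rcases h4 with rfl | h4
          · exact Or.inr (Or.inl rfl)
          · exact Or.inr (Or.inr (by omega))
    · have h1 : Slides (Within G.Adj (insert v π)) (Clash G.Adj ∅) {v} {y} :=
        Slides.single (r := 0) ⟨hvy, Set.mem_insert _ _, Set.mem_insert_of_mem _ hyπ⟩
          (conflictFree_singleton _ _) (conflictFree_singleton _ _)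
      exact h1.trans (hs.mono (fun _ _ h => ⟨h.1, Set.mem_insert_of_mem _ h.2.1,
        Set.mem_insert_of_mem _ h.2.2⟩) fun _ _ => id)

theorem exists_mem_layer {C : Set V} (hconn : ∀ x ∈ C, ∀ y ∈ C,
    ReflTransGen (Within G.Adj C) x y) {θ : V} (hθ : θ ∈ Θ) (hθC : θ ∈ C) {x : V} (hx : x ∈ C) :
    ∃ n, x ∈ layer G C Θ n := by
  have h := hconn x hx θ hθC
  induction h using ReflTransGen.head_induction_on with
  | refl => exact ⟨0, hθ⟩
  | head hxy _ ih =>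
    obtain ⟨n, hn⟩ := ih hxy.2.2
    exact ⟨n + 1, Or.inr ⟨hxy.2.1, _, hn, hxy.1⟩⟩

/-- A way for a token from `v` to a vertex `q` next to `Θ`, inside `C` except for `v`. -/
structure Approach (G : SimpleGraph V) (C Θ : Set V) (v : V) (π : Set V) (q : V) : Prop where
  v_mem : v ∈ π
  q_mem : q ∈ π
  sub : ∀ p ∈ π, p ∈ C ∨ p = v
  notMem : ∀ p ∈ π, p ∉ Θ
  adj : ∃ θ ∈ Θ, G.Adj q θ
  away : ∀ p ∈ π, p ≠ q → ∀ θ ∈ Θ, ¬ G.Adj p θ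
  away' : ∀ p ∈ π, p ≠ q → ∀ x ∈ C, (∃ θ ∈ Θ, G.Adj x θ) → G.Adj p x → G.Adj p q
  slides : Slides (Within G.Adj π) (Clash G.Adj ∅) {v} {q}

/-- Distances are taken in `insert v C`, because `v` may lie outside `C`. On a shortest path all
vertices except `q` have level at least two, so they are not adjacent to `Θ`, and one that is
adjacent to a neighbour of `Θ` has level exactly two and hence precedes `q`. A vertex whose level is
at least that of `v` is not adjacent to vertices two levels below `v`. -/
theorem exists_approach {C : Set V} (hconn : ∀ x ∈ C, ∀ y ∈ C,
    ReflTransGen (Within G.Adj C) x y) {θ : V} (hθ : θ ∈ Θ) (hΘC : Θ ⊆ C) {v : V} (hv : v ∉ Θ)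
    (hvC : v ∈ C ∨ ∃ x ∈ C, G.Adj v x) :
    ∃ (π : Set V) (q f : V), Approach G C Θ v π q ∧ (v ∈ C → f ∈ C ∧ ∀ y ∈ C,
      level G C Θ v ≤ level G C Θ y → y ≠ v → ¬ G.Adj y v → y ≠ f → ¬ G.Adj y f →
      ∀ p ∈ π, y ≠ p ∧ ¬ G.Adj y p) := by
  have hC : ∀ x ∈ C, ∃ n, x ∈ layer G (insert v C) Θ n := fun x hx =>
    (exists_mem_layer hconn hθ (hΘC hθ) hx).imp fun n hn =>
      layer_mono_left (Set.subset_insert v C) n hn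
  have hv' : ∃ n, v ∈ layer G (insert v C) Θ n := by
    rcases hvC with h | ⟨x, hx, hvx⟩
    · exact hC v h
    · obtain ⟨n, hn⟩ := hC x hx
      exact ⟨n + 1, Or.inr ⟨Set.mem_insert _ _, x, hn, hvx⟩⟩
  obtain ⟨m, hm⟩ := hv'
  have hlv : level G (insert v C) Θ v ≠ 0 := fun h => hv (by
    have := mem_layer_level hm
    rwa [h] at this)
  obtain ⟨n, hn⟩ := Nat.exists_eq_succ_of_ne_zero hlv
  obtain ⟨π, q, f, h1, h2, h3, h4, h5, h6⟩ := exists_path_levels n v m hm hn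
  have hsub : ∀ p ∈ π, p ∈ C ∨ p = v := fun p hp => (h4 p hp).1.symm
  refine ⟨π, q, f, ⟨h1, h2, hsub, ?_, ?_, ?_, ?_, h6⟩, ?_⟩
  · intro p hp hpΘ
    have := (h4 p hp).2.2.1
    have : level G (insert v C) Θ p ≤ 0 := level_le hpΘ
    omega
  · obtain ⟨-, y, hy, -, hqy⟩ := exists_level_pred (h4 q h2).2.1 (show _ = 0 + 1 from h5)
    exact ⟨y, hy, hqy⟩
  · intro p hp hpq θ' hθ' hadj
    obtain ⟨hpU, -, hp1, -, -, h, -⟩ := h4 p hp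
    have : level G (insert v C) Θ p ≤ 1 := level_le (Or.inr ⟨hpU, θ', hθ', hadj⟩)
    exact hpq (h (by omega))
  · rintro p hp hpq x hx ⟨θ', hθ', hxθ⟩ hpx
    obtain ⟨hpU, -, hp1, -, -, h, h'⟩ := h4 p hp
    have hx1 : x ∈ layer G (insert v C) Θ 1 := Or.inr ⟨Set.mem_insert_of_mem _ hx, θ', hθ', hxθ⟩
    have : level G (insert v C) Θ p ≤ 2 := level_le (Or.inr ⟨hpU, x, hx1, hpx⟩)
    have : level G (insert v C) Θ p ≠ 1 := fun e => hpq (h e)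
    exact h' (by omega)
  · intro hvC
    rw [Set.insert_eq_of_mem hvC] at h4
    have hfC : f ∈ C := (h4 f h3).1
    refine ⟨hfC, fun y hy hvy hyv hyv' hyf hyf' p hp => ?_⟩
    obtain ⟨hpU, hpl, hp1, -, h, -⟩ := h4 p hp
    rcases h with rfl | rfl | h
    · exact ⟨hyv, hyv'⟩
    · exact ⟨hyf, hyf'⟩
    · refine ⟨?_, fun hadj => ?_⟩
      · rintro rfl
        omega
      · have := level_le_succ hy hadj hpl
        omega

/-- An absorber is given by a parking place `W` around a set `Θ` of vertices into which tokens that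
arrive next to `Θ` can be taken. -/
theorem nonempty_absorber {C : Set V} {k w : ℕ} (hconn : ∀ x ∈ C, ∀ y ∈ C,
    ReflTransGen (Within G.Adj C) x y) {θ : V} (hθ : θ ∈ Θ) (W : Finset V) (hΘW : Θ ⊆ W)
    (hWC : ∀ x ∈ W, x ∈ C) (hW : W.card ≤ w) (park : ℕ → Multiset V)
    (hpW : ∀ j ≤ k, ∀ x ∈ park j, x ∈ W) (hpc : ∀ j ≤ k, (park j).card = j)
    (hpf : ∀ j ≤ k, ConflictFree (Clash G.Adj ∅) (park j))
    (hroom : ∀ v π q, v ∉ W → Approach G C Θ v π q → ∀ j < k, ∃ m : Multiset V,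
      (∀ x ∈ m, x ∈ W) ∧ (∀ x ∈ m, ∀ p ∈ π, p ≠ x ∧ ¬ G.Adj p x) ∧
      Slides (Within G.Adj W) (Clash G.Adj ∅) (park j) m ∧
      Slides (Within G.Adj (W ∪ π)) (Clash G.Adj ∅) (q ::ₘ m) (park (j + 1))) :
    Nonempty (Absorber G C k w) := by
  have hex : ∀ v, ∃ (π : Set V) (q f : V), (v ∉ W → (v ∈ C ∨ ∃ x ∈ C, G.Adj v x) →
      Approach G C Θ v π q ∧ (v ∈ C → f ∈ C ∧ ∀ y ∈ C,
      level G C Θ v ≤ level G C Θ y → y ≠ v → ¬ G.Adj y v → y ≠ f → ¬ G.Adj y f →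
      ∀ p ∈ π, y ≠ p ∧ ¬ G.Adj y p)) ∧ (∀ p ∈ π, p ∈ C ∨ p = v) ∧ v ∈ π := by
    intro v
    by_cases hv : v ∉ W ∧ (v ∈ C ∨ ∃ x ∈ C, G.Adj v x)
    · obtain ⟨π, q, f, h1, h2⟩ := exists_approach hconn hθ (fun x hx => hWC x (hΘW hx))
        (fun h => hv.1 (hΘW h)) hv.2
      exact ⟨π, q, f, fun _ _ => ⟨h1, h2⟩, h1.sub, h1.v_mem⟩
    -- The trivial path, where no approach is needed, makes `path_sub` and `mem_path` hold
    -- unconditionally.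
    · exact ⟨{v}, v, v, fun h1 h2 => absurd ⟨h1, h2⟩ hv, fun p hp => Or.inr hp, rfl⟩
  choose π q f hA hsub hmem using hex
  refine ⟨{
    W := W, W_sub := hWC, W_card := hW, park := park, park_mem := hpW, park_card := hpc
    park_free := hpf, path := π, path_sub := hsub, mem_path := hmem
    level := level G C Θ, next := f
    next_mem := fun x hx hxW => ((hA x hxW (Or.inl hx)).2 hx).1
    geo := fun x hx hxW => ((hA x hxW (Or.inl hx)).2 hx).2
    room := ?_ }⟩
  intro v hvW hvC j hj
  obtain ⟨ha, -⟩ := hA v hvW hvC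
  obtain ⟨m, hmW, hmp, h1, h2⟩ := hroom v (π v) (q v) hvW ha j hj
  refine ⟨m, hmW, fun x hx => hmp x hx v (hmem v), h1, ?_⟩
  have hmF := h1.conflictFree (hpf j hj.le)
  -- The restriction is doubled: the inner one is kept for the conclusion, while the outer one lets
  -- `frame` be applied with `π v`, which the tokens of `m` avoid.
  have h3 : Slides (Within (Within G.Adj (W ∪ π v)) (π v)) (Clash G.Adj ∅) {v} {q v} :=
    ha.slides.mono (fun _ _ h => ⟨⟨h.1, Or.inr h.2.1, Or.inr h.2.2⟩, h.2⟩) fun _ _ => id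
  have h4 := h3.frame (F' := Clash G.Adj ∅) (o := m) (by simpa using hmem v)
    Absorber.symmRel_clash (fun _ _ => id) hmF (by
      rintro x hx p hp ⟨-, -, h | h⟩
      · exact (hmp x hx p hp).1 h.symm
      · exact (hmp x hx p hp).2 h.symm)
  rw [Multiset.singleton_add, Multiset.singleton_add] at h4
  exact h4.trans h2

end Levels

/-! ### Spiders absorb tokens -/

section Absorbers

variable {V : Type*} {G : SimpleGraph V}

theorem insert_val_of_notMem' [DecidableEq V] {J : Finset V} {a : V} (h : a ∉ J) :
    (insert a J).val = a ::ₘ J.val := Finset.insert_val_of_notMem h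

open Classical in
/-- A vertex `c` together with neighbours `x ∈ X` that have further, pairwise non-adjacent
neighbours `y x`. -/
structure Spider (G : SimpleGraph V) (C : Set V) (c : V) (X : Finset V) (y : V → V) : Prop where
  center : c ∈ C
  foot : ∀ x ∈ X, x ∈ C
  toe : ∀ x ∈ X, y x ∈ C
  adj_center : ∀ x ∈ X, G.Adj c x
  adj_toe : ∀ x ∈ X, G.Adj x (y x)
  toe_ne : ∀ x ∈ X, y x ≠ c
  indep : ∀ x ∈ X, ∀ x' ∈ X, ¬ G.Adj (y x) (y x')

variable (h3 : ∀ a b c, G.Adj a b → G.Adj b c → ¬ G.Adj a c)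
  (h4 : ∀ a b c d, a ≠ c → G.Adj a b → G.Adj b c → G.Adj a d → G.Adj d c → b = d)

include h3 h4

open Classical in
-- The tokens on the feet in `J` step out to their toes, the token on `q` crosses the centre to `b`,
-- and the others step back. A toe is neither equal nor adjacent to another neighbour of `c`, since
-- this would give a triangle or a 4-cycle; so nothing obstructs. It matters that `q` may be any
-- neighbour of `c`, not only a foot.
theorem Spider.swap {C : Set V} {c : V} {X : Finset V} {y : V → V} (S : Spider G C c X y)
    {J : Finset V} (hJ : J ⊆ X) {q b : V} (hq : G.Adj c q) (hqJ : q ∉ J) (hb : b ∈ X)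
    (hbJ : b ∉ J) :
    Slides (Within G.Adj (insert q ((insert c (X ∪ X.image y) : Finset V) : Set V)))
      (Clash G.Adj ∅) (q ::ₘ J.val) (b ::ₘ J.val) := by
  set U : Set V := insert q ((insert c (X ∪ X.image y) : Finset V) : Set V) with hU
  have hF : SymmRel (Clash G.Adj ∅) := Absorber.symmRel_clash
  have hqU : q ∈ U := Set.mem_insert _ _
  have hcU : c ∈ U := Set.mem_insert_of_mem _ (by simp)
  have hxU : ∀ x ∈ X, x ∈ U := fun x hx => Set.mem_insert_of_mem _ (by simp [hx])
  have hyU : ∀ x ∈ X, y x ∈ U := fun x hx => Set.mem_insert_of_mem _ (by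
    simp only [Finset.coe_insert, Finset.coe_union, Finset.coe_image, Set.mem_insert_iff,
      Set.mem_union, Set.mem_image, Finset.mem_coe]
    exact Or.inr (Or.inr ⟨x, hx, rfl⟩))
  have hfar : ∀ p, G.Adj c p → ∀ x ∈ X, p ≠ x → ¬ Clash G.Adj ∅ (y x) p ∧
      ¬ Clash G.Adj ∅ p x := by
    rintro p hp x hx hpx
    have hxy := S.adj_toe x hx
    have hcx := S.adj_center x hx
    refine ⟨?_, ?_⟩
    · rintro ⟨-, -, h | h⟩
      · exact h3 c x (y x) hcx hxy (h ▸ hp)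
      · exact hpx (h4 c p (y x) x (S.toe_ne x hx).symm hp h.symm hcx hxy)
    · rintro ⟨-, -, h | h⟩
      · exact hpx h
      · exact h3 c p x hp h hcx
  have hyy : ∀ x ∈ X, ∀ x' ∈ X, x ≠ x' → ¬ Clash G.Adj ∅ (y x) (y x') := by
    rintro x hx x' hx' hne ⟨-, -, h | h⟩
    · exact hne (h4 c x (y x) x' (S.toe_ne x hx).symm (S.adj_center x hx) (S.adj_toe x hx)
        (S.adj_center x' hx') (h ▸ S.adj_toe x' hx'))
    · exact S.indep x hx x' hx' h
  have hcf : ∀ p, G.Adj c p → p ∉ J → ConflictFree (Clash G.Adj ∅) (p ::ₘ J.val) := by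
    intro p hp hpJ
    rw [conflictFree_cons hF]
    refine ⟨?_, fun x hx => ?_⟩
    · have := conflictFree_map_val hF id J fun i hi j hj hij =>
        (hfar i (S.adj_center i (hJ hi)) j (hJ hj) hij).2
      simpa using this
    · have hx : x ∈ J := by simpa using hx
      exact (hfar p hp x (hJ hx) fun e => hpJ (e ▸ hx)).2
  have hcy : ConflictFree (Clash G.Adj ∅) (J.val.map y) :=
    conflictFree_map_val hF y J fun i hi j hj hij => hyy i (hJ hi) j (hJ hj) hij
  have hout : ∀ p ∈ U, G.Adj c p → p ∉ J →
      Slides (Within G.Adj U) (Clash G.Adj ∅) (p ::ₘ J.val) (p ::ₘ J.val.map y) := by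
    intro p hpU hp hpJ
    have := Slides.asides (A := Within G.Adj U) hF {p} (J.toList.map fun x => (x, y x))
      (by
        rw [List.map_map, show (Prod.fst ∘ fun x => (x, y x)) = (id : V → V) from rfl, List.map_id,
          Finset.coe_toList, Multiset.singleton_add]
        exact hcf p hp hpJ)
      (by
        intro r hr
        obtain ⟨x, hx, rfl⟩ := List.mem_map.1 hr
        have hx : x ∈ J := by simpa using hx
        refine ⟨⟨S.adj_toe x (hJ hx), hxU x (hJ hx), hyU x (hJ hx)⟩, fun z hz => ?_⟩
        rw [Multiset.mem_singleton.1 hz]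
        exact (hfar p hp x (hJ hx) fun e => hpJ (e ▸ hx)).1)
      (by
        rw [List.pairwise_map]
        refine (Finset.nodup_toList J).imp_of_mem fun {x z} hx hz hne => ?_
        have hx : x ∈ X := hJ (by simpa using hx)
        have hz : z ∈ X := hJ (by simpa using hz)
        exact ⟨hyy x hx z hz hne, (hfar z (S.adj_center z hz) x hx hne.symm).1,
          (hfar x (S.adj_center x hx) z hz hne).1⟩)
    rw [List.map_map, show (Prod.fst ∘ fun x => (x, y x)) = (id : V → V) from rfl, List.map_id,
      Finset.coe_toList, Multiset.singleton_add, List.map_map,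
      show (Prod.snd ∘ fun x => (x, y x)) = y from rfl, ← Multiset.map_coe, Finset.coe_toList,
      Multiset.singleton_add] at this
    exact this
  have hcc : ConflictFree (Clash G.Adj ∅) (c ::ₘ J.val.map y) := by
    rw [conflictFree_cons hF]
    refine ⟨hcy, fun z hz => ?_⟩
    obtain ⟨x, hx, rfl⟩ := Multiset.mem_map.1 hz
    have hx : x ∈ X := hJ (by simpa using hx)
    rintro ⟨-, -, h | h⟩
    · exact S.toe_ne x hx h.symm
    · exact h3 c x (y x) (S.adj_center x hx) (S.adj_toe x hx) h
  have hcb := S.adj_center b hb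
  have s1 := hout q hqU hq hqJ
  have s4 := (hout b (hxU b hb) hcb hbJ).symm (fun _ _ h => ⟨h.1.symm, h.2.2, h.2.1⟩)
  have s2 : Slides (Within G.Adj U) (Clash G.Adj ∅) (q ::ₘ J.val.map y) (c ::ₘ J.val.map y) :=
    Slides.single ⟨hq.symm, hqU, hcU⟩ (s1.conflictFree (hcf q hq hqJ)) hcc
  have s3 : Slides (Within G.Adj U) (Clash G.Adj ∅) (c ::ₘ J.val.map y) (b ::ₘ J.val.map y) :=
    Slides.single ⟨hcb, hcU, hxU b hb⟩ hcc
      ((hout b (hxU b hb) hcb hbJ).conflictFree (hcf b hcb hbJ))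
  exact s1.trans (s2.trans (s3.trans s4))

open Classical in
-- Tokens are exchanged one at a time: `Spider.swap` carries a token from a foot in `J \ J'` to one
-- in `J' \ J`.
theorem Spider.slides_subsets {C : Set V} {c : V} {X : Finset V} {y : V → V}
    (S : Spider G C c X y) (n : ℕ) : ∀ J J' : Finset V, J ⊆ X → J' ⊆ X → J.card = J'.card →
      (J \ J').card = n → Slides (Within G.Adj ((insert c (X ∪ X.image y) : Finset V) : Set V))
        (Clash G.Adj ∅) J.val J'.val := by
  induction n with
  | zero =>
    intro J J' _ _ hc hn
    rw [Finset.card_eq_zero, Finset.sdiff_eq_empty_iff_subset] at hn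
    rw [Finset.eq_of_subset_of_card_le hn hc.ge]
    exact Slides.refl _
  | succ n ih =>
    intro J J' hJ hJ' hc hn
    obtain ⟨a, ha⟩ := Finset.card_pos.1 (by omega : 0 < (J \ J').card)
    have hcd : (J' \ J).card = (J \ J').card := Finset.card_sdiff_comm hc.symm
    obtain ⟨b, hb⟩ := Finset.card_pos.1 (by omega : 0 < (J' \ J).card)
    rw [Finset.mem_sdiff] at ha hb
    have hbe : b ∉ J.erase a := fun h => hb.2 (Finset.mem_of_mem_erase h)
    have h1 := S.swap h3 h4 ((Finset.erase_subset a J).trans hJ) (S.adj_center a (hJ ha.1))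
      (Finset.notMem_erase a J) (hJ' hb.1) hbe
    rw [← insert_val_of_notMem' (Finset.notMem_erase a J), Finset.insert_erase ha.1,
      ← insert_val_of_notMem' hbe, Set.insert_eq_of_mem (by
        simp [hJ ha.1])] at h1
    refine h1.trans (ih _ J' ?_ hJ' ?_ ?_)
    · exact Finset.insert_subset (hJ' hb.1) ((Finset.erase_subset a J).trans hJ)
    · rw [Finset.card_insert_of_notMem hbe, Finset.card_erase_of_mem ha.1, ← hc]
      have := Finset.card_pos.2 ⟨a, ha.1⟩
      omega
    · rw [Finset.insert_sdiff_of_mem _ hb.1, Finset.erase_sdiff_comm,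
        Finset.card_erase_of_mem (Finset.mem_sdiff.2 ha), hn]
      rfl

open Classical in
/-- A spider with many legs absorbs tokens. -/
theorem Spider.nonempty_absorber {C : Set V} {c : V} {X : Finset V} {y : V → V}
    (S : Spider G C c X y) {k w : ℕ} (hX : X.card = k + 1) (hw : 2 * k + 3 ≤ w)
    (hconn : ∀ x ∈ C, ∀ y ∈ C, ReflTransGen (Within G.Adj C) x y) :
    Nonempty (Absorber G C k w) := by
  have hP : ∀ j, ∃ P : Finset V, P ⊆ X ∧ (j ≤ k → P.card = j) := by
    intro j
    by_cases hj : j ≤ k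
    · obtain ⟨P, h1, h2⟩ := Finset.exists_subset_card_eq (by omega : j ≤ X.card)
      exact ⟨P, h1, fun _ => h2⟩
    · exact ⟨∅, by simp, fun h => absurd h hj⟩
  choose P hPX hPc using hP
  refine _root_.nonempty_absorber (Θ := {c}) hconn rfl (insert c (X ∪ X.image y)) (by simp) ?_ ?_
    (fun j => (P j).val) ?_ hPc ?_ ?_
  · intro x hx
    simp only [Finset.mem_insert, Finset.mem_union, Finset.mem_image] at hx
    rcases hx with rfl | hx | ⟨z, hz, rfl⟩
    · exact S.center
    · exact S.foot x hx
    · exact S.toe z hz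
  · have := Finset.card_insert_le c (X ∪ X.image y)
    have := Finset.card_union_le X (X.image y)
    have := Finset.card_image_le (s := X) (f := y)
    omega
  · intro j _ x hx
    have : x ∈ X := hPX j (by simpa using hx)
    simp [this]
  · intro j _
    have := conflictFree_map_val (Absorber.symmRel_clash (G := G) (H := ∅)) id (P j)
      fun i hi j' hj hij => by
        rintro ⟨-, -, h | h⟩
        · exact hij h
        · exact h3 c i j' (S.adj_center i (hPX j hi)) h (S.adj_center j' (hPX j hj))
    simpa using this
  · intro v π q hv ha j hj
    obtain ⟨θ, hθ, hqθ⟩ := ha.adj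
    rw [Set.mem_singleton_iff] at hθ
    subst hθ
    -- The extra foot is needed here: `q` may itself be a foot, and then `k` others remain for the
    -- parked tokens.
    have hce : k ≤ (X.erase q).card := by
      have := Finset.pred_card_le_card_erase (s := X) (a := q)
      omega
    obtain ⟨J, hJ, hJc⟩ := Finset.exists_subset_card_eq (hj.le.trans hce)
    have hJX : J ⊆ X := hJ.trans (Finset.erase_subset _ _)
    have hqJ : q ∉ J := fun h => Finset.notMem_erase q X (hJ h)
    obtain ⟨b, hb, hbJ⟩ := Finset.exists_mem_notMem_of_card_lt_card (by omega : J.card < X.card)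
    refine ⟨J.val, ?_, ?_, ?_, ?_⟩
    · intro x hx
      have : x ∈ X := hJX (by simpa using hx)
      simp [this]
    · intro x hx p hp
      have hx : x ∈ J := by simpa using hx
      have hcx := S.adj_center x (hJX hx)
      by_cases hpq : p = q
      · subst hpq
        exact ⟨fun e => hqJ (e ▸ hx), fun h => h3 _ _ _ hqθ.symm h hcx⟩
      · refine ⟨?_, fun h => ?_⟩
        · rintro rfl
          exact ha.away p hp hpq _ rfl hcx.symm
        -- If `p` were adjacent to the foot `x`, it would also be adjacent to `q`; then `θ` and `p`
        -- would have the two common neighbours `q` and `x`.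
        · have hpq' := ha.away' p hp hpq x (S.foot x (hJX hx)) ⟨_, rfl, hcx.symm⟩ h
          have hpc : p ≠ θ := fun e => ha.notMem p hp e
          exact hqJ (h4 θ q p x hpc.symm hqθ.symm hpq'.symm hcx h.symm ▸ hx)
    · exact S.slides_subsets h3 h4 _ _ _ (hPX j) hJX (by rw [hPc j hj.le, hJc]) rfl
    · have h1 := S.swap h3 h4 hJX hqθ.symm hqJ hb hbJ
      rw [← insert_val_of_notMem' hbJ] at h1
      have h2 := S.slides_subsets h3 h4 _ (insert b J) (P (j + 1)) (Finset.insert_subset hb hJX)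
        (hPX _) (by rw [hPc _ hj, Finset.card_insert_of_notMem hbJ, hJc]) rfl
      refine (h1.mono (fun _ _ h => ⟨h.1, ?_, ?_⟩) fun _ _ => id).trans
        (h2.mono (fun _ _ h => ⟨h.1, Or.inl h.2.1, Or.inl h.2.2⟩) fun _ _ => id)
      · rcases h.2.1 with rfl | h
        · exact Or.inr ha.q_mem
        · exact Or.inl h
      · rcases h.2.2 with rfl | h
        · exact Or.inr ha.q_mem
        · exact Or.inl h

end Absorbers

/-! ### Long induced paths absorb tokens -/

section PathAbsorber

variable {V : Type*} {G : SimpleGraph V}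

theorem eq_range_of_lower {J : Finset ℕ} (h : ∀ t, t + 1 ∈ J → t ∈ J) : J = Finset.range J.card := by
  have hlow : ∀ t, t ∈ J → ∀ s ≤ t, s ∈ J := by
    intro t
    induction t with
    | zero => intro ht s hs; rwa [Nat.le_zero.1 hs]
    | succ t ih =>
      intro ht s hs
      rcases Nat.lt_or_eq_of_le hs with hs | rfl
      · exact ih (h t ht) s (Nat.lt_succ_iff.1 hs)
      · exact ht
  refine Finset.eq_of_subset_of_card_le (fun t ht => ?_) (by simp)
  rw [Finset.mem_range]
  have : Finset.range (t + 1) ⊆ J := fun s hs =>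
    hlow t ht s (Nat.lt_succ_iff.1 (Finset.mem_range.1 hs))
  have := Finset.card_le_card this
  rw [Finset.card_range] at this
  omega

/-- The final position of tokens pushed to the beginning of a path: when none of them can be pushed
further, they occupy `0, 2, 4, …`. -/
theorem eq_image_two_mul {I : Finset ℕ} (h1 : 1 ∉ I) (h2 : ∀ i, i + 2 ∈ I → i ∈ I) :
    I = (Finset.range I.card).image (2 * ·) := by
  have heven : ∀ i ∈ I, Even i := by
    intro i
    induction i using Nat.strong_induction_on with
    | _ i ih =>
      intro hi
      match i, hi, ih with
      | 0, _, _ => exact Even.zero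
      | 1, hi, _ => exact absurd hi h1
      | i + 2, hi, ih =>
        have := ih i (by omega) (h2 i hi)
        exact this.add even_two
  have hinj : Function.Injective (fun t : ℕ => 2 * t) := fun a b h => by
    simp only at h; omega
  set J : Finset ℕ := I.preimage (2 * ·) hinj.injOn with hJ
  have hIJ : J.image (2 * ·) = I := by
    ext i
    simp only [hJ, Finset.mem_image, Finset.mem_preimage]
    constructor
    · rintro ⟨t, ht, rfl⟩; exact ht
    · intro hi
      obtain ⟨t, rfl⟩ := heven i hi
      exact ⟨t, by rwa [two_mul], by omega⟩
  have hc : I.card = J.card := by rw [← hIJ, Finset.card_image_of_injective _ hinj]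
  rw [hc, ← eq_range_of_lower (J := J), hIJ]
  intro t ht
  simp only [hJ, Finset.mem_preimage] at ht ⊢
  exact h2 _ ht

/-- An induced path `r 0, …, r L` in `C` such that a vertex off the path has at most one neighbour
on the path if it is in `C`. -/
structure InducedPath (G : SimpleGraph V) (C : Set V) (L : ℕ) (r : ℕ → V) : Prop where
  mem : ∀ i ≤ L, r i ∈ C
  adj : ∀ i < L, G.Adj (r i) (r (i + 1))
  far : ∀ i j, i + 2 ≤ j → j ≤ L → r i ≠ r j ∧ ¬ G.Adj (r i) (r j)
  unique : ∀ x ∈ C, (∀ i ≤ L, x ≠ r i) → ∀ i ≤ L, ∀ j ≤ L, G.Adj x (r i) → G.Adj x (r j) → i = j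

namespace InducedPath

variable {C : Set V} {L : ℕ} {r : ℕ → V}

theorem not_clash (R : InducedPath G C L r) {i j : ℕ} (hi : i ≤ L) (hj : j ≤ L) (hij : i ≠ j)
    (h1 : i + 1 ≠ j) (h2 : j + 1 ≠ i) : ¬ Clash G.Adj ∅ (r i) (r j) := by
  rintro ⟨-, -, h⟩
  rcases Nat.lt_or_gt_of_ne hij with hlt | hlt
  · have := R.far i j (by omega) hj
    exact h.elim this.1 this.2
  · have := R.far j i (by omega) hi
    exact h.elim (fun h => this.1 h.symm) fun h => this.2 h.symm

/-- A sparse set of positions. -/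
def Sparse (L : ℕ) (I : Finset ℕ) : Prop := ∀ i ∈ I, i ≤ L ∧ i + 1 ∉ I

theorem conflictFree (R : InducedPath G C L r) {I : Finset ℕ} (hI : Sparse L I) :
    ConflictFree (Clash G.Adj ∅) (I.val.map r) :=
  conflictFree_map_val Absorber.symmRel_clash r I fun i hi j hj hij =>
    R.not_clash (hI i hi).1 (hI j hj).1 hij (fun e => (hI i hi).2 (e ▸ hj))
      fun e => (hI j hj).2 (e ▸ hi)

/-- On an induced path, tokens can be pushed to the beginning of the path. -/
theorem slides_canonical [DecidableEq V] (R : InducedPath G C L r) (n : ℕ) :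
    ∀ I : Finset ℕ, Sparse L I → ∑ i ∈ I, i = n →
      Slides (Within G.Adj (((Finset.range (L + 1)).image r : Finset V) : Set V))
        (Clash G.Adj ∅) (I.val.map r) (((Finset.range I.card).image (2 * ·)).val.map r) := by
  induction n using Nat.strong_induction_on with
  | _ n ih =>
    intro I hI hn
    -- A token at `i + 1` can be pushed to `i` unless `i - 1` is occupied; quantifying over `i'`
    -- with `i' + 1 = i` covers `i = 0`. Each push decreases the sum of the positions.
    by_cases h : ∃ i, i + 1 ∈ I ∧ ∀ i', i' + 1 = i → i' ∉ I
    · obtain ⟨i, hi, hi'⟩ := h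
      have hiI : i ∉ I := fun h => (hI i h).2 hi
      have hie : i ∉ I.erase (i + 1) := fun h => hiI (Finset.mem_of_mem_erase h)
      have hI' : Sparse L (insert i (I.erase (i + 1))) := by
        intro j hj
        rcases Finset.mem_insert.1 hj with rfl | hj
        · refine ⟨by have := (hI _ hi).1; omega, fun h => ?_⟩
          rcases Finset.mem_insert.1 h with h | h
          · omega
          · exact Finset.notMem_erase _ _ h
        · have hj' := Finset.mem_of_mem_erase hj
          refine ⟨(hI j hj').1, fun h => ?_⟩
          rcases Finset.mem_insert.1 h with h | h
          · exact hi' j h hj'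
          · exact (hI j hj').2 (Finset.mem_of_mem_erase h)
      have hsum : ∑ i ∈ insert i (I.erase (i + 1)), i < n := by
        rw [Finset.sum_insert hie, ← hn, ← Finset.add_sum_erase I (fun i => i) hi]
        simp
      have hcard : (insert i (I.erase (i + 1))).card = I.card := by
        rw [Finset.card_insert_of_notMem hie, Finset.card_erase_of_mem hi]
        have := Finset.card_pos.2 ⟨_, hi⟩
        omega
      have hrec := ih _ hsum _ hI' rfl
      rw [hcard] at hrec
      refine Slides.trans ?_ hrec
      have e1 : I.val.map r = r (i + 1) ::ₘ (I.erase (i + 1)).val.map r := by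
        rw [← Multiset.map_cons, ← insert_val_of_notMem' (Finset.notMem_erase (i + 1) I),
          Finset.insert_erase hi]
      have e2 : (insert i (I.erase (i + 1))).val.map r =
          r i ::ₘ (I.erase (i + 1)).val.map r := by
        rw [← Multiset.map_cons, ← insert_val_of_notMem' hie]
      have c1 := R.conflictFree hI
      have c2 := R.conflictFree hI'
      rw [e1] at c1 ⊢
      rw [e2] at c2 ⊢
      have hL := (hI _ hi).1
      refine Slides.single ⟨(R.adj i (by omega)).symm, ?_, ?_⟩ c1 c2
      · exact Finset.mem_coe.2 (Finset.mem_image_of_mem r (by simp; omega))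
      · exact Finset.mem_coe.2 (Finset.mem_image_of_mem r (by simp; omega))
    · push Not at h
      have h1 : 1 ∉ I := fun h1 => by
        obtain ⟨i', h, -⟩ := h 0 h1
        omega
      have h2 : ∀ i, i + 2 ∈ I → i ∈ I := fun i hi => by
        obtain ⟨i', h, h'⟩ := h (i + 1) hi
        rwa [← Nat.succ_injective h]
      rw [← eq_image_two_mul h1 h2]
      exact Slides.refl _

/-- A long induced path absorbs tokens. -/
theorem nonempty_absorber (h3 : ∀ a b c, G.Adj a b → G.Adj b c → ¬ G.Adj a c) {k w : ℕ}
    (R : InducedPath G C (4 * k + 1) r) (hw : 4 * k + 2 ≤ w)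
    (hconn : ∀ x ∈ C, ∀ y ∈ C, ReflTransGen (Within G.Adj C) x y) :
    Nonempty (Absorber G C k w) := by
  classical
  have hcan : ∀ j ≤ k, Sparse (4 * k + 1) ((Finset.range j).image (2 * ·)) := by
    intro j hj i hi
    obtain ⟨t, ht, rfl⟩ := Finset.mem_image.1 hi
    rw [Finset.mem_range] at ht
    refine ⟨by omega, fun h => ?_⟩
    obtain ⟨t', -, h⟩ := Finset.mem_image.1 h
    omega
  have hcc : ∀ j, ((Finset.range j).image (2 * ·)).card = j := fun j => by
    rw [Finset.card_image_of_injective _ fun a b (h : 2 * a = 2 * b) => by omega, Finset.card_range]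
  set W : Finset V := (Finset.range (4 * k + 1 + 1)).image r with hW
  have hmemW : ∀ i ≤ 4 * k + 1, r i ∈ W := fun i hi =>
    Finset.mem_image_of_mem r (Finset.mem_range.2 (by omega))
  refine _root_.nonempty_absorber (Θ := W) (θ := r 0) hconn (Finset.mem_coe.2 (hmemW 0 (by omega)))
    W subset_rfl ?_ ?_ (fun j => ((Finset.range j).image (2 * ·)).val.map r) ?_ ?_ ?_ ?_
  · intro x hx
    obtain ⟨i, hi, rfl⟩ := Finset.mem_image.1 hx
    exact R.mem i (by rw [Finset.mem_range] at hi; omega)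
  · exact Finset.card_image_le.trans (by rw [Finset.card_range]; omega)
  · intro j hj x hx
    obtain ⟨i, hi, rfl⟩ := Multiset.mem_map.1 hx
    exact hmemW i (hcan j hj i (by simpa using hi)).1
  · intro j _
    rw [Multiset.card_map, Finset.card_val, hcc]
  · intro j hj
    exact R.conflictFree (hcan j hj)
  · intro v π q hv ha j hj
    obtain ⟨θ, hθ, hqθ⟩ := ha.adj
    obtain ⟨a, haL, rfl⟩ := Finset.mem_image.1 (Finset.mem_coe.1 hθ)
    have haL : a ≤ 4 * k + 1 := by rw [Finset.mem_range] at haL; omega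
    -- The vertex `v` may lie outside `C` and have many neighbours on the path, but by
    -- triangle-freeness not two consecutive ones. So each block contains a position, `4 * t` or `4
    -- * t + 1`, that is not adjacent to `v`.
    set e : ℕ → ℕ := fun t => if G.Adj v (r (4 * t)) then 4 * t + 1 else 4 * t with he
    have he1 : ∀ t, e t = 4 * t ∨ e t = 4 * t + 1 := by
      intro t
      simp only [he]
      split <;> simp
    have he2 : ∀ t ≤ k, ¬ G.Adj v (r (e t)) := by
      intro t ht
      simp only [he]
      split
      · rename_i h
        exact fun h' => h3 v (r (4 * t)) (r (4 * t + 1)) h (R.adj _ (by omega)) h'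
      · assumption
    -- Positions chosen in different blocks are at least three apart, so at most one of them is
    -- within distance one of `a`. Of `j + 1` blocks, `j` remain for the parked tokens while the new
    -- token enters at `a`.
    obtain ⟨t0, ht0⟩ : ∃ t0 ≤ j, ∀ t ≤ j, t ≠ t0 → e t + 2 ≤ a ∨ a + 2 ≤ e t := by
      by_cases h : ∃ t0 ≤ j, ¬ (e t0 + 2 ≤ a ∨ a + 2 ≤ e t0)
      · obtain ⟨t0, h0, h⟩ := h
        refine ⟨t0, h0, fun t _ hne => ?_⟩
        have := he1 t
        have := he1 t0
        omega
      · push Not at h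
        exact ⟨j, le_rfl, fun t ht _ => by have := h t ht; omega⟩
    set T := (Finset.range (j + 1)).erase t0 with hT
    have hTc : T.card = j := by
      rw [hT, Finset.card_erase_of_mem (Finset.mem_range.2 (by omega)), Finset.card_range]
      rfl
    have hTm : ∀ t ∈ T, t ≤ j ∧ (e t + 2 ≤ a ∨ a + 2 ≤ e t) := by
      intro t ht
      rw [hT, Finset.mem_erase, Finset.mem_range] at ht
      exact ⟨by omega, ht0.2 t (by omega) ht.1⟩
    have hinj : Function.Injective e := by
      intro s t h
      have := he1 s
      have := he1 t
      omega
    set I := T.image e with hI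
    have hIc : I.card = j := by rw [hI, Finset.card_image_of_injective _ hinj, hTc]
    have hIm : ∀ i ∈ I, i ≤ 4 * k + 1 ∧ (i + 2 ≤ a ∨ a + 2 ≤ i) ∧ ¬ G.Adj v (r i) := by
      intro i hi
      obtain ⟨t, ht, rfl⟩ := Finset.mem_image.1 hi
      have h := hTm t ht
      have := he1 t
      exact ⟨by omega, h.2, he2 t (by omega)⟩
    have hIs : Sparse (4 * k + 1) I := by
      intro i hi
      refine ⟨(hIm i hi).1, fun h => ?_⟩
      obtain ⟨t, ht, rfl⟩ := Finset.mem_image.1 hi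
      obtain ⟨s, hs, h⟩ := Finset.mem_image.1 h
      have h1 := he1 s
      have h2 := he1 t
      rcases eq_or_ne s t with rfl | hst <;> omega
    have haI : a ∉ I := fun h => by have := (hIm a h).2.1; omega
    have haIs : Sparse (4 * k + 1) (insert a I) := by
      intro i hi
      rcases Finset.mem_insert.1 hi with rfl | hi
      · refine ⟨haL, fun h => ?_⟩
        rcases Finset.mem_insert.1 h with h | h
        · omega
        · have := (hIm _ h).2.1
          omega
      · refine ⟨(hIs i hi).1, fun h => ?_⟩
        rcases Finset.mem_insert.1 h with h | h
        · have := (hIm _ hi).2.1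
          omega
        · exact (hIs i hi).2 h
    have haIc : (insert a I).card = j + 1 := by rw [Finset.card_insert_of_notMem haI, hIc]
    have hnadj : ∀ i ∈ I, ∀ p ∈ π, ¬ G.Adj p (r i) := by
      intro i hi p hp hadj
      obtain ⟨hiL, hia, hiv⟩ := hIm i hi
      -- Only `q` has neighbours on the path. If `q ∈ C`, then `r a` is its only one; if `q = v`,
      -- the positions were chosen to avoid its neighbours.
      by_cases hpq : p = q
      · subst hpq
        rcases ha.sub p hp with hpC | rfl
        · have := R.unique p hpC (fun i hi e => ha.notMem p hp (Finset.mem_coe.2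
            (e ▸ hmemW i hi))) i hiL a haL hadj hqθ
          omega
        · exact hiv hadj
      · exact ha.away p hp hpq _ (Finset.mem_coe.2 (hmemW i hiL)) hadj
    refine ⟨I.val.map r, ?_, ?_, ?_, ?_⟩
    · intro x hx
      obtain ⟨i, hi, rfl⟩ := Multiset.mem_map.1 hx
      exact hmemW i (hIm i (by simpa using hi)).1
    · intro x hx p hp
      obtain ⟨i, hi, rfl⟩ := Multiset.mem_map.1 hx
      have hi : i ∈ I := by simpa using hi
      exact ⟨fun e => ha.notMem p hp (Finset.mem_coe.2 (e ▸ hmemW i (hIm i hi).1)),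
        hnadj i hi p hp⟩
    · have := R.slides_canonical _ I hIs rfl
      rw [hIc] at this
      exact this.symm fun _ _ h => ⟨h.1.symm, h.2.2, h.2.1⟩
    · have h1 := R.slides_canonical _ _ haIs rfl
      rw [haIc] at h1
      refine Slides.trans ?_ (h1.mono (fun _ _ h => ⟨h.1, Or.inl h.2.1, Or.inl h.2.2⟩)
        fun _ _ => id)
      have c1 := R.conflictFree hIs
      have c2 := R.conflictFree haIs
      rw [insert_val_of_notMem' haI, Multiset.map_cons] at c2 ⊢
      refine Slides.single ⟨hqθ, Or.inr ha.q_mem, Or.inl (hmemW a haL)⟩ ?_ c2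
      rw [conflictFree_cons Absorber.symmRel_clash]
      refine ⟨c1, fun y hy => ?_⟩
      obtain ⟨i, hi, rfl⟩ := Multiset.mem_map.1 hy
      have hi : i ∈ I := by simpa using hi
      rintro ⟨-, -, h | h⟩
      · exact ha.notMem q ha.q_mem (Finset.mem_coe.2 (h ▸ hmemW i (hIm i hi).1))
      · exact hnadj i hi q ha.q_mem h

end InducedPath

end PathAbsorber

/-! ### Large components contain absorbers -/

section Existence

variable {V : Type*} {G : SimpleGraph V}

/-- In a triangle-free graph, every set of `m * m` vertices contains `m` independent ones. -/
theorem exists_independent [DecidableEq V] (h3 : ∀ a b c, G.Adj a b → G.Adj b c → ¬ G.Adj a c)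
    (m : ℕ) (Y : Finset V) (hY : m * m ≤ Y.card) :
    ∃ I ⊆ Y, I.card = m ∧ ∀ a ∈ I, ∀ b ∈ I, ¬ G.Adj a b := by
  classical
  obtain ⟨Q, hQ⟩ : ∃ Q : Finset V → Prop, ∀ I, Q I ↔ ∀ a ∈ I, ∀ b ∈ I, ¬ G.Adj a b :=
    ⟨_, fun _ => Iff.rfl⟩
  obtain ⟨I, hI, hmax⟩ := (Y.powerset.filter Q).exists_max_image Finset.card
    ⟨∅, by simp [hQ]⟩
  rw [Finset.mem_filter, Finset.mem_powerset, hQ] at hI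
  by_cases hm : m ≤ I.card
  · obtain ⟨J, hJ, hJc⟩ := Finset.exists_subset_card_eq hm
    exact ⟨J, hJ.trans hI.1, hJc, fun a ha b hb => hI.2 a (hJ ha) b (hJ hb)⟩
  push Not at hm
  -- By maximality every vertex of `Y \ I` has a neighbour in `I`. As `I` has fewer than `m`
  -- elements, some vertex of `I` has at least `m` neighbours in `Y`, and these are independent by
  -- triangle-freeness.
  have hnb : ∀ y ∈ Y \ I, ∃ i ∈ I, G.Adj y i := by
    intro y hy
    rw [Finset.mem_sdiff] at hy
    by_contra! hcon
    have := hmax (insert y I) (by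
      rw [Finset.mem_filter, Finset.mem_powerset, hQ]
      refine ⟨Finset.insert_subset hy.1 hI.1, fun a ha b hb => ?_⟩
      rw [Finset.mem_insert] at ha hb
      rcases ha with ha | ha <;> rcases hb with hb | hb
      · rw [ha, hb]; exact G.irrefl
      · rw [ha]; exact hcon b hb
      · rw [hb]; exact fun h => hcon a ha h.symm
      · exact hI.2 a ha b hb)
    rw [Finset.card_insert_of_notMem hy.2] at this
    omega
  choose! f hf hadj using hnb
  have hlt : I.card * (m - 1) < (Y \ I).card := by
    have h1 : Y.card - I.card ≤ (Y \ I).card := Finset.le_card_sdiff I Y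
    obtain ⟨j, rfl⟩ : ∃ j, m = j + 1 := ⟨m - 1, by omega⟩
    have h2 : I.card * (j + 1 - 1) ≤ j * j := Nat.mul_le_mul (by omega) (by omega)
    have h5 : (j + 1) * (j + 1) = j * j + 2 * j + 1 := by ring
    omega
  obtain ⟨i, hi, hci⟩ := Finset.exists_lt_card_fiber_of_mul_lt_card_of_maps_to hf hlt
  obtain ⟨J, hJ, hJc⟩ := Finset.exists_subset_card_eq (by omega :
    m ≤ ((Y \ I).filter fun y => f y = i).card)
  have hJ' : ∀ y ∈ J, y ∈ Y \ I ∧ f y = i := fun y hy => Finset.mem_filter.1 (hJ hy)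
  refine ⟨J, fun y hy => (Finset.mem_sdiff.1 (hJ' y hy).1).1, hJc, fun a ha b hb => ?_⟩
  have h1 := hadj a (hJ' a ha).1
  have h2 := hadj b (hJ' b hb).1
  rw [(hJ' a ha).2] at h1
  rw [(hJ' b hb).2] at h2
  exact h3 a i b h1 h2.symm

/-- The closed neighbourhood of a set of vertices of bounded degree. -/
theorem card_layer_le [Fintype V] [DecidableRel G.Adj] {C Θ : Set V} {D : ℕ} {θ : V}
    (hΘ : Θ = {θ}) (hC : ∀ x ∈ C, G.degree x ≤ D) (hθ : θ ∈ C) (n : ℕ) :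
    ∃ T : Finset V, (∀ x ∈ layer G C Θ n, x ∈ T) ∧ (∀ x ∈ T, x ∈ C) ∧ T.card ≤ (D + 1) ^ n := by
  classical
  induction n with
  | zero =>
    refine ⟨{θ}, ?_, ?_, by simp⟩
    · intro x hx
      rw [layer, hΘ] at hx
      simpa using hx
    · intro x hx
      rw [Finset.mem_singleton.1 hx]; exact hθ
  | succ n ih =>
    obtain ⟨T, h1, h2, h3⟩ := ih
    refine ⟨T ∪ (T.biUnion fun y => (G.neighborFinset y).filter (· ∈ C)), ?_, ?_, ?_⟩
    · rintro x (hx | ⟨hxC, y, hy, hxy⟩)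
      · exact Finset.mem_union_left _ (h1 x hx)
      · refine Finset.mem_union_right _ (Finset.mem_biUnion.2 ⟨y, h1 y hy, ?_⟩)
        rw [Finset.mem_filter, SimpleGraph.mem_neighborFinset]
        exact ⟨hxy.symm, hxC⟩
    · intro x hx
      rcases Finset.mem_union.1 hx with hx | hx
      · exact h2 x hx
      · obtain ⟨y, -, hy⟩ := Finset.mem_biUnion.1 hx
        exact (Finset.mem_filter.1 hy).2
    · have hb : (T.biUnion fun y => (G.neighborFinset y).filter (· ∈ C)).card ≤ T.card * D := by
        refine Finset.card_biUnion_le_card_mul _ _ _ fun y hy => ?_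
        refine (Finset.card_filter_le _ _).trans ?_
        rw [SimpleGraph.card_neighborFinset_eq_degree]
        exact hC y (h2 y hy)
      calc _ ≤ T.card + T.card * D := (Finset.card_union_le _ _).trans (by omega)
        _ = T.card * (D + 1) := by ring
        _ ≤ (D + 1) ^ n * (D + 1) := Nat.mul_le_mul_right _ h3
        _ = (D + 1) ^ (n + 1) := (pow_succ _ _).symm

theorem exists_descending {C Θ : Set V} (hΘC : Θ ⊆ C) (n : ℕ) : ∀ x m, x ∈ layer G C Θ m →
    level G C Θ x = n → ∃ r : ℕ → V, (∀ i ≤ n, r i ∈ C ∧ r i ∈ layer G C Θ i ∧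
      level G C Θ (r i) = i) ∧ (∀ i < n, G.Adj (r i) (r (i + 1))) ∧ r n = x := by
  induction n with
  | zero =>
    intro x m hx hl
    have := mem_layer_level hx
    rw [hl] at this
    refine ⟨fun _ => x, fun i hi => ?_, fun i hi => absurd hi (Nat.not_lt_zero _), rfl⟩
    rw [Nat.le_zero.1 hi]
    exact ⟨hΘC this, this, hl⟩
  | succ n ih =>
    intro x m hx hl
    obtain ⟨hxC, y, hy, hly, hxy⟩ := exists_level_pred hx hl
    obtain ⟨r, h1, h2, h3⟩ := ih y _ hy hly
    refine ⟨fun i => if i ≤ n then r i else x, fun i hi => ?_, fun i hi => ?_, by simp⟩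
    · by_cases h : i ≤ n
      · simp only [if_pos h]; exact h1 i h
      · have : i = n + 1 := by omega
        subst this
        simp only [if_neg h]
        have hx' := mem_layer_level hx
        rw [hl] at hx'
        exact ⟨hxC, hx', hl⟩
    · by_cases h : i + 1 ≤ n
      · simp only [if_pos h, if_pos (show i ≤ n by omega)]; exact h2 i (by omega)
      · have : i = n := by omega
        subst this
        simp only [if_neg h, if_pos le_rfl, h3]
        exact hxy.symm

/-- A large connected set `C` of vertices that is separated from the rest of the graph by few
vertices absorbs tokens, if the graph has girth at least five and no vertex has many pendant
neighbours. -/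
theorem nonempty_absorber_of_card [Fintype V] [DecidableRel G.Adj]
    (h3 : ∀ a b c, G.Adj a b → G.Adj b c → ¬ G.Adj a c)
    (h4 : ∀ a b c d, a ≠ c → G.Adj a b → G.Adj b c → G.Adj a d → G.Adj d c → b = d)
    {k w p D : ℕ} (hpend : ∀ c, ∃ P : Finset V, P.card ≤ p ∧ ∀ x, G.Adj c x →
      (∀ y, G.Adj x y → y = c) → x ∈ P)
    {C : Set V} (Z : Finset V)
    (hN : ∀ x ∈ C, ∀ y, G.Adj x y → y ∈ C ∨ y ∈ Z)
    (hconn : ∀ x ∈ C, ∀ y ∈ C, ReflTransGen (Within G.Adj C) x y)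
    (hD : 2 * Z.card + p + (k + 1) * (k + 1) ≤ D) (hw : 4 * k + 3 ≤ w)
    (K : Finset V) (hK : ∀ x ∈ K, x ∈ C) (hcard : (D + 1) ^ (4 * k + 1) < K.card) :
    Nonempty (Absorber G C k w) := by
  classical
  -- If all degrees in `C` are at most `D`, the ball of radius `4 * k + 1` around `θ` cannot contain
  -- `K`, so there is a geodesic longer than that; otherwise a vertex of larger degree is the centre
  -- of a spider.
  by_cases hdeg : ∀ x ∈ C, G.degree x ≤ D
  · obtain ⟨θ, hθ⟩ : ∃ θ, θ ∈ K := Finset.card_pos.1 (lt_of_le_of_lt (Nat.zero_le _) hcard)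
    obtain ⟨T, hT, -, hTc⟩ := card_layer_le (Θ := {θ}) rfl hdeg (hK θ hθ) (4 * k + 1)
    obtain ⟨x, hx, hxT⟩ := Finset.exists_mem_notMem_of_card_lt_card (lt_of_le_of_lt hTc hcard)
    obtain ⟨m, hm⟩ := exists_mem_layer hconn (Set.mem_singleton θ) (hK θ hθ) (hK x hx)
    have hlev : 4 * k + 1 < level G C {θ} x := by
      by_contra hle
      exact hxT (hT x (layer_mono (by omega) (mem_layer_level hm)))
    obtain ⟨r, hr1, hr2, -⟩ := exists_descending (by simpa using hK θ hθ) _ x m hm rfl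
    have hstep : ∀ i ≤ 4 * k + 1, ∀ x ∈ C, G.Adj x (r i) → level G C {θ} x ≤ i + 1 := by
      intro i hi x hx hadj
      have := hr1 i (by omega)
      have h := level_le_succ hx hadj this.2.1
      rwa [this.2.2] at h
    have hfar : ∀ i j, i + 2 ≤ j → j ≤ 4 * k + 1 → r i ≠ r j ∧ ¬ G.Adj (r i) (r j) := by
      intro i j hij hj
      have hi := hr1 i (by omega)
      have hj' := hr1 j (by omega)
      refine ⟨fun e => ?_, fun hadj => ?_⟩
      · have := hi.2.2
        rw [e, hj'.2.2] at this
        omega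
      · have := hstep i (by omega) (r j) hj'.1 hadj.symm
        rw [hj'.2.2] at this
        omega
    refine InducedPath.nonempty_absorber (r := r) h3 ⟨fun i hi => (hr1 i (by omega)).1,
      fun i hi => hr2 i (by omega), hfar, ?_⟩ (by omega) hconn
    intro x hx hxr
    have key : ∀ i ≤ 4 * k + 1, ∀ j ≤ 4 * k + 1, i < j → G.Adj x (r i) → ¬ G.Adj x (r j) := by
      intro i hi j hj hij hxi hxj
      have h1 := hstep i hi x hx hxi
      obtain ⟨m, hm⟩ := exists_mem_layer hconn (Set.mem_singleton θ) (hK θ hθ) hx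
      have h2 := level_le_succ (hr1 j (by omega)).1 hxj.symm hm
      rw [(hr1 j (by omega)).2.2] at h2
      -- Two neighbours of `x` differ by at most two levels. Consecutive ones give a triangle; for
      -- the others, the 4-cycle condition puts `x` on the path.
      obtain rfl | rfl : j = i + 1 ∨ j = i + 2 := by omega
      · exact h3 x (r i) (r (i + 1)) hxi (hr2 i (by omega)) hxj
      · exact hxr (i + 1) (by omega) (h4 (r i) x (r (i + 2)) (r (i + 1))
          (hfar i (i + 2) le_rfl hj).1 hxi.symm hxj (hr2 i (by omega)) (hr2 (i + 1) (by omega)))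
    intro i hi j hj hxi hxj
    rcases Nat.lt_trichotomy i j with h | h | h
    · exact absurd hxj (key i hi j hj h hxi)
    · exact h
    · exact absurd hxi (key j hj i hi h hxj)
  · push Not at hdeg
    obtain ⟨c, hc, hcD⟩ := hdeg
    obtain ⟨P, hPc, hP⟩ := hpend c
    -- The degree of `c` pays for discarding the neighbours in `Z`, the pendant ones, and those
    -- whose further neighbour is in `Z`. Distinct neighbours have distinct further neighbours by
    -- `h4`, so the last loss is again at most `Z.card`. At least `(k + 1) * (k + 1)` remain, enough
    -- for `k + 1` independent toes.
    set N := ((G.neighborFinset c) \ Z) \ P with hNdef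
    have hNcard : G.degree c - Z.card - P.card ≤ N.card := by
      have h1 := Finset.le_card_sdiff Z (G.neighborFinset c)
      have h2 := Finset.le_card_sdiff P ((G.neighborFinset c) \ Z)
      rw [SimpleGraph.card_neighborFinset_eq_degree] at h1
      rw [← hNdef] at h2
      omega
    have hNm : ∀ x ∈ N, G.Adj c x ∧ x ∈ C ∧ ∃ y, G.Adj x y ∧ y ≠ c := by
      intro x hx
      rw [hNdef, Finset.mem_sdiff, Finset.mem_sdiff, SimpleGraph.mem_neighborFinset] at hx
      refine ⟨hx.1.1, (hN c hc x hx.1.1).resolve_right hx.1.2, ?_⟩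
      by_contra! hcon
      exact hx.2 (hP x hx.1.1 hcon)
    choose! y hy using fun x hx => (hNm x hx).2.2
    have hinj : ∀ x ∈ N, ∀ x' ∈ N, y x = y x' → x = x' := fun x hx x' hx' e =>
      h4 c x (y x) x' (hy x hx).2.symm (hNm x hx).1 (hy x hx).1 (hNm x' hx').1 (e ▸ (hy x' hx').1)
    set N' := N.filter fun x => y x ∉ Z with hN'
    have hN'card : N.card ≤ N'.card + Z.card := by
      rw [← Finset.card_filter_add_card_filter_not (s := N) (fun x => y x ∉ Z)]
      refine Nat.add_le_add_left (Finset.card_le_card_of_injOn y ?_ ?_) _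
      · intro x hx
        simpa using (Finset.mem_filter.1 (Finset.mem_coe.1 hx)).2
      · intro x hx x' hx' e
        exact hinj x (Finset.mem_filter.1 (Finset.mem_coe.1 hx)).1 x'
          (Finset.mem_filter.1 (Finset.mem_coe.1 hx')).1 e
    have hinj' : Set.InjOn y N' := fun x hx x' hx' e =>
      hinj x (Finset.mem_filter.1 (Finset.mem_coe.1 hx)).1 x'
          (Finset.mem_filter.1 (Finset.mem_coe.1 hx')).1 e
    obtain ⟨I, hI, hIc, hIind⟩ := exists_independent h3 (k + 1) (N'.image y) (by
      rw [Finset.card_image_of_injOn hinj']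
      omega)
    set X := N'.filter fun x => y x ∈ I with hX
    have hXI : X.image y = I := by
      ext z
      constructor
      · intro hz
        obtain ⟨x, hx, rfl⟩ := Finset.mem_image.1 hz
        exact (Finset.mem_filter.1 hx).2
      · intro hz
        obtain ⟨x, hx, rfl⟩ := Finset.mem_image.1 (hI hz)
        exact Finset.mem_image_of_mem y (Finset.mem_filter.2 ⟨hx, hz⟩)
    have hXN' : X ⊆ N' := Finset.filter_subset _ _
    have hXN : X ⊆ N := hXN'.trans (Finset.filter_subset _ _)
    refine Spider.nonempty_absorber h3 h4 (c := c) (X := X) (y := y) ⟨hc, fun x hx =>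
      (hNm x (hXN hx)).2.1, fun x hx => ?_, fun x hx => (hNm x (hXN hx)).1,
      fun x hx => (hy x (hXN hx)).1, fun x hx => (hy x (hXN hx)).2, ?_⟩ ?_ (by omega) hconn
    · exact (hN x (hNm x (hXN hx)).2.1 (y x) (hy x (hXN hx)).1).resolve_right
        (Finset.mem_filter.1 (hXN' hx)).2
    · intro x hx x' hx'
      exact hIind _ (Finset.mem_filter.1 hx).2 _ (Finset.mem_filter.1 hx').2
    · rw [← hIc, ← hXI, Finset.card_image_of_injOn]
      exact hinj'.mono (Finset.coe_subset.2 hXN')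

end Existence

/-! ### Licences, contractions and redundant pendant vertices -/

section Reductions

variable {V : Type*}

open Classical in
/-- In slides between configurations on `Z`, the tokens on the large components of the graph
without `Z` may be allowed to clash with no token. -/
theorem slides_of_slides_large [Fintype V] {G : SimpleGraph V}
    (h3 : ∀ a b c, G.Adj a b → G.Adj b c → ¬ G.Adj a c)
    (h4 : ∀ a b c d, a ≠ c → G.Adj a b → G.Adj b c → G.Adj a d → G.Adj d c → b = d)
    {k p D M : ℕ} (hpend : ∀ c, ∃ P : Finset V, P.card ≤ p ∧ ∀ x, G.Adj c x →
      (∀ y, G.Adj x y → y = c) → x ∈ P)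
    (Z : Finset V) (lab : V → V)
    (hlab : ∀ u v, lab u = lab v ↔ ReflTransGen (Within G.Adj {x | x ∉ Z}) u v)
    (hD : 2 * Z.card + p + (k + 1) * (k + 1) ≤ D) (hM : (D + 1) ^ (4 * k + 1) ≤ M)
    (hM' : Z.card + 2 * (k + (4 * k + 3) + 2 * k) ≤ M)
    {s t : Multiset V} (hs : s.card = k) (hsZ : ∀ x ∈ s, x ∈ Z)
    (hsF : ConflictFree (Clash G.Adj ∅) s) (ht : t.card = k) (htZ : ∀ x ∈ t, x ∈ Z)
    (htF : ConflictFree (Clash G.Adj ∅) t)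
    (hdeg : ∀ b, b ∈ s ∨ b ∈ t → (∀ y, G.Adj b y → y ∈ Z) ∨ M < G.degree b)
    (h : Slides G.Adj (Clash G.Adj
      {v | v ∉ Z ∧ M < (Finset.univ.filter fun w => lab w = lab v).card}) s t) :
    Slides G.Adj (Clash G.Adj ∅) s t := by
  set H : Set V := {v | v ∉ Z ∧ M < (Finset.univ.filter fun w => lab w = lab v).card} with hH
  -- The licence is withdrawn from one component after the other. The argument for one component
  -- tolerates a licence on the others, which is why absorbers were treated relative to an arbitrary
  -- `H`.
  have main : ∀ Ls : Finset V, Slides G.Adj (Clash G.Adj {v | v ∈ H ∧ lab v ∈ Ls}) s t →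
      Slides G.Adj (Clash G.Adj ∅) s t := by
    intro Ls
    induction Ls using Finset.induction with
    | empty =>
      intro h
      simpa using h
    | insert l Ls hl ih =>
      intro h
      apply ih
      set C : Set V := {v | v ∈ H ∧ lab v = l} with hC
      have hU : {v | v ∈ H ∧ lab v ∈ insert l Ls} = {v | v ∈ H ∧ lab v ∈ Ls} ∪ C := by
        ext v
        simp only [Finset.mem_insert, Set.mem_ofPred_eq, Set.mem_union, hC]
        tauto
      rw [hU] at h
      by_cases hne : ∃ c, c ∈ C
      swap
      · rw [show C = ∅ from Set.eq_empty_iff_forall_notMem.2 fun x hx => hne ⟨x, hx⟩,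
          Set.union_empty] at h
        exact h
      obtain ⟨c, hc⟩ := hne
      have hCZ : ∀ x ∈ C, x ∉ Z := fun x hx => hx.1.1
      have hCmem : ∀ y, y ∉ Z → lab y = l → y ∈ C := by
        intro y hy hyl
        refine ⟨⟨hy, ?_⟩, hyl⟩
        rw [hyl, ← hc.2]
        exact hc.1.2
      have hN : ∀ x ∈ C, ∀ y, G.Adj x y → y ∈ C ∨ y ∈ Z := by
        intro x hx y hxy
        by_cases hy : y ∈ Z
        · exact Or.inr hy
        · refine Or.inl (hCmem y hy ?_)
          rw [← hx.2]
          exact ((hlab x y).2 (ReflTransGen.single ⟨hxy, hCZ x hx, hy⟩)).symm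
      have hconn : ∀ x ∈ C, ∀ y ∈ C, ReflTransGen (Within G.Adj C) x y := by
        intro x hx y hy
        have hxy := (hlab x y).1 (hx.2.trans hy.2.symm)
        induction hxy with
        | refl => exact ReflTransGen.refl
        | tail hxz hzy ih =>
          have hz := hCmem _ hzy.2.1 (((hlab _ _).2 hxz).symm.trans hx.2)
          exact (ih hz).tail ⟨hzy.1, hz, hy⟩
      have hmemC : ∀ y, lab y = l → y ∈ C := by
        intro y hy
        refine hCmem y ?_ hy
        rcases ReflTransGen.cases_tail ((hlab c y).1 (hc.2.trans hy.symm)) with rfl | ⟨z, -, hz⟩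
        · exact hCZ _ hc
        · exact hz.2.2
      obtain ⟨B⟩ := nonempty_absorber_of_card (k := k) (w := 4 * k + 3) h3 h4 hpend Z hN hconn hD
        le_rfl (Finset.univ.filter fun w => lab w = l)
        (fun x hx => hmemC x (Finset.mem_filter.1 hx).2) (by
          refine lt_of_le_of_lt hM ?_
          have := hc.1.2
          rwa [hc.2] at this)
      have hanti : ∀ x y, Clash G.Adj {v | v ∈ H ∧ lab v ∈ Ls} x y → Clash G.Adj ∅ x y :=
        Clash.anti (Set.empty_subset _)
      refine B.slides_of_slides_union h4 Z hCZ hN (fun x hx => hx.1.1) hs hsZ (hsF.mono hanti)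
        ht htZ (htF.mono hanti) ?_ h
      -- A token next to `C` has a neighbour off `Z`, so the first alternative of `hdeg` fails for
      -- it and its degree is large.
      intro b hb hbC
      rcases hbC with hbC | ⟨x, hx, hbx⟩
      · exact absurd (hb.elim (hsZ b) (htZ b)) (hCZ b hbC)
      · rcases hdeg b hb with h | h
        · exact absurd (h x hbx) (hCZ x hx)
        · exact lt_of_le_of_lt hM' h
  apply main Finset.univ
  simpa using h

/-- The adjacency relation after vertices have been identified by `φ`. -/
def MapAdj (A : V → V → Prop) (φ : V → V) (u v : V) : Prop :=
  ∃ u' v', φ u' = u ∧ φ v' = v ∧ A u' v'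

theorem MapAdj.symmRel {A : V → V → Prop} (hA : SymmRel A) (φ : V → V) : SymmRel (MapAdj A φ) :=
  fun _ _ ⟨u', v', h1, h2, h3⟩ => ⟨v', u', h2, h1, hA h3⟩

/-- A token that stays on `H` conflicts with no token, so its way is never blocked. -/
theorem Slides.roam {A : V → V → Prop} (hA : SymmRel A) {H : Set V} {r : Multiset V}
    (hr : ConflictFree (Clash A H) r) {x y : V} (h : ReflTransGen (Within A H) x y) :
    Slides A (Clash A H) (x ::ₘ r) (y ::ₘ r) := by
  have key : ∀ z ∈ H, ConflictFree (Clash A H) (z ::ₘ r) := fun z hz =>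
    (conflictFree_cons (Clash.symmRel hA H)).2 ⟨hr, fun y _ hc => hc.1 hz⟩
  induction h with
  | refl => exact Slides.refl _
  | tail _ h ih => exact ih.trans (Slides.single h.1 (key _ h.2.1) (key _ h.2.2))

/-- Identifying the vertices of connected sets of vertices on which tokens clash with no token does
not change reachability. -/
theorem slides_mapAdj_iff {A : V → V → Prop} (hA : SymmRel A) {H : Set V} {φ : V → V}
    (hφ : ∀ v, v ∉ H → φ v = v) (hφH : ∀ v ∈ H, φ v ∈ H)
    (hconn : ∀ v ∈ H, ReflTransGen (Within A H) v (φ v)) {s t : Multiset V}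
    (hs : ∀ x ∈ s, x ∉ H) (ht : ∀ x ∈ t, x ∉ H) :
    Slides (MapAdj A φ) (Clash (MapAdj A φ) H) s t ↔ Slides A (Clash A H) s t := by
  have hQ := MapAdj.symmRel hA φ
  have hback : ∀ u, φ u ∉ H → φ u = u := fun u hu => hφ u fun h => hu (hφH u h)
  have hcl : ∀ u v, Clash (MapAdj A φ) H u v ↔ Clash A H u v := by
    intro u v
    refine and_congr_right fun hu => and_congr_right fun hv => or_congr_right ?_
    constructor
    · rintro ⟨u', v', rfl, rfl, h⟩
      rwa [hback u' hu, hback v' hv]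
    · intro h
      exact ⟨u, v, hφ u hu, hφ v hv, h⟩
  have hcl' : Clash (MapAdj A φ) H = Clash A H := by
    funext u v
    exact propext (hcl u v)
  rw [hcl']
  constructor
  · intro h
    clear hs ht
    induction h with
    | refl => exact Slides.refl _
    | tail _ hst ih =>
      obtain ⟨u, v, r, rfl, rfl, ⟨u', v', rfl, rfl, huv⟩, h1, h2⟩ := hst
      refine ih.trans ?_
      have hr := ((conflictFree_cons (Clash.symmRel hA H)).1 h1).1
      -- To imitate a slide of the contracted graph, the token walks inside `H` from the
      -- representative to the actual end of the edge, and back to the representative at the other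
      -- end.
      have hto : ∀ x, Slides A (Clash A H) (φ x ::ₘ r) (x ::ₘ r) := by
        intro x
        by_cases hx : x ∈ H
        · exact (Slides.roam hA hr (hconn x hx)).symm hA
        · rw [hφ x hx]
          exact Slides.refl _
      exact (hto u').trans ((Slides.single huv ((hto u').conflictFree h1)
        ((hto v').conflictFree h2)).trans ((hto v').symm hA))
  · intro h
    have := h.map (f := φ) (B := MapAdj A φ) (E := Clash A H) (Clash.symmRel hA H)
      (Clash.symmRel hA H) (fun u v h => ⟨u, v, rfl, rfl, h⟩) (by
        rintro u v ⟨h1, h2, h⟩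
        rw [hback u h1, hback v h2] at h
        exact ⟨fun hu => h1 (hφH u hu), fun hv => h2 (hφH v hv), h⟩)
    rwa [Multiset.map_congr rfl (fun x hx => hφ x (hs x hx)), Multiset.map_id',
      Multiset.map_congr rfl (fun x hx => hφ x (ht x hx)), Multiset.map_id'] at this

/-- Conflicts matter only where the tokens are. -/
theorem Slides.congr_within {A F F' : V → V → Prop} {U : Set V} (h : ∀ u ∈ U, ∀ v ∈ U,
    F' u v → F u v) {m m' : Multiset V} (hs : Slides (Within A U) F m m') (hm : ∀ x ∈ m, x ∈ U) :
    Slides (Within A U) F' m m' := by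
  have key : ∀ m : Multiset V, (∀ x ∈ m, x ∈ U) → ConflictFree F m → ConflictFree F' m := by
    intro m hm hF u v r e hc
    exact hF u v r e (h u (hm u (by simp [e])) v (hm v (by simp [e])) hc)
  induction hs with
  | refl => exact Slides.refl _
  | tail h1 h2 ih =>
    have hm1 := Slides.mem_of_within h1 hm
    have hm2 := Slides.mem_of_within (h1.tail h2) hm
    obtain ⟨u, v, r, e1, e2, huv, c1, c2⟩ := h2
    exact ih.tail ⟨u, v, r, e1, e2, huv, key _ hm1 c1, key _ hm2 c2⟩

/-! ### Redundant pendant vertices -/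

section Pendant

variable [Fintype V] [LinearOrder V] (G : SimpleGraph V) [DecidableRel G.Adj] (tok : Finset V)

/-- A pendant vertex without a token of the source or target configuration. -/
def FreePendant (v : V) : Prop := v ∉ tok ∧ G.degree v = 1

/-- The vertex `v` is redundant, because it is a free pendant vertex and not the first one at its
neighbour. -/
def Redundant (v : V) : Prop :=
  FreePendant G tok v ∧ ∃ u v', G.Adj v u ∧ FreePendant G tok v' ∧ v' < v ∧ G.Adj v' u

variable {G tok}

omit [LinearOrder V] in
theorem FreePendant.eq {v u u' : V} (h : FreePendant G tok v) (hu : G.Adj v u)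
    (hu' : G.Adj v u') : u = u' :=
  (G.degree_eq_one_iff_existsUnique_adj.1 h.2).unique hu hu'

theorem Redundant.exists_first {v u : V} (h : Redundant G tok v) (hvu : G.Adj v u) :
    ∃ v', FreePendant G tok v' ∧ v' < v ∧ G.Adj v' u ∧ ¬ Redundant G tok v' := by
  classical
  obtain ⟨hv, u', v', h1, h2, h3, h4⟩ := h
  obtain rfl := hv.eq h1 hvu
  obtain ⟨w, hw, hmin⟩ := (Finset.univ.filter fun w => FreePendant G tok w ∧ G.Adj w u' ∧
    w < v).exists_min_image id ⟨v', by simp [h2, h3, h4]⟩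
  simp only [Finset.mem_filter, Finset.mem_univ, true_and, id] at hw hmin
  refine ⟨w, hw.1, hw.2.2, hw.2.1, ?_⟩
  rintro ⟨-, u, v'', g1, g2, g3, g4⟩
  obtain rfl := hw.1.eq g1 hw.2.1
  exact absurd g3 (not_lt.2 (hmin v'' ⟨g2, g4, g3.trans hw.2.2⟩))

/-- An instance of `Slides.confine`. A token about to slide from `u` to a redundant vertex `v` is
sent to the first free pendant vertex `v'` at `u` instead. The transposition of `v` and `v'` is an
automorphism; it fixes the present tokens, since `v` is redundant and a token on `v'` would conflict
with the one on `u`, and it fixes the target, since both are free. -/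
theorem slides_within_notRedundant_iff {s t : Multiset V} (hs : ∀ x ∈ s, x ∈ tok)
    (ht : ∀ x ∈ t, x ∈ tok) (hsF : ConflictFree (Clash G.Adj ∅) s) :
    Slides (Within G.Adj {v | ¬ Redundant G tok v})
      (Clash (Within G.Adj {v | ¬ Redundant G tok v}) ∅) s t ↔
      Slides G.Adj (Clash G.Adj ∅) s t := by
  have hF : SymmRel (Clash G.Adj ∅) := Absorber.symmRel_clash
  have hsK : ∀ x ∈ s, x ∈ {v | ¬ Redundant G tok v} := fun x hx h => h.1.1 (hs x hx)
  constructor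
  · intro h
    have := h.congr_within (F' := Clash G.Adj ∅) (fun u hu v hv hc =>
      ⟨hc.1, hc.2.1, hc.2.2.imp id fun h => ⟨h, hu, hv⟩⟩) hsK
    exact this.mono (fun _ _ h => h.1) fun _ _ => id
  · intro h
    have := h.confine (K := {v | ¬ Redundant G tok v}) hF hsK hsF ?_
    · exact this.mono (fun _ _ => id) fun _ _ hc => ⟨hc.1, hc.2.1, hc.2.2.imp id fun h => h.1⟩
    intro m hm hmF _ u hu v hv huv
    have hv : Redundant G tok v := not_not.1 hv
    obtain ⟨v', hv', hlt, hv'u, hv'r⟩ := hv.exists_first huv.symm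
    have hadj : ∀ x, G.Adj v x ↔ x = u := fun x => ⟨fun h => hv.1.eq h huv.symm, by
      rintro rfl; exact huv.symm⟩
    have hadj' : ∀ x, G.Adj v' x ↔ x = u := fun x => ⟨fun h => hv'.eq h hv'u, by
      rintro rfl; exact hv'u⟩
    have hadj2 : ∀ x, G.Adj x v ↔ x = u := fun x => by rw [G.adj_comm, hadj]
    have hadj2' : ∀ x, G.Adj x v' ↔ x = u := fun x => by rw [G.adj_comm, hadj']
    have huv' : u ≠ v' := hv'u.ne'
    have huv1 : u ≠ v := huv.ne
    have hiff : ∀ x y, G.Adj (Equiv.swap v v' x) (Equiv.swap v v' y) ↔ G.Adj x y := by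
      intro x y
      have hc : ∀ x, Equiv.swap v v' x = u ↔ x = u := fun x => by
        rw [Equiv.swap_apply_def]
        split_ifs with h1 h2 <;> simp_all [eq_comm]
      by_cases hx : x = v
      · rw [hx, Equiv.swap_apply_left, hadj', hadj, hc]
      by_cases hx' : x = v'
      · rw [hx', Equiv.swap_apply_right, hadj', hadj, hc]
      by_cases hy : y = v
      · rw [hy, Equiv.swap_apply_left, hadj2', hadj2, hc]
      by_cases hy' : y = v'
      · rw [hy', Equiv.swap_apply_right, hadj2', hadj2, hc]
      rw [Equiv.swap_apply_of_ne_of_ne hx hx', Equiv.swap_apply_of_ne_of_ne hy hy']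
    refine ⟨Equiv.swap v v', fun x y => (hiff x y).2, fun x y hc => ⟨id, id, ?_⟩, fun x hx => ?_,
      fun x hx => ?_, ?_⟩
    · exact hc.2.2.imp (fun h => (Equiv.swap v v').injective h) (hiff x y).1
    · refine Equiv.swap_apply_of_ne_of_ne ?_ ?_
      · rintro rfl
        exact hm x hx hv
      · rintro rfl
        obtain ⟨r, rfl⟩ := Multiset.exists_cons_of_mem hu
        rcases Multiset.mem_cons.1 hx with h | h
        · exact huv' h.symm
        · exact ((conflictFree_cons hF).1 hmF).2 x h ⟨id, id, Or.inr hv'u.symm⟩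
    · refine Equiv.swap_apply_of_ne_of_ne ?_ ?_
      · rintro rfl
        exact hv.1.1 (ht x hx)
      · rintro rfl
        exact hv'.1 (ht x hx)
    · rw [Equiv.swap_apply_left]
      exact hv'r

/-- Unless `c` is itself a free pendant vertex, with a single neighbour, the surviving pendant
neighbours of `c` are occupied vertices or the first free pendant vertex at `c`. -/
theorem exists_pendant_bound (c : V) : ∃ P : Finset V, P.card ≤ tok.card + 1 ∧
    ∀ x, Within G.Adj {v | ¬ Redundant G tok v} c x →
      (∀ y, Within G.Adj {v | ¬ Redundant G tok v} x y → y = c) → x ∈ P := by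
  classical
  by_cases hc : FreePendant G tok c
  · refine ⟨G.neighborFinset c, ?_, fun x hx _ => ?_⟩
    · rw [SimpleGraph.card_neighborFinset_eq_degree, hc.2]
      omega
    · rw [SimpleGraph.mem_neighborFinset]
      exact hx.1
  · refine ⟨tok ∪ Finset.univ.filter (fun x => FreePendant G tok x ∧ ¬ Redundant G tok x ∧
      G.Adj x c), (Finset.card_union_le _ _).trans (Nat.add_le_add_left
        (Finset.card_le_one.2 ?_) _), fun x hx hpend => ?_⟩
    · intro x hx y hy
      simp only [Finset.mem_filter, Finset.mem_univ, true_and] at hx hy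
      rcases lt_trichotomy x y with h | h | h
      · exact absurd ⟨hy.1, c, x, hy.2.2, hx.1, h, hx.2.2⟩ hy.2.1
      · exact h
      · exact absurd ⟨hx.1, c, y, hx.2.2, hy.1, h, hy.2.2⟩ hx.2.1
    · by_cases hxt : x ∈ tok
      · simp [hxt]
      simp only [Finset.mem_union, Finset.mem_filter, Finset.mem_univ, true_and]
      refine Or.inr ⟨⟨hxt, ?_⟩, hx.2.2, hx.1.symm⟩
      rw [G.degree_eq_one_iff_existsUnique_adj]
      refine ⟨c, hx.1.symm, fun y hy => ?_⟩
      -- Deleting redundant vertices creates no new pendant ones: if `x` loses the neighbour `y`,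
      -- the first free pendant vertex at `x` survives, and it cannot be `c`.
      by_cases hyr : Redundant G tok y
      · obtain ⟨v', h1, -, h3, h4⟩ := hyr.exists_first hy.symm
        have := hpend v' ⟨h3.symm, hx.2.2, h4⟩
        exact absurd (this ▸ h1) hc
      · exact hpend y ⟨hy, hx.2.2, hyr⟩

end Pendant

end Reductions

/-! ### Keeping `k` components of each type -/

section Types

variable {V : Type*}

/-- A graph whose vertices off `Z` fall into labelled classes, with no edge between vertices of
different classes. The active vertices, which include all vertices off `Z` of positive degree, are
ranked in their classes, and classes with equal signatures are copies of each other. -/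
structure ClassSystem (A : V → V → Prop) (H : Set V) (Z : Finset V) (ac : V → Prop)
    (lab : V → V) (rk sg : V → ℕ) : Prop where
  symm : SymmRel A
  notMem : ∀ x, ac x → x ∉ Z
  active : ∀ x y, A x y → x ∈ Z ∨ ac x
  lab_eq : ∀ x y, A x y → x ∉ Z → y ∉ Z → lab x = lab y
  rk_inj : ∀ x y, ac x → ac y → lab x = lab y → rk x = rk y → x = y
  copy : ∀ x l, ac x → (∃ y, ac y ∧ lab y = l) → sg (lab x) = sg l →
    ∃ x', ac x' ∧ lab x' = l ∧ rk x' = rk x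
  outer : ∀ x x', ac x → ac x' → sg (lab x) = sg (lab x') → rk x = rk x' →
    (x ∈ H → x' ∈ H) ∧ ∀ z ∈ Z, A x z → A x' z
  inner : ∀ x y x' y', ac x → ac y → ac x' → ac y' → lab x = lab y → lab x' = lab y' →
    sg (lab x) = sg (lab x') → rk x = rk x' → rk y = rk y' → A x y → A x' y'

variable [Fintype V] [LinearOrder V]

open Classical in
/-- The labels of the classes before the class `l` that have the same signature. -/
noncomputable def earlier (ac : V → Prop) (lab : V → V) (sg : V → ℕ) (l : V) : Finset V :=
  Finset.univ.filter fun l' => (∃ y, ac y ∧ lab y = l') ∧ l' < l ∧ sg l' = sg l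

theorem mem_earlier {ac : V → Prop} {lab : V → V} {sg : V → ℕ} {l l' : V} :
    l' ∈ earlier ac lab sg l ↔ (∃ y, ac y ∧ lab y = l') ∧ l' < l ∧ sg l' = sg l := by
  simp [earlier]

/-- The vertices of `Z` and those of the first `k` classes of each signature. -/
def keptSet (Z : Finset V) (ac : V → Prop) (lab : V → V) (sg : V → ℕ) (k : ℕ) : Set V :=
  {v | v ∈ Z ∨ ac v ∧ (earlier ac lab sg (lab v)).card < k}

namespace ClassSystem

variable {A : V → V → Prop} {H : Set V} {Z : Finset V} {ac : V → Prop} {lab : V → V}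
  {rk sg : V → ℕ}

omit [Fintype V] [LinearOrder V] in
-- The vertices of two classes with equal signature are exchanged according to their ranks. As ranks
-- are injective in each class, this is an involution; `outer` and `inner` make it an automorphism
-- that preserves `H`.
theorem exists_swap (S : ClassSystem A H Z ac lab rk sg) {l₁ l₂ : V} (hne : l₁ ≠ l₂)
    (h₁ : ∃ y, ac y ∧ lab y = l₁) (h₂ : ∃ y, ac y ∧ lab y = l₂) (hsg : sg l₁ = sg l₂) :
    ∃ σ : V → V, (∀ x y, A x y → A (σ x) (σ y)) ∧
      (∀ x y, Clash A H (σ x) (σ y) → Clash A H x y) ∧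
      (∀ x, (ac x → lab x ≠ l₁ ∧ lab x ≠ l₂) → σ x = x) ∧
      ∀ x, ac x → lab x = l₁ → ac (σ x) ∧ lab (σ x) = l₂ := by
  classical
  have c12 : ∀ x, ac x ∧ lab x = l₁ → ∃ x', ac x' ∧ lab x' = l₂ ∧ rk x' = rk x := fun x hx =>
    S.copy x l₂ hx.1 h₂ (by rw [hx.2, hsg])
  have c21 : ∀ x, ac x ∧ lab x = l₂ → ∃ x', ac x' ∧ lab x' = l₁ ∧ rk x' = rk x := fun x hx =>
    S.copy x l₁ hx.1 h₁ (by rw [hx.2, hsg])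
  choose f hf1 hf2 hf3 using c12
  choose g hg1 hg2 hg3 using c21
  let σ : V → V := fun x => if h : ac x ∧ lab x = l₁ then f x h else
    if h : ac x ∧ lab x = l₂ then g x h else x
  have σ1 : ∀ x, ac x → lab x = l₁ → ac (σ x) ∧ lab (σ x) = l₂ ∧ rk (σ x) = rk x := by
    intro x h h'
    have : σ x = f x ⟨h, h'⟩ := dif_pos ⟨h, h'⟩
    rw [this]
    exact ⟨hf1 _ _, hf2 _ _, hf3 _ _⟩
  have σ2 : ∀ x, ac x → lab x = l₂ → ac (σ x) ∧ lab (σ x) = l₁ ∧ rk (σ x) = rk x := by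
    intro x h h'
    have : σ x = g x ⟨h, h'⟩ := by
      simp only [σ]
      rw [dif_neg (by rintro ⟨-, h''⟩; exact hne (h''.symm.trans h')), dif_pos ⟨h, h'⟩]
    rw [this]
    exact ⟨hg1 _ _, hg2 _ _, hg3 _ _⟩
  have σ0 : ∀ x, (ac x → lab x ≠ l₁ ∧ lab x ≠ l₂) → σ x = x := by
    intro x h
    simp only [σ]
    rw [dif_neg fun h' => (h h'.1).1 h'.2, dif_neg fun h' => (h h'.1).2 h'.2]
  have σmv : ∀ x, ac x → (lab x = l₁ ∨ lab x = l₂) → ac (σ x) ∧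
      sg (lab x) = sg (lab (σ x)) ∧ rk x = rk (σ x) := by
    rintro x h (h' | h')
    · obtain ⟨a, b, c⟩ := σ1 x h h'
      exact ⟨a, by rw [h', b, hsg], c.symm⟩
    · obtain ⟨a, b, c⟩ := σ2 x h h'
      exact ⟨a, by rw [h', b, hsg], c.symm⟩
  have σσ : ∀ x, σ (σ x) = x := by
    intro x
    by_cases h : ac x ∧ lab x = l₁
    · obtain ⟨a, b, c⟩ := σ1 x h.1 h.2
      obtain ⟨a', b', c'⟩ := σ2 _ a b
      exact S.rk_inj _ _ a' h.1 (by rw [b', h.2]) (by rw [c', c])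
    by_cases h' : ac x ∧ lab x = l₂
    · obtain ⟨a, b, c⟩ := σ2 x h'.1 h'.2
      obtain ⟨a', b', c'⟩ := σ1 _ a b
      exact S.rk_inj _ _ a' h'.1 (by rw [b', h'.2]) (by rw [c', c])
    · have : σ x = x := σ0 x fun hx => ⟨fun e => h ⟨hx, e⟩, fun e => h' ⟨hx, e⟩⟩
      rw [this, this]
  have hA1 : ∀ x y, A x y → ac x → (lab x = l₁ ∨ lab x = l₂) → A (σ x) (σ y) := by
    intro x y hxy hx hl
    obtain ⟨a, b, c⟩ := σmv x hx hl
    by_cases hy : y ∈ Z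
    · rw [σ0 y fun h => absurd hy (S.notMem y h)]
      exact (S.outer x _ hx a b c).2 y hy hxy
    · have hay := (S.active y x (S.symm hxy)).resolve_left hy
      have hlab := S.lab_eq x y hxy (S.notMem x hx) hy
      obtain ⟨a', b', c'⟩ := σmv y hay (hlab ▸ hl)
      refine S.inner x y _ _ hx hay a a' hlab ?_ b c c' hxy
      rcases hl with hl | hl
      · rw [(σ1 x hx hl).2.1, (σ1 y hay (hlab ▸ hl)).2.1]
      · rw [(σ2 x hx hl).2.1, (σ2 y hay (hlab ▸ hl)).2.1]
  have hA : ∀ x y, A x y → A (σ x) (σ y) := by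
    intro x y hxy
    by_cases hx : ac x ∧ (lab x = l₁ ∨ lab x = l₂)
    · exact hA1 x y hxy hx.1 hx.2
    by_cases hy : ac y ∧ (lab y = l₁ ∨ lab y = l₂)
    · exact S.symm (hA1 y x (S.symm hxy) hy.1 hy.2)
    · rw [σ0 x fun h => by grind, σ0 y fun h => by grind]
      exact hxy
  have hH : ∀ x, x ∈ H → σ x ∈ H := by
    intro x hx
    by_cases h : ac x ∧ (lab x = l₁ ∨ lab x = l₂)
    · obtain ⟨a, b, c⟩ := σmv x h.1 h.2
      exact (S.outer x _ h.1 a b c).1 hx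
    · rwa [σ0 x fun h => by grind]
  refine ⟨σ, hA, ?_, σ0, fun x h h' => ⟨(σ1 x h h').1, (σ1 x h h').2.1⟩⟩
  rintro x y ⟨c1, c2, c3⟩
  refine ⟨fun h => c1 (hH x h), fun h => c2 (hH y h), ?_⟩
  rcases c3 with c3 | c3
  · exact Or.inl (by rw [← σσ x, c3, σσ])
  · exact Or.inr (by rw [← σσ x, ← σσ y]; exact hA _ _ c3)

/-- Consider the least label up to `l` of this signature with at least `k` earlier ones. All labels
earlier than it are kept, and there are at least `k` of them. -/
theorem le_card_kept (l : V) (k : ℕ) (h : k ≤ (earlier ac lab sg l).card) :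
    ∃ Q ⊆ earlier ac lab sg l, k ≤ Q.card ∧ ∀ l' ∈ Q, (earlier ac lab sg l').card < k := by
  classical
  refine ⟨(earlier ac lab sg l).filter fun l' => (earlier ac lab sg l').card < k,
    Finset.filter_subset _ _, ?_, fun l' h => (Finset.mem_filter.1 h).2⟩
  by_contra! hlt
  obtain ⟨l₀, h0, hmin⟩ := (Finset.univ.filter fun l₀ => l₀ ≤ l ∧ sg l₀ = sg l ∧
    k ≤ (earlier ac lab sg l₀).card).exists_min_image id ⟨l, by simp [h]⟩
  simp only [Finset.mem_filter, Finset.mem_univ, true_and, id] at h0 hmin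
  refine absurd h0.2.2 (not_le.2 (lt_of_le_of_lt (Finset.card_le_card ?_) hlt))
  intro l' hl'
  rw [mem_earlier] at hl'
  rw [Finset.mem_filter, mem_earlier]
  refine ⟨⟨hl'.1, hl'.2.1.trans_le h0.1, hl'.2.2.trans h0.2.1⟩, ?_⟩
  by_contra! hge
  have := hmin l' ⟨(hl'.2.1.trans_le h0.1).le, hl'.2.2.trans h0.2.1, hge⟩
  exact absurd hl'.2.1 (not_lt.2 this)

/-- Slides of `k` tokens may be confined to the first `k` classes of each signature. -/
theorem slides_iff (S : ClassSystem A H Z ac lab rk sg) {k : ℕ} {s t : Multiset V}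
    (hs : s.card = k) (hsZ : ∀ x ∈ s, x ∈ Z) (htZ : ∀ x ∈ t, x ∈ Z)
    (hsF : ConflictFree (Clash A H) s) :
    Slides (Within A (keptSet Z ac lab sg k)) (Clash A H) s t ↔ Slides A (Clash A H) s t := by
  classical
  refine ⟨fun h => h.mono (fun _ _ h => h.1) fun _ _ => id, fun h => h.confine
    (Clash.symmRel S.symm H) (fun x hx => Or.inl (hsZ x hx)) hsF ?_⟩
  intro m hm _ hmk u hu v hv huv
  have hvZ : v ∉ Z := fun h => hv (Or.inl h)
  have hav := (S.active v u (S.symm huv)).resolve_left hvZ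
  have huZ : u ∈ Z := by
    by_contra huZ
    rcases hm u hu with h | h
    · exact huZ h
    · exact hv (Or.inr ⟨hav, S.lab_eq u v huv huZ hvZ ▸ h.2⟩)
  obtain ⟨Q, hQ, hQk, hQ'⟩ := le_card_kept (ac := ac) (lab := lab) (sg := sg) (lab v) k
    (not_lt.1 fun h => hv (Or.inr ⟨hav, h⟩))
  obtain ⟨r, rfl⟩ := Multiset.exists_cons_of_mem hu
  -- Besides the moving token there are only `k - 1` others, so one of the `k` kept classes of this
  -- signature is free of tokens. Since `u ∈ Z`, exchanging it with the class of `v` moves no token.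
  obtain ⟨l, hl, hlr⟩ : ∃ l ∈ Q, l ∉ (r.map lab).toFinset := by
    by_contra! hcon
    have h1 := Finset.card_le_card hcon
    have h2 := Multiset.toFinset_card_le (r.map lab)
    rw [Multiset.card_map] at h2
    rw [Multiset.card_cons, hs] at hmk
    omega
  have hl' := hQ hl
  rw [mem_earlier] at hl'
  obtain ⟨σ, h1, h2, h3, h4⟩ := S.exists_swap hl'.2.1.ne' ⟨v, hav, rfl⟩ hl'.1 hl'.2.2.symm
  refine ⟨σ, h1, h2, fun x hx => h3 x fun hax => ⟨fun e => ?_, fun e => ?_⟩, fun x hx =>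
    h3 x fun hax => absurd (htZ x hx) (S.notMem x hax), ?_⟩
  · rcases hm x hx with h | h
    · exact S.notMem x hax h
    · exact hv (Or.inr ⟨hav, e ▸ h.2⟩)
  · rcases Multiset.mem_cons.1 hx with rfl | hx
    · exact S.notMem x hax huZ
    · exact hlr (by rw [Multiset.mem_toFinset, ← e]; exact Multiset.mem_map_of_mem _ hx)
  · obtain ⟨h5, h6⟩ := h4 v hav rfl
    exact Or.inr ⟨h5, h6 ▸ hQ' l hl⟩

/-- A bound for the number of kept vertices. -/
theorem ncard_keptSet_le {M X k : ℕ} (hM : ∀ l, {v | ac v ∧ lab v = l}.ncard ≤ M)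
    (U : Finset ℕ) (hU : ∀ y, ac y → sg (lab y) ∈ U) (hX : U.card ≤ X) :
    (keptSet Z ac lab sg k).ncard ≤ Z.card + k * X * M := by
  classical
  set L : Finset V := Finset.univ.filter fun l => (∃ y, ac y ∧ lab y = l) ∧
    (earlier ac lab sg l).card < k with hL
  have hLc : L.card ≤ k * U.card := by
    refine Finset.card_le_mul_card_image_of_maps_to (f := sg) ?_ k ?_
    · intro l hl
      obtain ⟨⟨y, hy, rfl⟩, -⟩ := (Finset.mem_filter.1 hl).2
      exact hU y hy
    · intro b _
      rcases (L.filter fun l => sg l = b).eq_empty_or_nonempty with h | h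
      · simp [h]
      · set F := L.filter fun l => sg l = b with hF
        have hmax := Finset.max'_mem F h
        simp only [hF, hL, Finset.mem_filter, Finset.mem_univ, true_and] at hmax
        -- The last kept label of a signature has fewer than `k` predecessors of this signature, and
        -- all other kept ones are among them.
        have hsub : F.erase (F.max' h) ⊆ earlier ac lab sg (F.max' h) := by
          intro l hl
          have hl1 := Finset.mem_of_mem_erase hl
          have hlt := lt_of_le_of_ne (Finset.le_max' F l hl1) (Finset.ne_of_mem_erase hl)
          simp only [hF, hL, Finset.mem_filter, Finset.mem_univ, true_and] at hl1
          rw [mem_earlier]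
          exact ⟨hl1.1.1, hlt, hl1.2.trans hmax.2.symm⟩
        have h1 := Finset.card_le_card hsub
        rw [Finset.card_erase_of_mem (Finset.max'_mem F h)] at h1
        have h2 : (earlier ac lab sg (F.max' h)).card < k := hmax.1.2
        change F.card ≤ k
        omega
  have hsub : keptSet Z ac lab sg k ⊆
      ((Z ∪ L.biUnion fun l => Finset.univ.filter fun v => ac v ∧ lab v = l : Finset V) :
        Set V) := by
    rintro v (hv | ⟨hv, hk⟩)
    · simp [hv]
    · simp only [Finset.coe_union, Finset.coe_biUnion, Set.mem_union, Set.mem_iUnion]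
      refine Or.inr ⟨lab v, ?_, by simp [hv]⟩
      simp only [hL, Finset.coe_filter, Finset.mem_univ, true_and]
      exact ⟨⟨v, hv, rfl⟩, hk⟩
  refine (Set.ncard_le_ncard hsub).trans ?_
  rw [Set.ncard_coe_finset]
  refine (Finset.card_union_le _ _).trans (Nat.add_le_add_left ?_ _)
  refine (Finset.card_biUnion_le_card_mul _ _ M fun l _ => ?_).trans
    (Nat.mul_le_mul_right _ (hLc.trans (Nat.mul_le_mul_left _ hX)))
  rw [← Set.ncard_coe_finset]
  simpa using hM l

end ClassSystem

end Types

/-! ### Girth at least five forbids triangles and 4-cycles -/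

section Girth

variable {V : Type*} {G : SimpleGraph V}

theorem not_adj_of_five_le_egirth (h : 5 ≤ G.egirth) (a b c : V) (hab : G.Adj a b)
    (hbc : G.Adj b c) : ¬ G.Adj a c := by
  intro hac
  have hc : (SimpleGraph.Walk.cons hab (.cons hbc (.cons hac.symm .nil))).IsCycle := by
    rw [SimpleGraph.Walk.cons_isCycle_iff]
    have h1 := hab.ne
    have h2 := hbc.ne
    have h3 := hac.ne
    constructor
    · simp [SimpleGraph.Walk.cons_isPath_iff, h1.symm, h2, h3.symm]
    · simp [h1, h1.symm, h2, h3]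
  have := h.trans (SimpleGraph.egirth_le_length hc)
  simp at this
  exact absurd this (by decide)

theorem eq_of_five_le_egirth (h : 5 ≤ G.egirth) (a b c d : V) (hac : a ≠ c) (hab : G.Adj a b)
    (hbc : G.Adj b c) (had : G.Adj a d) (hdc : G.Adj d c) : b = d := by
  by_contra hbd
  have hc : (SimpleGraph.Walk.cons hab (.cons hbc (.cons hdc.symm (.cons had.symm .nil)))).IsCycle
      := by
    rw [SimpleGraph.Walk.cons_isCycle_iff]
    have h1 := hab.ne
    have h2 := hbc.ne
    have h3 := hdc.ne
    have h4 := had.ne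
    constructor
    · simp [SimpleGraph.Walk.cons_isPath_iff, h1.symm, h2, h3.symm, hac.symm, hbd, h4.symm]
    · simp [h1, h1.symm, h2, hac, hbd, h4]
  have := h.trans (SimpleGraph.egirth_le_length hc)
  simp at this
  exact absurd this (by decide)

end Girth

/-! ### Token Sliding in terms of multisets -/

section Instances

theorem conflictFree_val_iff {V : Type*} {G : SimpleGraph V} {I : Finset V} :
    ConflictFree (Clash G.Adj ∅) I.val ↔ G.IsIndepSet I := by
  classical
  have hF : SymmRel (Clash G.Adj ∅) := Absorber.symmRel_clash
  constructor
  · intro h u hu v hv huv hadj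
    have hu : u ∈ I := by simpa using hu
    have hv : v ∈ I := by simpa using hv
    have e : I.val = u ::ₘ (I.erase u).val := by
      rw [← Finset.insert_val_of_notMem (Finset.notMem_erase u I), Finset.insert_erase hu]
    rw [e, conflictFree_cons hF] at h
    exact h.2 v (Finset.mem_def.1 (Finset.mem_erase.2 ⟨huv.symm, hv⟩)) ⟨id, id, Or.inr hadj⟩
  · intro h
    have := conflictFree_map_val hF id I fun i hi j hj hij hc =>
      hc.2.2.elim hij (h (by simpa using hi) (by simpa using hj) hij)
    simpa using this

/-- Because the two sets have the same size, their symmetric difference `{u, v}` has one element in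
each of them. -/
theorem tokenSlide_iff_exists {n k : ℕ} {G : SimpleGraph (Fin n)} {I J : Finset (Fin n)}
    (hI : I.card = k) (hJ : J.card = k) :
    TokenSlide G I J ↔ ∃ u v r, I.val = u ::ₘ r ∧ J.val = v ::ₘ r ∧ G.Adj u v := by
  have key : ∀ {I J : Finset (Fin n)} {u v : Fin n}, I.card = k → J.card = k → G.Adj u v →
      symmDiff I J = {u, v} → u ∈ I → ∃ r, I.val = u ::ₘ r ∧ J.val = v ::ₘ r := by
    intro I J u v hI hJ huv hs hu
    have hmem : ∀ x, x ∈ symmDiff I J ↔ x = u ∨ x = v := fun x => by simp [hs]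
    simp only [Finset.mem_symmDiff] at hmem
    have huJ : u ∉ J := fun h => by have := hmem u; tauto
    have hvJ : v ∈ J := by
      by_contra hvJ
      have hlt : J ⊂ I := by
        rw [Finset.ssubset_iff_of_subset]
        · exact ⟨u, hu, huJ⟩
        · intro x hx
          by_contra hxI
          rcases (hmem x).1 (Or.inr ⟨hx, hxI⟩) with rfl | rfl
          · exact huJ hx
          · exact hvJ hx
      have := Finset.card_lt_card hlt
      omega
    have hvI : v ∉ I := fun h => by have := hmem v; tauto
    refine ⟨(I.erase u).val, ?_, ?_⟩
    · rw [← Finset.insert_val_of_notMem (Finset.notMem_erase u I), Finset.insert_erase hu]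
    · rw [← Finset.insert_val_of_notMem (by simp [hvI])]
      congr 1
      ext x
      have := hmem x
      have := huv.ne
      simp only [Finset.mem_insert, Finset.mem_erase]
      by_cases hxu : x = u
      · subst hxu; simp [huJ, this]
      by_cases hxv : x = v
      · subst hxv; simp [hvJ]
      · simp only [hxu, hxv, false_or, not_false_iff, true_and, ne_eq] at this ⊢
        tauto
  constructor
  · rintro ⟨u, v, huv, hs⟩
    by_cases hu : u ∈ I
    · obtain ⟨r, h1, h2⟩ := key hI hJ huv hs hu
      exact ⟨u, v, r, h1, h2, huv⟩
    · have huJ : u ∈ J := by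
        have : u ∈ symmDiff I J := by simp [hs]
        rw [Finset.mem_symmDiff] at this
        tauto
      obtain ⟨r, h1, h2⟩ := key hJ hI huv (by rw [symmDiff_comm, hs]) huJ
      exact ⟨v, u, r, h2, h1, huv.symm⟩
  · rintro ⟨u, v, r, h1, h2, huv⟩
    refine ⟨u, v, huv, ?_⟩
    have n1 := I.nodup
    have n2 := J.nodup
    rw [h1, Multiset.nodup_cons] at n1
    rw [h2, Multiset.nodup_cons] at n2
    have e1 : ∀ x, x ∈ I ↔ x = u ∨ x ∈ r := fun x => by simp [← Finset.mem_val, h1]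
    have e2 : ∀ x, x ∈ J ↔ x = v ∨ x ∈ r := fun x => by simp [← Finset.mem_val, h2]
    ext x
    simp only [Finset.mem_symmDiff, e1, e2, Finset.mem_insert, Finset.mem_singleton]
    have := huv.ne
    by_cases hxu : x = u
    · subst hxu; simp [n1.1, this]
    by_cases hxv : x = v
    · subst hxv; simp [n2.1, this.symm]
    · tauto

theorem TokenSlidingInstance.isYes_iff (x : TokenSlidingInstance) :
    x.IsYes ↔ Slides x.G.Adj (Clash x.G.Adj ∅) x.source.val x.target.val := by
  constructor
  · rintro ⟨l, I, h0, hl, hI, hstep⟩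
    rw [← h0, ← hl]
    have : ∀ i ≤ l, Slides x.G.Adj (Clash x.G.Adj ∅) (I 0).val (I i).val := by
      intro i
      induction i with
      | zero => exact fun _ => Slides.refl _
      | succ i ih =>
        intro hi
        obtain ⟨u, v, r, h1, h2, huv⟩ := (tokenSlide_iff_exists (hI i (by omega)).card_eq
          (hI (i + 1) hi).card_eq).1 (hstep i (by omega))
        exact (ih (by omega)).tail ⟨u, v, r, h1, h2, huv,
          conflictFree_val_iff.2 (hI i (by omega)).isIndepSet,
          conflictFree_val_iff.2 (hI (i + 1) hi).isIndepSet⟩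
    exact this l le_rfl
  · intro h
    have : ∀ m, Slides x.G.Adj (Clash x.G.Adj ∅) x.source.val m →
        ∃ (l : ℕ) (I : ℕ → Finset (Fin x.n)), I 0 = x.source ∧ (I l).val = m ∧
          (∀ i ≤ l, x.G.IsNIndepSet x.k (I i)) ∧ (∀ i < l, TokenSlide x.G (I i) (I (i + 1))) := by
      intro m hm
      induction hm with
      | refl =>
        exact ⟨0, fun _ => x.source, rfl, rfl, fun _ _ => x.source_indep,
          fun i hi => absurd hi (Nat.not_lt_zero i)⟩
      | @tail m m' h1 h2 ih =>
        obtain ⟨l, I, h0, hl, hI, hstep⟩ := ih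
        have hcard : m'.card = x.k := (Slides.card_eq (h1.tail h2)).trans x.source_indep.card_eq
        obtain ⟨u, v, r, e1, e2, huv, hc1, hc2⟩ := h2
        -- Every multiset reached is a set, because equal positions clash.
        have hnd : m'.Nodup := hc2.nodup Absorber.symmRel_adj fun _ _ => id
        set J : Finset (Fin x.n) := ⟨m', hnd⟩ with hJ
        have hJi : x.G.IsNIndepSet x.k J := ⟨conflictFree_val_iff.1 hc2, hcard⟩
        refine ⟨l + 1, fun i => if i ≤ l then I i else J, by simp [h0], by simp [hJ],
          fun i hi => ?_, fun i hi => ?_⟩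
        · dsimp only
          split_ifs with h
          · exact hI i h
          · exact hJi
        · dsimp only
          rw [if_pos (by omega : i ≤ l)]
          split_ifs with h
          · exact hstep i h
          · obtain rfl : i = l := by omega
            exact (tokenSlide_iff_exists (hI i le_rfl).card_eq hJi.card_eq).2
              ⟨u, v, r, hl.trans e1, e2, huv⟩
    obtain ⟨l, I, h0, hl, h1, h2⟩ := this _ h
    exact ⟨l, I, h0, Finset.val_inj.1 hl, h1, h2⟩

end Instances

/-! ### Labelled tokens -/

section Tuples

variable {V ι : Type*} [Fintype ι] [DecidableEq ι] {A F : V → V → Prop}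

/-- One entry of a tuple changes along `A`. -/
def TupleStep (A : V → V → Prop) (f g : ι → V) : Prop :=
  ∃ i, A (f i) (g i) ∧ ∀ j, j ≠ i → g j = f j

/-- No two entries of a tuple are in conflict. -/
def TupleFree (F : V → V → Prop) (f : ι → V) : Prop := ∀ i j, i ≠ j → ¬ F (f i) (f j)

/-- The multiset of the entries of a tuple. -/
def entries (f : ι → V) : Multiset V := (Finset.univ : Finset ι).val.map f

theorem entries_eq_cons (f : ι → V) (i : ι) :
    entries f = f i ::ₘ ((Finset.univ.erase i).val.map f) := by
  rw [entries, ← Multiset.map_cons, ← Finset.insert_val_of_notMem (Finset.notMem_erase i _),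
    Finset.insert_erase (Finset.mem_univ i)]

theorem conflictFree_entries_iff (hF : SymmRel F) {f : ι → V} :
    ConflictFree F (entries f) ↔ TupleFree F f := by
  constructor
  · intro h i j hij
    rw [entries_eq_cons f i, conflictFree_cons hF] at h
    exact h.2 _ (Multiset.mem_map_of_mem f (Finset.mem_def.1 (by simpa using hij.symm)))
  · intro h
    exact conflictFree_map_val hF f _ fun i _ j _ => h i j

theorem TupleStep.entries_eq {f g : ι → V} {i : ι} (h : ∀ j, j ≠ i → g j = f j) :
    entries g = g i ::ₘ ((Finset.univ.erase i).val.map f) := by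
  rw [entries_eq_cons g i]
  congr 1
  refine Multiset.map_congr rfl fun j hj => h j ?_
  exact Finset.ne_of_mem_erase (Finset.mem_def.2 hj)

/-- Tokens keep their identities along a run, so slides of multisets lift to moves of tuples. The
final tuple may list the target in any order. -/
theorem slides_entries_iff (hF : SymmRel F) {f : ι → V} (hf : TupleFree F f) {m : Multiset V} :
    Slides A F (entries f) m ↔ ∃ g : ι → V, entries g = m ∧
      ReflTransGen (fun f g => TupleStep A f g ∧ TupleFree F g) f g := by
  constructor
  · intro h
    induction h with
    | refl => exact ⟨f, rfl, ReflTransGen.refl⟩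
    | tail _ h ih =>
      obtain ⟨g, rfl, hg⟩ := ih
      obtain ⟨u, v, r, h1, rfl, huv, -, h2⟩ := h
      have hu : u ∈ entries g := by simp [h1]
      obtain ⟨i, -, rfl⟩ := Multiset.mem_map.1 hu
      rw [entries_eq_cons g i] at h1
      obtain rfl := Multiset.cons_inj_right _ |>.1 h1
      have e : entries (Function.update g i v) = v ::ₘ (Finset.univ.erase i).val.map g := by
        rw [TupleStep.entries_eq (f := g) (i := i) fun j hj => Function.update_of_ne hj _ _,
          Function.update_self]
      refine ⟨Function.update g i v, e, hg.tail ⟨⟨i, by simpa using huv, fun j hj =>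
        Function.update_of_ne hj _ _⟩, ?_⟩⟩
      rw [← conflictFree_entries_iff hF, e]
      exact h2
  · rintro ⟨g, rfl, h⟩
    have : TupleFree F g ∧ Slides A F (entries f) (entries g) := by
      induction h with
      | refl => exact ⟨hf, Slides.refl _⟩
      | tail _ h ih =>
        obtain ⟨⟨i, hA, hi⟩, hfree⟩ := h
        refine ⟨hfree, ih.2.tail ⟨_, _, _, entries_eq_cons _ i, TupleStep.entries_eq hi, hA, ?_, ?_⟩⟩
        · exact (conflictFree_entries_iff hF).2 ih.1
        · exact (conflictFree_entries_iff hF).2 hfree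
    exact this.2

/-- Transports slides inside the image of `e` to the index type, so that the kernel can be handled
through an enumeration of its vertices. -/
theorem slides_within_range_iff {W : Type*} (hF : SymmRel F) {e : W → V}
    (he : Function.Injective e) {s t : Multiset W} :
    Slides (Within A (Set.range e)) F (s.map e) (t.map e) ↔
      Slides (fun x y => A (e x) (e y)) (fun x y => F (e x) (e y)) s t := by
  have hFe : SymmRel fun x y => F (e x) (e y) := fun _ _ h => hF h
  constructor
  · intro h
    rcases s.empty_or_exists_mem with rfl | ⟨w, -⟩
    · have := h.card_eq
      simp only [Multiset.card_map, Multiset.card_zero, Multiset.card_eq_zero] at this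
      rw [this]
      exact Slides.refl _
    have : Nonempty W := ⟨w⟩
    have hinv := Function.leftInverse_invFun he
    have h' := h.congr_within 
      (F' := fun u v => F (e (Function.invFun e u)) (e (Function.invFun e v)))
      (by rintro _ ⟨x, rfl⟩ _ ⟨y, rfl⟩; simp [hinv x, hinv y]) (by simp)
    have := h'.map (f := Function.invFun e) (B := fun x y => A (e x) (e y))
      (E := fun x y => F (e x) (e y)) (fun _ _ h => hF h) hFe
      (by
        rintro u v ⟨h, ⟨x, rfl⟩, ⟨y, rfl⟩⟩
        simpa [hinv x, hinv y] using h)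
      (fun _ _ => id)
    simpa [Multiset.map_map, Function.comp_def, hinv _] using this
  · intro h
    exact h.map (f := e) (B := Within A (Set.range e)) (E := F) hFe hF
      (fun u v h => ⟨h, ⟨u, rfl⟩, ⟨v, rfl⟩⟩) fun _ _ => id

end Tuples

/-! ### Breadth-first search in rounds -/

section Rounds

variable {α : Type*} [Fintype α] {step : α → α → Prop} {R : ℕ → α → Prop}

/-- A search in rounds is complete after as many rounds as there are vertices. -/
theorem rounds_iff (hR : ∀ i c, R (i + 1) c ↔ R i c ∨ ∃ c', R i c' ∧ step c' c) {m : ℕ}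
    (hm : Fintype.card α ≤ m) (c : α) : R m c ↔ ∃ c₀, R 0 c₀ ∧ ReflTransGen step c₀ c := by
  classical
  have hsound : ∀ i c, R i c → ∃ c₀, R 0 c₀ ∧ ReflTransGen step c₀ c := by
    intro i
    induction i with
    | zero => exact fun c h => ⟨c, h, ReflTransGen.refl⟩
    | succ i ih =>
      intro c h
      rcases (hR i c).1 h with h | ⟨c', h, hs⟩
      · exact ih c h
      · obtain ⟨c₀, h0, h1⟩ := ih c' h
        exact ⟨c₀, h0, h1.tail hs⟩
  have hmono : ∀ i j, i ≤ j → ∀ c, R i c → R j c := by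
    intro i j hij
    induction hij with
    | refl => exact fun _ => id
    | step _ ih => exact fun c h => (hR _ c).2 (Or.inl (ih c h))
  let S : ℕ → Finset α := fun i => Finset.univ.filter (R i)
  have hS : ∀ i c, c ∈ S i ↔ R i c := fun i c => by simp [S]
  -- Each round either adds an element or repeats the previous set; after one repetition the sets
  -- never change again.
  have hprog : ∀ i, (∃ j ≤ i, S (j + 1) = S j) ∨ i ≤ (S i).card := by
    intro i
    induction i with
    | zero => exact Or.inr (Nat.zero_le _)
    | succ i ih =>
      rcases ih with ⟨j, hj, h⟩ | h
      · exact Or.inl ⟨j, by omega, h⟩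
      · by_cases he : S (i + 1) = S i
        · exact Or.inl ⟨i, by omega, he⟩
        · refine Or.inr (lt_of_le_of_lt h (Finset.card_lt_card ?_))
          exact lt_of_le_of_ne (fun c hc => (hS _ c).2 (hmono i _ (by omega) c ((hS _ c).1 hc)))
            (Ne.symm he)
  refine ⟨hsound m c, ?_⟩
  rintro ⟨c₀, h0, h⟩
  have h0 := hmono 0 m (Nat.zero_le _) c₀ h0
  rcases hprog m with ⟨j, hj, he⟩ | hcard
  · have hstab : ∀ i, S (j + i) = S j := by
      intro i
      induction i with
      | zero => rfl
      | succ i ih =>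
        ext c
        rw [hS, ← add_assoc, hR, ← he, hS, hR, ← hS, ih, hS]
        simp only [← hS, ih]
    have hm' : S (m + 1) = S m := by
      have h1 := hstab (m - j)
      have h2 := hstab (m + 1 - j)
      rw [Nat.add_sub_cancel' hj] at h1
      rw [Nat.add_sub_cancel' (by omega)] at h2
      rw [h1, h2]
    induction h with
    | refl => exact h0
    | tail _ hs ih =>
      rw [← hS, ← hm', hS, hR]
      exact Or.inr ⟨_, ih, hs⟩
  · have : S m = Finset.univ := Finset.eq_univ_of_card _
      (le_antisymm (Finset.card_le_univ _) (hm.trans hcard))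
    rw [← hS, this]
    exact Finset.mem_univ c

end Rounds

/-! ### A small language of bounded loops and its compilation -/

section Language

/-- Expressions over the memory of the machine, with bounded sums. -/
inductive Ex where
  | var (r : ℕ)
  | const (c : ℕ)
  | add (a b : Ex)
  | sub (a b : Ex)
  | load (a : ℕ) (e : Ex)
  | ite (c a b : Ex)
  /-- the sum of `e` over all values of the register `x` below the value of the register `r` -/
  | sum (x r : ℕ) (e : Ex)

/-- Statements: assignments, writes to arrays, sequences and bounded loops. -/
inductive St where
  | set (x : ℕ) (e : Ex)
  | store (a : ℕ) (i e : Ex)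
  | seq (p q : St)
  /-- run `p` for all values of the register `x` below the value of the register `r` -/
  | loop (x r : ℕ) (p : St)

namespace RamState

@[simp] theorem reg_setReg (s : RamState) (r v q : ℕ) :
    (s.setReg r v).reg q = if q = r then v else s.reg q := by
  simp [setReg, Function.update_apply]

@[simp] theorem arr_setReg (s : RamState) (r v : ℕ) : (s.setReg r v).arr = s.arr := rfl

@[simp] theorem reg_setArr (s : RamState) (a i v : ℕ) : (s.setArr a i v).reg = s.reg := rfl

theorem arr_setArr (s : RamState) (a i v b : ℕ) : (s.setArr a i v).arr b =
    if b = a then Function.update (s.arr a) i v else s.arr b := by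
  simp [setArr, Function.update_apply]

end RamState

namespace Ex

/-- The value of an expression. -/
def eval : Ex → RamState → ℕ
  | var r, s => s.reg r
  | const c, _ => c
  | add a b, s => eval a s + eval b s
  | sub a b, s => eval a s - eval b s
  | load a e, s => s.arr a (eval e s)
  | ite c a b, s => if eval c s ≠ 0 then eval a s else eval b s
  | sum x r e, s => ∑ i ∈ Finset.range (s.reg r), eval e (s.setReg x i)

/-- The registers that occur in an expression. -/
def regs : Ex → List ℕ
  | var r => [r]
  | const _ => []
  | add a b => regs a ++ regs b
  | sub a b => regs a ++ regs b
  | load _ e => regs e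
  | ite c a b => regs c ++ regs a ++ regs b
  | sum x r e => x :: r :: regs e

/-- The arrays that occur in an expression. -/
def arrs : Ex → List ℕ
  | var _ => []
  | const _ => []
  | add a b => arrs a ++ arrs b
  | sub a b => arrs a ++ arrs b
  | load a e => a :: arrs e
  | ite c a b => arrs c ++ arrs a ++ arrs b
  | sum _ _ e => arrs e

theorem eval_congr (e : Ex) : ∀ {s s' : RamState}, (∀ r ∈ e.regs, s.reg r = s'.reg r) →
    (∀ a ∈ e.arrs, s.arr a = s'.arr a) → e.eval s = e.eval s' := by
  induction e with
  | var r => intro s s' h _; exact h r (by simp [regs])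
  | const c => intros; rfl
  | add a b iha ihb | sub a b iha ihb =>
    intro s s' h h'
    simp only [regs, arrs, List.mem_append] at h h'
    simp only [eval]
    rw [iha (fun r hr => h r (Or.inl hr)) (fun r hr => h' r (Or.inl hr)),
      ihb (fun r hr => h r (Or.inr hr)) (fun r hr => h' r (Or.inr hr))]
  | load a e ih =>
    intro s s' h h'
    simp only [regs, arrs, List.mem_cons] at h h'
    simp only [eval]
    rw [ih h fun r hr => h' r (Or.inr hr), h' a (Or.inl rfl)]
  | ite c a b ihc iha ihb =>
    intro s s' h h'
    simp only [regs, arrs, List.mem_append] at h h'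
    simp only [eval]
    rw [ihc (fun r hr => h r (Or.inl (Or.inl hr))) (fun r hr => h' r (Or.inl (Or.inl hr))),
      iha (fun r hr => h r (Or.inl (Or.inr hr))) (fun r hr => h' r (Or.inl (Or.inr hr))),
      ihb (fun r hr => h r (Or.inr hr)) (fun r hr => h' r (Or.inr hr))]
  | sum x r e ih =>
    intro s s' h h'
    simp only [regs, arrs, List.mem_cons] at h h'
    simp only [eval]
    rw [h r (Or.inr (Or.inl rfl))]
    refine Finset.sum_congr rfl fun i _ => ih (fun q hq => ?_) fun a ha => h' a ha
    simp only [RamState.reg_setReg]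
    rw [h q (Or.inr (Or.inr hq))]

end Ex

namespace St

/-- The effect of a statement. The register of a loop is local to the loop. -/
def exec : St → RamState → RamState
  | set x e, s => s.setReg x (e.eval s)
  | store a i e, s => s.setArr a (i.eval s) (e.eval s)
  | seq p q, s => exec q (exec p s)
  | loop x r p, s => (Nat.rec s (fun i s => exec p (s.setReg x i)) (s.reg r) : RamState).setReg x
      (s.reg x)

/-- The registers that occur in a statement. -/
def regs : St → List ℕ
  | set x e => x :: e.regs
  | store _ i e => i.regs ++ e.regs
  | seq p q => regs p ++ regs q
  | loop x r p => x :: r :: regs p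

end St

/-! ### Compilation -/

/-- Copy the register `r` to the register `x`, with the auxiliary register `z`. -/
def RamProg.copy (x r z : ℕ) : RamProg := .seq (.const z 0) (.add x r z)

/-- Code for an expression, that leaves its value in the register `d` and uses as auxiliary
registers only registers from `d` on. -/
def Ex.code : Ex → ℕ → RamProg
  | var r, d => .copy d r (d + 1)
  | const c, d => .const d c
  | add a b, d => .seq (code a d) (.seq (code b (d + 1)) (.add d d (d + 1)))
  | sub a b, d => .seq (code a d) (.seq (code b (d + 1)) (.sub d d (d + 1)))
  | load a e, d => .seq (code e d) (.load d a d)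
  | ite c a b, d => .seq (code c d) (.ite d (code a d) (code b d))
  -- Register `d` accumulates the sum, `d + 1` counts down, `d + 2` saves the value of `x`, `d + 3`
  -- counts up, and from `d + 4` on there is scratch space.
  | sum x r e, d => .seq (.copy (d + 2) x (d + 4)) (.seq (.copy (d + 1) r (d + 4))
      (.seq (.const d 0) (.seq (.const (d + 3) 0) (.seq (.loop (d + 1)
        (.seq (.copy x (d + 3) (d + 4)) (.seq (code e (d + 4)) (.seq (.add d d (d + 4))
          (.seq (.const (d + 4) 1) (.seq (.add (d + 3) (d + 3) (d + 4))
            (.sub (d + 1) (d + 1) (d + 4)))))))) (.copy x (d + 2) (d + 4))))))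

/-- Code for a statement that uses as auxiliary registers only registers from `d` on. -/
def St.code : St → ℕ → RamProg
  | set x e, d => .seq (e.code d) (.copy x d (d + 1))
  | store a i e, d => .seq (i.code d) (.seq (e.code (d + 1)) (.store a d (d + 1)))
  | seq p q, d => .seq (code p d) (code q d)
  -- Register `d` counts down, `d + 1` counts up, `d + 2` saves the value of `x`, and from `d + 3`
  -- on there is scratch space.
  | loop x r p, d => .seq (.copy (d + 2) x (d + 3)) (.seq (.copy d r (d + 3))
      (.seq (.const (d + 1) 0) (.seq (.loop d
        (.seq (.copy x (d + 1) (d + 3)) (.seq (code p (d + 3)) (.seq (.const (d + 3) 1)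
          (.seq (.add (d + 1) (d + 1) (d + 3)) (.sub d d (d + 3))))))) (.copy x (d + 2) (d + 3)))))

/-! ### Running time -/

/-- A measure of the length of an expression. -/
def Ex.size : Ex → ℕ
  | var _ => 2
  | const _ => 1
  | add a b => size a + size b + 1
  | sub a b => size a + size b + 1
  | load _ e => size e + 1
  | ite c a b => size c + size a + size b + 1
  | sum _ _ e => size e + 16

/-- The order of magnitude of the running time of an expression, when the loops over the register
`r` contribute `w r`. -/
def Ex.depth (w : ℕ → ℕ) : Ex → ℕ
  | var _ => 0
  | const _ => 0
  | add a b => max (depth w a) (depth w b)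
  | sub a b => max (depth w a) (depth w b)
  | load _ e => depth w e
  | ite c a b => max (depth w c) (max (depth w a) (depth w b))
  | sum _ r e => w r + depth w e

/-- The bounds of all loops are registers of positive weight, which do not change. -/
def Ex.Static (w : ℕ → ℕ) : Ex → Bool
  | var _ => true
  | const _ => true
  | add a b => Static w a && Static w b
  | sub a b => Static w a && Static w b
  | load _ e => Static w e
  | ite c a b => Static w c && Static w a && Static w b
  | sum x r e => w x == 0 && w r != 0 && Static w e

/-- The constant factor for the running time of a statement. -/
def St.size : St → ℕ
  | set _ e => e.size + 2
  | store _ i e => i.size + e.size + 1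
  | seq p q => size p + size q
  | loop _ _ p => size p + 15

/-- The order of magnitude of the running time of a statement. -/
def St.depth (w : ℕ → ℕ) : St → ℕ
  | set _ e => e.depth w
  | store _ i e => max (i.depth w) (e.depth w)
  | seq p q => max (depth w p) (depth w q)
  | loop _ r p => w r + depth w p

/-- The bounds of all loops are registers of positive weight, which do not change. -/
def St.Static (w : ℕ → ℕ) : St → Bool
  | set x e => w x == 0 && e.Static w
  | store _ i e => i.Static w && e.Static w
  | seq p q => Static w p && Static w q
  | loop x r p => w x == 0 && w r != 0 && Static w p

/-- The registers of positive weight are bounded by powers of `B`. -/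
def RamState.Bounded (w : ℕ → ℕ) (B : ℕ) (s : RamState) : Prop :=
  1 ≤ B ∧ ∀ r, w r ≠ 0 → s.reg r + 1 ≤ B ^ w r

/-- The states agree, except on registers from `d` on. -/
def RamState.Agree (d : ℕ) (s s' : RamState) : Prop :=
  (∀ r < d, s'.reg r = s.reg r) ∧ s'.arr = s.arr

theorem RamState.Agree.trans {d : ℕ} {s s' s'' : RamState} (h : s.Agree d s')
    (h' : s'.Agree d s'') : s.Agree d s'' :=
  ⟨fun r hr => (h'.1 r hr).trans (h.1 r hr), h'.2.trans h.2⟩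

theorem RamState.Agree.mono {d d' : ℕ} (hd : d' ≤ d) {s s' : RamState} (h : s.Agree d s') :
    s.Agree d' s' :=
  ⟨fun r hr => h.1 r (by omega), h.2⟩

theorem RamState.Agree.eval {d : ℕ} {s s' : RamState} (h : s.Agree d s') {e : Ex}
    (he : ∀ r ∈ e.regs, r < d) : e.eval s' = e.eval s :=
  e.eval_congr (fun r hr => h.1 r (he r hr)) fun a _ => by rw [h.2]

theorem RamState.agree_setReg {d : ℕ} (s : RamState) {r : ℕ} (hr : d ≤ r) (v : ℕ) :
    s.Agree d (s.setReg r v) :=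
  ⟨fun q hq => by simp [show q ≠ r by omega], rfl⟩

theorem ramRuns_copy (s : RamState) {x r z : ℕ} (hr : r ≠ z) :
    RamRuns (.copy x r z) s 2 ((s.setReg z 0).setReg x (s.reg r)) := by
  have := RamRuns.seq (RamRuns.const s z 0) (RamRuns.add (s.setReg z 0) x r z)
  rw [RamProg.copy]
  simpa [hr] using this

theorem RamRuns.loop_of_invariant {c N T : ℕ} {p : RamProg} (I : ℕ → RamState → Prop)
    (hc : ∀ i s, I i s → s.reg c = N - i)
    (hp : ∀ i s, i < N → I i s → ∃ t s', RamRuns p s t s' ∧ I (i + 1) s' ∧ t ≤ T)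
    {s : RamState} (hs : I 0 s) :
    ∃ t s', RamRuns (.loop c p) s t s' ∧ I N s' ∧ t ≤ N * (T + 1) + 1 := by
  have main : ∀ m i s, i + m = N → I i s →
      ∃ t s', RamRuns (.loop c p) s t s' ∧ I N s' ∧ t ≤ m * (T + 1) + 1 := by
    intro m
    induction m with
    | zero =>
      intro i s hi h
      obtain rfl : i = N := by omega
      exact ⟨1, s, .loop_exit (by rw [hc _ _ h]; omega), h, by omega⟩
    | succ m ih =>
      intro i s hi h
      obtain ⟨t, s', h1, h2, h3⟩ := hp i s (by omega) h
      obtain ⟨t', s'', h1', h2', h3'⟩ := ih (i + 1) s' (by omega) h2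
      refine ⟨_, s'', .loop_next (by rw [hc _ _ h]; omega) h1 h1', h2', ?_⟩
      have : (m + 1) * (T + 1) = m * (T + 1) + (T + 1) := by ring
      omega
  exact main N 0 s (by omega) hs

theorem RamState.Bounded.of_agree {w : ℕ → ℕ} {B d : ℕ} {s s' : RamState} (hs : s.Bounded w B)
    (hw : ∀ r, w r ≠ 0 → r < d) (h : s.Agree d s') : s'.Bounded w B :=
  ⟨hs.1, fun r hr => by rw [h.1 r (hw r hr)]; exact hs.2 r hr⟩

theorem RamState.Bounded.setReg {w : ℕ → ℕ} {B : ℕ} {s : RamState} (hs : s.Bounded w B)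
    {x : ℕ} (hx : w x = 0) (v : ℕ) : (s.setReg x v).Bounded w B :=
  ⟨hs.1, fun r hr => by
    rw [reg_setReg, if_neg (by rintro rfl; exact hr hx)]
    exact hs.2 r hr⟩

theorem mul_pow_le_of_le {B a b c d m n : ℕ} (hB : 1 ≤ B) (h : a ≤ m * B ^ b) (hm : m ≤ n)
    (hb : b ≤ c) (hd : d = n * B ^ c) : a ≤ d :=
  hd ▸ h.trans (Nat.mul_le_mul hm (Nat.pow_le_pow_right hB hb))

/-- The code writes only to registers from `d` on and restores the variables of sums, so
subexpressions are evaluated in states that agree with `s` on all registers that matter. Nested sums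
multiply their lengths, which are powers of `B`; hence the exponent adds up the weights of nested
sums. -/
theorem Ex.runs_code {w : ℕ → ℕ} {B : ℕ} (e : Ex) : ∀ (d : ℕ) (s : RamState),
    (∀ r ∈ e.regs, r < d) → (∀ r, w r ≠ 0 → r < d) → e.Static w = true → s.Bounded w B →
    ∃ t s', RamRuns (e.code d) s t s' ∧ s.Agree d s' ∧ s'.reg d = e.eval s ∧
      t ≤ e.size * B ^ e.depth w := by
  induction e with
  | var r =>
    intro d s hr _ _ hB
    simp only [regs, List.mem_singleton, forall_eq] at hr
    refine ⟨2, _, ramRuns_copy s (by omega), ⟨fun q hq => ?_, rfl⟩, by simp [eval], ?_⟩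
    · simp [show q ≠ d by omega, show q ≠ d + 1 by omega]
    · simp [size, depth]
  | const c =>
    intro d s _ _ _ _
    exact ⟨1, _, .const s d c, s.agree_setReg le_rfl c, by simp [eval], by simp [size, depth]⟩
  | add a b iha ihb | sub a b iha ihb =>
    intro d s hr hw hst hB
    simp only [regs, List.mem_append, Static, Bool.and_eq_true] at hr hst
    obtain ⟨t1, s1, h1, a1, v1, c1⟩ := iha d s (fun r h => hr r (Or.inl h)) hw hst.1 hB
    obtain ⟨t2, s2, h2, a2, v2, c2⟩ := ihb (d + 1) s1 (fun r h => (hr r (Or.inr h)).trans (by omega))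
      (fun r h => (hw r h).trans (by omega)) hst.2 (hB.of_agree hw a1)
    refine ⟨_, _, .seq h1 (.seq h2 (by constructor)), ((a1.trans (a2.mono (by omega))).trans
      (s2.agree_setReg le_rfl _)), ?_, ?_⟩
    · rw [RamState.reg_setReg, if_pos rfl, v2, a2.1 d (by omega), v1,
        a1.eval fun r h => hr r (Or.inr h)]
      rfl
    · have e1 := mul_pow_le_of_le hB.1 c1 le_rfl (le_max_left _ (b.depth w)) rfl
      have e2 := mul_pow_le_of_le hB.1 c2 le_rfl (le_max_right (a.depth w) _) rfl
      have := Nat.one_le_pow (max (a.depth w) (b.depth w)) B hB.1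
      simp only [size, depth]
      nlinarith
  | load a e ih =>
    intro d s hr hw hst hB
    obtain ⟨t1, s1, h1, a1, v1, c1⟩ := ih d s hr hw hst hB
    refine ⟨_, _, .seq h1 (.load s1 d a d), a1.trans (s1.agree_setReg le_rfl _), ?_, ?_⟩
    · rw [RamState.reg_setReg, if_pos rfl, v1, a1.2]
      rfl
    · have := Nat.one_le_pow (e.depth w) B hB.1
      simp only [size, depth]
      nlinarith
  | ite c a b ihc iha ihb =>
    intro d s hr hw hst hB
    simp only [regs, List.mem_append, Static, Bool.and_eq_true] at hr hst
    obtain ⟨t1, s1, h1, a1, v1, c1⟩ := ihc d s (fun r h => hr r (Or.inl (Or.inl h))) hw hst.1.1 hB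
    have hB1 := hB.of_agree hw a1
    have e1 := mul_pow_le_of_le hB.1 c1 le_rfl
      (le_max_left _ (max (a.depth w) (b.depth w))) rfl
    have hpos := Nat.one_le_pow (max (c.depth w) (max (a.depth w) (b.depth w))) B hB.1
    by_cases hc : c.eval s = 0
    · obtain ⟨t2, s2, h2, a2, v2, c2⟩ := ihb d s1 (fun r h => hr r (Or.inr h)) hw hst.2 hB1
      refine ⟨_, s2, .seq h1 (.ite_false (v1.trans hc) h2), a1.trans a2, ?_, ?_⟩
      · rw [v2, a1.eval fun r h => hr r (Or.inr h)]
        simp [eval, hc]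
      · have e2 := mul_pow_le_of_le hB.1 c2 le_rfl ((le_max_right (a.depth w) _).trans
          (le_max_right (c.depth w) _)) rfl
        simp only [size, depth]
        nlinarith
    · obtain ⟨t2, s2, h2, a2, v2, c2⟩ := iha d s1 (fun r h => hr r (Or.inl (Or.inr h))) hw hst.1.2
        hB1
      refine ⟨_, s2, .seq h1 (.ite_true (by rwa [v1]) h2), a1.trans a2, ?_, ?_⟩
      · rw [v2, a1.eval fun r h => hr r (Or.inl (Or.inr h))]
        simp [eval, hc]
      · have e2 := mul_pow_le_of_le hB.1 c2 le_rfl ((le_max_left _ (b.depth w)).trans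
          (le_max_right (c.depth w) _)) rfl
        simp only [size, depth]
        nlinarith
  | sum x r e ih =>
    intro d s hr hw hst hB
    simp only [regs, List.mem_cons, Static, Bool.and_eq_true, beq_iff_eq, bne_iff_ne] at hr hst
    obtain ⟨⟨hx, hrw⟩, hst⟩ := hst
    have hxd : x < d := hr x (Or.inl rfl)
    have hrd : r < d := hr r (Or.inr (Or.inl rfl))
    let I : ℕ → RamState → Prop := fun i s1 => (∀ q < d, q ≠ x → s1.reg q = s.reg q) ∧
      s1.arr = s.arr ∧ s1.reg d = ∑ j ∈ Finset.range i, e.eval (s.setReg x j) ∧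
      s1.reg (d + 1) = s.reg r - i ∧ s1.reg (d + 2) = s.reg x ∧ s1.reg (d + 3) = i
    obtain ⟨t, s', h1, ⟨i1, i2, i3, i4, i5, i6⟩, h3⟩ := RamRuns.loop_of_invariant (c := d + 1)
      (N := s.reg r) (T := e.size * B ^ e.depth w + 6)
      (p := .seq (.copy x (d + 3) (d + 4)) (.seq (code e (d + 4)) (.seq (.add d d (d + 4))
          (.seq (.const (d + 4) 1) (.seq (.add (d + 3) (d + 3) (d + 4))
            (.sub (d + 1) (d + 1) (d + 4))))))) I (fun i s1 h => h.2.2.2.1) (by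
        rintro i s1 hi ⟨i1, i2, i3, i4, i5, i6⟩
        have hag : (s.setReg x i).Agree d ((s1.setReg (d + 4) 0).setReg x (s1.reg (d + 3))) := by
          refine ⟨fun q hq => ?_, i2⟩
          simp only [RamState.reg_setReg, i6]
          by_cases hqx : q = x
          · simp [hqx]
          · simp [hqx, show q ≠ d + 4 by omega, i1 q hq hqx]
        obtain ⟨t2, s2, h2, a2, v2, c2⟩ := ih (d + 4) _
          (fun q hq => (hr q (Or.inr (Or.inr hq))).trans (by omega))
          (fun q hq => (hw q hq).trans (by omega)) hst
          ((hB.setReg hx i).of_agree hw hag)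
        refine ⟨_, _, .seq (ramRuns_copy s1 (by omega)) (.seq h2 (.seq (.add _ _ _ _)
          (.seq (.const _ _ _) (.seq (.add _ _ _ _) (.sub _ _ _ _))))), ?_, by omega⟩
        rw [hag.eval fun q hq => hr q (Or.inr (Or.inr hq))] at v2
        have g : ∀ q < d + 4, q ≠ x → s2.reg q = s1.reg q := by
          intro q hq hqx
          rw [a2.1 q hq]
          simp [hqx, show q ≠ d + 4 by omega]
        refine ⟨fun q hq hqx => ?_, ?_, ?_, ?_, ?_, ?_⟩
        · simp [show q ≠ d by omega, show q ≠ d + 1 by omega, show q ≠ d + 3 by omega,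
            show q ≠ d + 4 by omega, g q (by omega) hqx, i1 q hq hqx]
        · exact a2.2.trans i2
        · simp [g d (by omega) (by omega), v2, i3, Finset.sum_range_succ]
        · simp [g (d + 1) (by omega) (by omega), i4]
          omega
        · simp [g (d + 2) (by omega) (by omega), i5]
        · simp [g (d + 3) (by omega) (by omega), i6])
      (s := (((((s.setReg (d + 4) 0).setReg (d + 2) (s.reg x)).setReg (d + 4) 0).setReg (d + 1)
        (s.reg r)).setReg d 0).setReg (d + 3) 0)
      (by
        refine ⟨fun q hq hqx => ?_, rfl, ?_, ?_, ?_, ?_⟩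
        · simp [show q ≠ d by omega, show q ≠ d + 1 by omega, show q ≠ d + 2 by omega,
            show q ≠ d + 3 by omega, show q ≠ d + 4 by omega]
        all_goals simp)
    have e1 : (((s.setReg (d + 4) 0).setReg (d + 2) (s.reg x))).reg r = s.reg r := by
      simp [show r ≠ d + 2 by omega, show r ≠ d + 4 by omega]
    have hcopy := ramRuns_copy ((s.setReg (d + 4) 0).setReg (d + 2) (s.reg x)) (x := d + 1)
      (r := r) (z := d + 4) (by omega)
    rw [e1] at hcopy
    refine ⟨_, _, .seq (ramRuns_copy s (by omega)) (.seq hcopy (.seq (.const _ _ _)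
      (.seq (.const _ _ _) (.seq h1 (ramRuns_copy s' (by omega)))))), ⟨fun q hq => ?_, i2⟩,
      ?_, ?_⟩
    · simp only [RamState.reg_setReg]
      by_cases hqx : q = x
      · simp [hqx, i5]
      · simp [hqx, show q ≠ d + 4 by omega, i1 q hq hqx]
    · simp [show d ≠ x by omega, i3, eval]
    · have e2 := hB.2 r hrw
      have e3 := Nat.one_le_pow (e.depth w) B hB.1
      simp only [size, depth, pow_add]
      generalize B ^ w r = Y at *
      generalize B ^ e.depth w = X at *
      -- The summand one in `Bounded` pays for what happens before and after the loop, even if the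
      -- loop is empty.
      have e4 : (s.reg r + 1) * (e.size * X + 16) ≤ Y * (e.size * X + 16) :=
        Nat.mul_le_mul_right _ e2
      have e5 : Y * (e.size * X + 16) ≤ Y * ((e.size + 16) * X) :=
        Nat.mul_le_mul_left _ (by nlinarith)
      nlinarith

end Language

/-! ### Correctness of compiled programs and defining equations of arrays -/

section Programs

namespace St

/-- The registers that a statement may change. -/
def regsOut : St → List ℕ
  | set x _ => [x]
  | store _ _ _ => []
  | seq p q => regsOut p ++ regsOut q
  | loop x _ p => (regsOut p).filter (· != x)

/-- The arrays that a statement may change. -/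
def arrsOut : St → List ℕ
  | set _ _ => []
  | store a _ _ => [a]
  | seq p q => arrsOut p ++ arrsOut q
  | loop _ _ p => arrsOut p

theorem reg_exec (p : St) : ∀ (s : RamState) {q : ℕ}, q ∉ p.regsOut →
    (p.exec s).reg q = s.reg q := by
  induction p with
  | set x e => intro s q h; simp_all [regsOut, exec]
  | store a i e => intro s q _; simp [exec]
  | seq p p' ih ih' =>
    intro s q h
    simp only [regsOut, List.mem_append, not_or] at h
    rw [exec, ih' _ h.2, ih _ h.1]
  | loop x r p ih =>
    intro s q h
    simp only [exec, RamState.reg_setReg]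
    split_ifs with hq
    · rw [hq]
    · have hp : q ∉ p.regsOut := fun h' => h (by simp [regsOut, h', hq])
      induction s.reg r with
      | zero => rfl
      | succ i ih' =>
        dsimp only
        rw [ih _ hp, RamState.reg_setReg, if_neg hq, ih']

theorem arr_exec (p : St) : ∀ (s : RamState) {a : ℕ}, a ∉ p.arrsOut →
    (p.exec s).arr a = s.arr a := by
  induction p with
  | set x e => intro s a _; simp [exec]
  | store b i e =>
    intro s a h
    simp only [arrsOut, List.mem_singleton] at h
    rw [exec, RamState.arr_setArr, if_neg h]
  | seq p p' ih ih' =>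
    intro s q h
    simp only [arrsOut, List.mem_append, not_or] at h
    rw [exec, ih' _ h.2, ih _ h.1]
  | loop x r p ih =>
    intro s a h
    simp only [exec, RamState.arr_setReg]
    induction s.reg r with
    | zero => rfl
    | succ i ih' =>
      dsimp only
      rw [ih _ h, RamState.arr_setReg, ih']

theorem weight_eq_zero_of_static {w : ℕ → ℕ} (p : St) : p.Static w = true →
    ∀ q ∈ p.regsOut, w q = 0 := by
  induction p with
  | set x e => simp +contextual [Static, regsOut]
  | store a i e => simp [regsOut]
  | seq p p' ih ih' =>
    intro h q hq
    simp only [Static, Bool.and_eq_true] at h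
    simp only [regsOut, List.mem_append] at hq
    exact hq.elim (ih h.1 q) (ih' h.2 q)
  | loop x r p ih =>
    intro h q hq
    simp only [Static, Bool.and_eq_true] at h
    exact ih h.2 q (List.mem_of_mem_filter hq)

theorem bounded_exec {w : ℕ → ℕ} {B : ℕ} {p : St} (hp : p.Static w = true) {s : RamState}
    (hs : s.Bounded w B) : (p.exec s).Bounded w B :=
  ⟨hs.1, fun r hr => by
    rw [p.reg_exec s fun h => hr (p.weight_eq_zero_of_static hp r h)]
    exact hs.2 r hr⟩

/-- The code of a statement has the effect of the statement, in the time that its measures say. -/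
theorem runs_code {w : ℕ → ℕ} {B d : ℕ} (hw : ∀ r, w r ≠ 0 → r < d) (p : St) :
    ∀ (d' : ℕ) (s s₁ : RamState), d ≤ d' → (∀ r ∈ p.regs, r < d) → p.Static w = true →
      s.Bounded w B → s.Agree d s₁ →
      ∃ t s₂, RamRuns (p.code d') s₁ t s₂ ∧ (p.exec s).Agree d s₂ ∧
        (∀ q, d ≤ q → q < d' → s₂.reg q = s₁.reg q) ∧ t ≤ p.size * B ^ p.depth w := by
  induction p with
  | set x e =>
    intro d' s s₁ hd hr hst hB ha
    simp only [regs, List.mem_cons, Static, Bool.and_eq_true, beq_iff_eq] at hr hst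
    have hre : ∀ r ∈ e.regs, r < d := fun r h => hr r (Or.inr h)
    have hx := hr x (Or.inl rfl)
    obtain ⟨t, s₂, h1, a1, v1, c1⟩ := e.runs_code d' s₁ (fun r h => (hre r h).trans_le hd)
      (fun r h => (hw r h).trans_le hd) hst.2 (hB.of_agree hw ha)
    refine ⟨_, _, .seq h1 (ramRuns_copy s₂ (by omega)), ⟨fun q hq => ?_, ?_⟩, ?_, ?_⟩
    · simp only [RamState.reg_setReg, exec, v1, ha.eval hre]
      split_ifs with h h'
      · rfl
      · omega
      · exact (ha.trans (a1.mono hd)).1 q hq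
    · exact (ha.trans (a1.mono hd)).2
    · intro q hq hq'
      simp [show q ≠ x by omega, show q ≠ d' + 1 by omega, a1.1 q hq']
    · have := Nat.one_le_pow (e.depth w) B hB.1
      simp only [size, depth]
      nlinarith
  | store a i e =>
    intro d' s s₁ hd hr hst hB ha
    simp only [regs, List.mem_append, Static, Bool.and_eq_true] at hr hst
    have hri : ∀ r ∈ i.regs, r < d := fun r h => hr r (Or.inl h)
    have hre : ∀ r ∈ e.regs, r < d := fun r h => hr r (Or.inr h)
    have hB1 := hB.of_agree hw ha
    obtain ⟨t, s₂, h1, a1, v1, c1⟩ := i.runs_code d' s₁ (fun r h => (hri r h).trans_le hd)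
      (fun r h => (hw r h).trans_le hd) hst.1 hB1
    obtain ⟨t', s₃, h2, a2, v2, c2⟩ := e.runs_code (d' + 1) s₂
      (fun r h => (hre r h).trans (by omega)) (fun r h => (hw r h).trans (by omega)) hst.2
      (hB1.of_agree hw (a1.mono hd))
    have a3 := ha.trans ((a1.mono hd).trans (a2.mono (by omega)))
    refine ⟨_, _, .seq h1 (.seq h2 (.store _ _ _ _)), ⟨fun q hq => ?_, ?_⟩, ?_, ?_⟩
    · simpa [exec] using a3.1 q hq
    · rw [(a1.mono hd).eval hre, ha.eval hre] at v2
      rw [ha.eval hri] at v1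
      simp only [exec, RamState.setArr, v2, a2.1 d' (by omega), v1, a3.2]
    · intro q hq hq'
      rw [RamState.reg_setArr, a2.1 q (by omega), a1.1 q hq']
    · have e1 := mul_pow_le_of_le hB.1 c1 le_rfl (le_max_left _ (e.depth w)) rfl
      have e2 := mul_pow_le_of_le hB.1 c2 le_rfl (le_max_right (i.depth w) _) rfl
      have := Nat.one_le_pow (max (i.depth w) (e.depth w)) B hB.1
      simp only [size, depth]
      nlinarith
  | seq p q ihp ihq =>
    intro d' s s₁ hd hr hst hB ha
    simp only [regs, List.mem_append, Static, Bool.and_eq_true] at hr hst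
    obtain ⟨t, s₂, h1, a1, b1, c1⟩ := ihp d' s s₁ hd (fun r h => hr r (Or.inl h)) hst.1 hB ha
    obtain ⟨t', s₃, h2, a2, b2, c2⟩ := ihq d' _ s₂ hd (fun r h => hr r (Or.inr h)) hst.2
      (bounded_exec hst.1 hB) a1
    refine ⟨_, _, .seq h1 h2, a2, fun q hq hq' => (b2 q hq hq').trans (b1 q hq hq'), ?_⟩
    have e1 := mul_pow_le_of_le hB.1 c1 le_rfl (le_max_left _ (q.depth w)) rfl
    have e2 := mul_pow_le_of_le hB.1 c2 le_rfl (le_max_right (p.depth w) _) rfl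
    simp only [size, depth]
    nlinarith
  | loop x r p ih =>
    intro d' s s₁ hd hr hst hB ha
    simp only [regs, List.mem_cons, Static, Bool.and_eq_true, beq_iff_eq, bne_iff_ne] at hr hst
    obtain ⟨⟨hx, hrw⟩, hst⟩ := hst
    have hxd : x < d := hr x (Or.inl rfl)
    have hrd : r < d := hr r (Or.inr (Or.inl rfl))
    let g : ℕ → RamState := fun i => Nat.rec s (fun i s => exec p (s.setReg x i)) i
    have hg : ∀ i, (g i).Bounded w B := by
      intro i
      induction i with
      | zero => exact hB
      | succ i ih => exact bounded_exec hst (ih.setReg hx i)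
    let I : ℕ → RamState → Prop := fun i s2 => (∀ q < d, q ≠ x → s2.reg q = (g i).reg q) ∧
      s2.arr = (g i).arr ∧ (∀ q, d ≤ q → q < d' → s2.reg q = s₁.reg q) ∧
      s2.reg d' = s.reg r - i ∧ s2.reg (d' + 1) = i ∧ s2.reg (d' + 2) = s.reg x
    obtain ⟨t, s', h1, ⟨i1, i2, i0, i3, i4, i5⟩, h3⟩ := RamRuns.loop_of_invariant (c := d')
      (N := s.reg r) (T := p.size * B ^ p.depth w + 5)
      (p := .seq (.copy x (d' + 1) (d' + 3)) (.seq (code p (d' + 3)) (.seq (.const (d' + 3) 1)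
          (.seq (.add (d' + 1) (d' + 1) (d' + 3)) (.sub d' d' (d' + 3)))))) I
      (fun i s1 h => h.2.2.2.1) (by
        rintro i s2 hi ⟨i1, i2, i0, i3, i4, i5⟩
        have hag : ((g i).setReg x i).Agree d
            ((s2.setReg (d' + 3) 0).setReg x (s2.reg (d' + 1))) := by
          refine ⟨fun q hq => ?_, i2⟩
          simp only [RamState.reg_setReg, i4]
          by_cases hqx : q = x
          · simp [hqx]
          · simp [hqx, show q ≠ d' + 3 by omega, i1 q hq hqx]
        obtain ⟨t, s3, h1, a1, b1, c1⟩ := ih (d' + 3) _ _ (by omega)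
          (fun q hq => hr q (Or.inr (Or.inr hq))) hst ((hg i).setReg hx i) hag
        have b2 : ∀ q, d ≤ q → q < d' + 3 → s3.reg q = s2.reg q := by
          intro q hq hq'
          rw [b1 q hq hq']
          simp [show q ≠ x by omega, show q ≠ d' + 3 by omega]
        refine ⟨_, _, .seq (ramRuns_copy s2 (by omega)) (.seq h1 (.seq (.const _ _ _)
          (.seq (.add _ _ _ _) (.sub _ _ _ _)))), ?_, by omega⟩
        refine ⟨fun q hq hqx => ?_, a1.2, fun q hq hq' => ?_, ?_, ?_, ?_⟩
        · simpa [show q ≠ d' by omega, show q ≠ d' + 1 by omega, show q ≠ d' + 3 by omega]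
            using a1.1 q hq
        · simp [show q ≠ d' by omega, show q ≠ d' + 1 by omega, show q ≠ d' + 3 by omega,
            b2 q hq (by omega), i0 q hq hq']
        · simp [b2 d' hd (by omega), i3]
          omega
        · simp [b2 (d' + 1) (by omega) (by omega), i4]
        · simp [b2 (d' + 2) (by omega) (by omega), i5])
      (s := (((((s₁.setReg (d' + 3) 0).setReg (d' + 2) (s.reg x)).setReg (d' + 3) 0).setReg d'
        (s.reg r))).setReg (d' + 1) 0)
      (by
        refine ⟨fun q hq hqx => ?_, ha.2, fun q hq hq' => ?_, ?_, ?_, ?_⟩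
        · simp [show q ≠ d' by omega, show q ≠ d' + 1 by omega, show q ≠ d' + 2 by omega,
            show q ≠ d' + 3 by omega, g, ha.1 q hq]
        · simp [show q ≠ d' by omega, show q ≠ d' + 1 by omega, show q ≠ d' + 2 by omega,
            show q ≠ d' + 3 by omega]
        all_goals simp)
    have e0 : s₁.reg x = s.reg x := ha.1 x hxd
    have e1 : (((s₁.setReg (d' + 3) 0).setReg (d' + 2) (s.reg x))).reg r = s.reg r := by
      simp [show r ≠ d' + 2 by omega, show r ≠ d' + 3 by omega, ha.1 r hrd]
    have hcopy := ramRuns_copy ((s₁.setReg (d' + 3) 0).setReg (d' + 2) (s.reg x)) (x := d')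
      (r := r) (z := d' + 3) (by omega)
    have hcopy' := ramRuns_copy s₁ (x := d' + 2) (r := x) (z := d' + 3) (by omega)
    rw [e1] at hcopy
    rw [e0] at hcopy'
    refine ⟨_, _, .seq hcopy' (.seq hcopy (.seq (.const _ _ _)
      (.seq h1 (ramRuns_copy s' (by omega))))), ⟨fun q hq => ?_, i2⟩, fun q hq hq' => ?_, ?_⟩
    · simp only [RamState.reg_setReg, exec]
      by_cases hqx : q = x
      · simp [hqx, i5]
      · simp only [hqx, if_false, show q ≠ d' + 3 by omega]
        exact i1 q hq hqx
    · simp [show q ≠ d' + 3 by omega, show q ≠ x by omega, i0 q hq hq']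
    · have e2 := hB.2 r hrw
      have e3 := Nat.one_le_pow (p.depth w) B hB.1
      simp only [size, depth, pow_add]
      generalize B ^ w r = Y at *
      generalize B ^ p.depth w = X at *
      have e4 : (s.reg r + 1) * (p.size * X + 15) ≤ Y * (p.size * X + 15) :=
        Nat.mul_le_mul_right _ e2
      have e5 : Y * (p.size * X + 15) ≤ Y * ((p.size + 15) * X) :=
        Nat.mul_le_mul_left _ (by nlinarith)
      nlinarith

end St

/-! ### Programs as lists of statements -/

/-- The effect of a list of statements. -/
def execList (l : List St) (s : RamState) : RamState := l.foldl (fun s p => p.exec s) s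

/-- The code of a list of statements. -/
def codeList (d : ℕ) (l : List St) : RamProg := l.foldr (fun p q => .seq (p.code d) q) .skip

/-- The code of a list of statements, started in the state `s`, has the effect of these statements
in time at most `T`. -/
def RunsWithin (d : ℕ) (l : List St) (s : RamState) (T : ℕ) : Prop :=
  ∀ s₁, s.Agree d s₁ → ∃ t s₂, RamRuns (codeList d l) s₁ t s₂ ∧ (execList l s).Agree d s₂ ∧ t ≤ T

theorem execList_append (l l' : List St) (s : RamState) :
    execList (l ++ l') s = execList l' (execList l s) := List.foldl_append

theorem RunsWithin.append {d : ℕ} {l l' : List St} {s : RamState} {T T' : ℕ}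
    (h : RunsWithin d l s T) (h' : RunsWithin d l' (execList l s) T') :
    RunsWithin d (l ++ l') s (T + T') := by
  intro s₁ ha
  obtain ⟨t, s₂, h1, h2, h3⟩ := h s₁ ha
  obtain ⟨t', s₃, h4, h5, h6⟩ := h' s₂ h2
  -- A run of `codeList d l` ends with a `skip`; it is replaced by the run of the code of `l'`.
  have main : ∀ (l : List St) (s₁ : RamState) (t : ℕ), RamRuns (codeList d l) s₁ t s₂ →
      ∃ u ≤ t + t', RamRuns (codeList d (l ++ l')) s₁ u s₃ := by
    intro l
    induction l with
    | nil =>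
      intro s₁ t h
      cases h
      exact ⟨t', by omega, h4⟩
    | cons p l ih =>
      intro s₁ t h
      cases h with
      | seq ha hb =>
        obtain ⟨u, hu, hru⟩ := ih _ _ hb
        exact ⟨_, by omega, .seq ha hru⟩
  obtain ⟨u, hu, hru⟩ := main l s₁ t h1
  exact ⟨u, s₃, hru, by rwa [execList_append], by omega⟩

/-- The syntactic conditions for a bound on the running time. -/
def checkList (w : ℕ → ℕ) (d m : ℕ) (l : List St) : Bool :=
  l.all fun p => p.Static w && p.regs.all (· < d) && p.depth w ≤ m

/-- Reduces the time bound of a concrete program to a Boolean check on its syntax and bounds for a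
few registers at its start. -/
theorem runsWithin_of_check {w : ℕ → ℕ} {d m : ℕ} (hw : ∀ r, w r ≠ 0 → r < d) {B : ℕ} :
    ∀ (l : List St) {s : RamState}, checkList w d m l = true → s.Bounded w B →
      RunsWithin d l s ((l.map St.size).sum * B ^ m + 1) := by
  intro l
  induction l with
  | nil => exact fun _ _ s₁ ha => ⟨1, s₁, .skip s₁, ha, by simp⟩
  | cons p l ih =>
    intro s hc hB s₁ ha
    simp only [checkList, List.all_cons, Bool.and_eq_true, decide_eq_true_eq, List.all_eq_true]
      at hc
    obtain ⟨⟨⟨h1, h2⟩, h3⟩, h4⟩ := hc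
    obtain ⟨t, s₂, g1, g2, -, g3⟩ := p.runs_code hw d s s₁ le_rfl h2 h1 hB ha
    obtain ⟨t', s₃, g4, g5, g6⟩ := ih (s := p.exec s) (by
      simpa only [checkList, Bool.and_eq_true, decide_eq_true_eq, List.all_eq_true] using h4)
      (St.bounded_exec h1 hB) s₂ g2
    refine ⟨_, s₃, .seq g1 g4, g5, ?_⟩
    have := mul_pow_le_of_le hB.1 g3 le_rfl h3 rfl
    simp only [List.map_cons, List.sum_cons]
    nlinarith

/-! ### Programs that write every cell once -/

/-- Overwrite an array. -/
def RamState.withArr (s : RamState) (a : ℕ) (f : ℕ → ℕ) : RamState :=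
  { s with arr := Function.update s.arr a f }

@[simp] theorem RamState.reg_withArr (s : RamState) (a : ℕ) (f : ℕ → ℕ) :
    (s.withArr a f).reg = s.reg := rfl

@[simp] theorem RamState.arr_withArr (s : RamState) (a : ℕ) (f : ℕ → ℕ) (b : ℕ) :
    (s.withArr a f).arr b = if b = a then f else s.arr b := by
  simp [withArr, Function.update_apply]

/-- For all values of the register `x` below the value of the register `r`, write the value of `e`
to the cell `x` of the array `a`. -/
def St.scan (a x r : ℕ) (e : Ex) : St := .loop x r (.store a (.var x) e)

/-- When cell `c` is written, the cells below it already have their final values, whereas nothing is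
said about the others. This allows recurrences in which `e` reads earlier cells of the array being
filled. -/
theorem St.exec_scan (a x r : ℕ) (e : Ex) (s : RamState) {c : ℕ} (hc : c < s.reg r) :
    ∃ f, (∀ i < c, f i = ((scan a x r e).exec s).arr a i) ∧
      ((scan a x r e).exec s).arr a c = e.eval ((s.withArr a f).setReg x c) := by
  let g : ℕ → RamState := fun i =>
    Nat.rec s (fun i s => (St.store a (.var x) e).exec (s.setReg x i)) i
  have hreg : ∀ i q, q ≠ x → (g i).reg q = s.reg q := by
    intro i q hq
    induction i with
    | zero => rfl
    | succ i ih => simpa [g, exec, hq] using ih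
  have harr : ∀ i b, b ≠ a → (g i).arr b = s.arr b := by
    intro i b hb
    induction i with
    | zero => rfl
    | succ i ih => simpa [g, exec, RamState.arr_setArr, hb] using ih
  have hstep : ∀ i j, (g (i + 1)).arr a j =
      if j = i then e.eval ((g i).setReg x i) else (g i).arr a j := by
    intro i j
    simp [g, exec, RamState.arr_setArr, Function.update_apply, Ex.eval]
  have hstab : ∀ i j k, j < i → (g (i + k)).arr a j = (g i).arr a j := by
    intro i j k hj
    induction k with
    | zero => rfl
    | succ k ih => rw [← add_assoc, hstep, if_neg (by omega), ih]
  have hfin : ∀ i j, j < i → i ≤ s.reg r → ((scan a x r e).exec s).arr a j = (g i).arr a j := by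
    intro i j hj hi
    have := hstab i j (s.reg r - i) hj
    rw [Nat.add_sub_cancel' hi] at this
    exact this
  refine ⟨(g c).arr a, fun i hi => (hfin c i hi hc.le).symm, ?_⟩
  rw [hfin (c + 1) c (by omega) hc, hstep, if_pos rfl]
  refine e.eval_congr (fun q _ => ?_) fun b _ => ?_
  · simp only [RamState.reg_setReg, RamState.reg_withArr]
    split_ifs with h
    · rfl
    · exact hreg c q h
  · simp only [RamState.arr_setReg, RamState.arr_withArr]
    split_ifs with h
    · rw [h]
    · exact harr c b h

theorem reg_execList (l : List St) (s : RamState) {q : ℕ} (h : q ∉ l.flatMap St.regsOut) :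
    (execList l s).reg q = s.reg q := by
  induction l generalizing s with
  | nil => rfl
  | cons p l ih =>
    simp only [List.flatMap_cons, List.mem_append, not_or] at h
    exact (ih _ h.2).trans (p.reg_exec s h.1)

theorem arr_execList (l : List St) (s : RamState) {a : ℕ} (h : a ∉ l.flatMap St.arrsOut) :
    (execList l s).arr a = s.arr a := by
  induction l generalizing s with
  | nil => rfl
  | cons p l ih =>
    simp only [List.flatMap_cons, List.mem_append, not_or] at h
    exact (ih _ h.2).trans (p.arr_exec s h.1)

theorem elem_eq_false_iff {a : ℕ} {l : List ℕ} : l.elem a = false ↔ a ∉ l := by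
  rw [Bool.eq_false_iff, ne_eq, List.elem_iff]

/-- The statements after a scan change nothing that the scan depends on. -/
def checkScan (a x r : ℕ) (e : Ex) (l : List St) : Bool :=
  !(l.flatMap St.regsOut).elem r && e.regs.all (fun q => q == x || !(l.flatMap St.regsOut).elem q)
    && (a :: e.arrs).all (fun b => !(l.flatMap St.arrsOut).elem b)

/-- Nothing that the scan depends on, and no cell of its array, is changed afterwards, so the value
written can be recomputed in the final memory. Programs are thus verified as systems of equations in
one state instead of step by step. The hypothesis `he` says that `e` reads its own array only below
`c`. -/
theorem execList_scan_of_self {l : List St} {j a x r : ℕ} {e : Ex}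
    (hj : l[j]? = some (.scan a x r e)) (hl : checkScan a x r e (l.drop (j + 1)) = true)
    (s : RamState) {c : ℕ} (hc : c < (execList l s).reg r)
    (he : ∀ f, (∀ i < c, f i = (execList l s).arr a i) →
      e.eval (((execList l s).withArr a f).setReg x c) = e.eval ((execList l s).setReg x c)) :
    (execList l s).arr a c = e.eval ((execList l s).setReg x c) := by
  obtain ⟨hjl, hj⟩ := List.getElem?_eq_some_iff.1 hj
  have hsplit : l = l.take j ++ (.scan a x r e :: l.drop (j + 1)) := by
    rw [← hj, ← List.drop_eq_getElem_cons hjl, List.take_append_drop]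
  set l' := l.drop (j + 1) with hl'
  set s' := execList (l.take j) s with hs'
  have hF : execList l s = execList l' ((St.scan a x r e).exec s') := by
    conv_lhs => rw [hsplit, execList_append]
    rfl
  simp only [checkScan, Bool.and_eq_true, Bool.not_eq_true', List.all_eq_true, Bool.or_eq_true,
    beq_iff_eq, elem_eq_false_iff, List.mem_cons] at hl
  obtain ⟨⟨h1, h2⟩, h3⟩ := hl
  have hregs : ∀ q, ((St.scan a x r e).exec s').reg q = s'.reg q := fun q =>
    St.reg_exec _ _ (by simp [St.scan, St.regsOut])
  have harrs : ∀ b, b ≠ a → ((St.scan a x r e).exec s').arr b = s'.arr b := fun b hb =>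
    St.arr_exec _ _ (by simp [St.scan, St.arrsOut, hb])
  rw [hF] at hc he ⊢
  rw [reg_execList _ _ h1, hregs] at hc
  obtain ⟨f, hf1, hf2⟩ := St.exec_scan a x r e s' hc
  have ha := arr_execList l' ((St.scan a x r e).exec s') (h3 a (Or.inl rfl))
  rw [← he f (fun i hi => by rw [hf1 i hi, ha]), ha, hf2]
  refine e.eval_congr (fun q hq => ?_) fun b hb => ?_
  · simp only [RamState.reg_setReg, RamState.reg_withArr]
    split_ifs with h
    · rfl
    · rw [reg_execList _ _ ((h2 q hq).resolve_left h), hregs]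
  · simp only [RamState.arr_setReg, RamState.arr_withArr]
    split_ifs with h
    · rfl
    · rw [arr_execList _ _ (h3 b (Or.inr hb)), harrs b h]

theorem execList_scan {l : List St} {j a x r : ℕ} {e : Ex}
    (hj : l[j]? = some (.scan a x r e)) (hl : checkScan a x r e (l.drop (j + 1)) = true)
    (ha : e.arrs.elem a = false) (s : RamState) {c : ℕ} (hc : c < (execList l s).reg r) :
    (execList l s).arr a c = e.eval ((execList l s).setReg x c) := by
  refine execList_scan_of_self hj hl s hc fun f _ => e.eval_congr (fun _ _ => rfl) fun b hb => ?_
  have : b ≠ a := by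
    rintro rfl
    simp [hb] at ha
  simp [this]

/-- The value of a register that is written once. -/
theorem execList_set {l : List St} {j x : ℕ} {e : Ex} (hj : l[j]? = some (.set x e))
    (hx : ((l.drop (j + 1)).flatMap St.regsOut).elem x = false)
    (he : e.regs.all (fun q => !((l.drop j).flatMap St.regsOut).elem q) = true)
    (ha : e.arrs.all (fun q => !((l.drop j).flatMap St.arrsOut).elem q) = true) (s : RamState) :
    (execList l s).reg x = e.eval (execList l s) := by
  obtain ⟨hjl, hj⟩ := List.getElem?_eq_some_iff.1 hj
  have hdrop : l.drop j = .set x e :: l.drop (j + 1) := by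
    rw [← hj, ← List.drop_eq_getElem_cons hjl]
  have hsplit : l = l.take j ++ l.drop j := (List.take_append_drop _ _).symm
  set s' := execList (l.take j) s with hs'
  have hF : execList l s = execList (l.drop j) s' := by
    conv_lhs => rw [hsplit, execList_append]
  simp only [List.all_eq_true, Bool.not_eq_true', elem_eq_false_iff] at hx he ha
  rw [hF, e.eval_congr (s' := s') (fun q hq => reg_execList _ _ (he q hq))
    fun b hb => arr_execList _ _ (ha b hb), hdrop]
  exact (reg_execList _ _ hx).trans (by simp [St.exec])

end Programs

/-! ### The program -/

section Algorithm

namespace Ex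

/-- The value of the expression is not zero. -/
def Holds (e : Ex) (s : RamState) : Prop := e.eval s ≠ 0

instance (e : Ex) (s : RamState) : Decidable (e.Holds s) := inferInstanceAs (Decidable (_ ≠ _))

/-- Every nonzero value counts as true. So addition serves as disjunction and a bounded sum as
existential quantifier, and truncated subtraction provides comparisons and minima. -/
def not (a : Ex) : Ex := ite a (const 0) (const 1)

def and (a b : Ex) : Ex := ite a b (const 0)

def or (a b : Ex) : Ex := add a b

def lt (a b : Ex) : Ex := sub b a

def le (a b : Ex) : Ex := not (sub a b)

def eq (a b : Ex) : Ex := not (add (sub a b) (sub b a))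

def min (a b : Ex) : Ex := sub a (sub a b)

def exi (x r : ℕ) (e : Ex) : Ex := sum x r e

def all (x r : ℕ) (e : Ex) : Ex := not (sum x r (not e))

def count (x r : ℕ) (e : Ex) : Ex := sum x r (ite e (const 1) (const 0))

variable {s : RamState} {a b c e : Ex} {x r : ℕ}

@[simp] theorem eval_var : (var r).eval s = s.reg r := rfl

@[simp] theorem eval_const {n : ℕ} : (const n).eval s = n := rfl

@[simp] theorem eval_add : (add a b).eval s = a.eval s + b.eval s := rfl

@[simp] theorem eval_sub : (sub a b).eval s = a.eval s - b.eval s := rfl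

@[simp] theorem eval_load {n : ℕ} : (load n a).eval s = s.arr n (a.eval s) := rfl

@[simp] theorem eval_ite : (ite c a b).eval s = if c.Holds s then a.eval s else b.eval s := rfl

@[simp] theorem eval_sum : (sum x r e).eval s =
    ∑ i ∈ Finset.range (s.reg r), e.eval (s.setReg x i) := rfl

@[simp] theorem eval_min : (min a b).eval s = Min.min (a.eval s) (b.eval s) := by
  simp only [min, eval_sub]
  omega

@[simp] theorem eval_count : (count x r e).eval s =
    ((Finset.range (s.reg r)).filter fun i => e.Holds (s.setReg x i)).card := by
  simp [count]

@[simp] theorem holds_var : (var r).Holds s ↔ s.reg r ≠ 0 := Iff.rfl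

@[simp] theorem holds_load {n : ℕ} : (load n a).Holds s ↔ s.arr n (a.eval s) ≠ 0 := Iff.rfl

@[simp] theorem holds_not : (not a).Holds s ↔ ¬ a.Holds s := by
  by_cases h : a.eval s = 0 <;> simp [not, Holds, h]

@[simp] theorem holds_and : (and a b).Holds s ↔ a.Holds s ∧ b.Holds s := by
  by_cases h : a.eval s = 0 <;> simp [and, Holds, h]

@[simp] theorem holds_or : (or a b).Holds s ↔ a.Holds s ∨ b.Holds s := by
  simp only [or, Holds, eval_add]
  omega

@[simp] theorem holds_lt : (lt a b).Holds s ↔ a.eval s < b.eval s := by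
  simp only [lt, Holds, eval_sub]
  omega

@[simp] theorem holds_le : (le a b).Holds s ↔ a.eval s ≤ b.eval s := by
  rw [le, holds_not]
  simp only [Holds, eval_sub]
  omega

@[simp] theorem holds_eq : (eq a b).Holds s ↔ a.eval s = b.eval s := by
  rw [eq, holds_not]
  simp only [Holds, eval_add, eval_sub]
  omega

@[simp] theorem holds_exi : (exi x r e).Holds s ↔ ∃ i < s.reg r, e.Holds (s.setReg x i) := by
  simp [exi, Holds, Finset.sum_eq_zero_iff]

@[simp] theorem holds_all : (all x r e).Holds s ↔ ∀ i < s.reg r, e.Holds (s.setReg x i) := by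
  rw [all, holds_not, ← exi, holds_exi]
  simp

end Ex

open Ex

/-- The entry `(i, j)` of a matrix whose rows have the length `n`. -/
def entry (a : ℕ) (i j : Ex) : Ex := load a (add (load 3 i) j)

/-- The entry `(i, j)` of a matrix whose rows have the length `P`. -/
def entryP (a : ℕ) (i j : Ex) : Ex := load a (add (load 32 i) j)

/-- The registers 2, 3, 4 and 6 receive `n + n + 20`, `(n + n + 20) * n`, `2 * k + 2` and `k + 1`. -/
def progSizes : List St :=
  -- The table of powers of two has `n * (2 * n + 20)` entries. It must contain the exponents of
  -- signatures, which occupy rows up to `2 * n + 1`, and the exponents `d + k + 10 ≤ 2 * n + 10` of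
  -- thresholds, even for `n = 1`.
  [.set 2 (add (add (var 0) (var 0)) (const 20)),
   .set 3 (sum 10 0 (var 2)),
   .set 4 (add (add (var 1) (var 1)) (const 2)),
   .set 6 (add (var 1) (const 1))]

/-- The capped threshold that belongs to a degree. -/
def thresholdEx (e : Ex) : Ex :=
  min (var 0) (load 6 (min (var 0) (load 6 (add (add e (var 1)) (const 10)))))

def isToken (e : Ex) : Ex := or (load 1 e) (load 2 e)

def adjEx (u v : Ex) : Ex :=
  and (load 10 u) (and (load 10 v) (entry 0 u v))

/-- The construction of the kernel. -/
def progKernel : List St :=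
  -- 3: the multiples of `n`; 4, 5: quotients and remainders by `n`; 6: powers of two
  [.scan 3 10 2 (sum 11 2 (ite (lt (var 11) (var 10)) (var 0) (const 0))),
   .scan 4 10 3 (count 11 2 (le (add (load 3 (var 11)) (var 0)) (var 10))),
   .scan 5 10 3 (sub (var 10) (load 3 (load 4 (var 10)))),
   .scan 6 10 3 (ite (var 10) (add (load 6 (sub (var 10) (const 1)))
     (load 6 (sub (var 10) (const 1)))) (const 1)),
   -- 7: degrees; 8: free pendant vertices; 10: vertices that are not redundant
   .scan 7 10 0 (count 11 0 (entry 0 (var 10) (var 11))),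
   .scan 8 10 0 (and (not (isToken (var 10))) (eq (load 7 (var 10)) (const 1))),
   .scan 10 10 0 (not (and (load 8 (var 10)) (exi 11 0 (and (entry 0 (var 10) (var 11))
     (exi 12 0 (and (load 8 (var 12)) (and (lt (var 12) (var 10))
       (entry 0 (var 12) (var 11))))))))),
   -- 11: degrees in the graph without redundant vertices; 12: thresholds
   .scan 11 10 0 (count 11 0 (adjEx (var 10) (var 11))),
   .scan 12 10 4 (ite (var 10) (ite (exi 11 0 (and (isToken (var 11)) (and
       (lt (load 12 (sub (var 10) (const 1))) (load 11 (var 11)))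
       (le (load 11 (var 11)) (thresholdEx (load 12 (sub (var 10) (const 1))))))))
     (thresholdEx (load 12 (sub (var 10) (const 1)))) (load 12 (sub (var 10) (const 1))))
     (const 0)),
   -- 13: the set `Z`
   .scan 13 10 0 (or (isToken (var 10)) (exi 11 0 (and (isToken (var 11)) (and
     (le (load 11 (var 11)) (load 12 (sub (var 4) (const 1)))) (adjEx (var 11) (var 10)))))),
   -- 14: labels after a number of merges; 15: labels; 16: sizes of components
   .scan 14 10 3 (ite (load 4 (var 10)) (ite (and (not (load 13 (sub (load 4 (var 10)) (const 1))))
       (exi 11 0 (and (not (load 13 (var 11))) (and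
         (adjEx (sub (load 4 (var 10)) (const 1)) (var 11))
         (eq (entry 14 (sub (load 4 (var 10)) (const 1)) (var 11))
           (entry 14 (sub (load 4 (var 10)) (const 1)) (load 5 (var 10))))))))
       (entry 14 (sub (load 4 (var 10)) (const 1)) (sub (load 4 (var 10)) (const 1)))
       (entry 14 (sub (load 4 (var 10)) (const 1)) (load 5 (var 10))))
     (load 5 (var 10))),
   .scan 15 10 0 (entry 14 (var 0) (var 10)),
   .scan 16 10 0 (count 11 0 (eq (load 15 (var 11)) (load 15 (var 10)))),
   -- 17: vertices of large components; 18: contraction; 19, 20: contracted graph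
   .scan 17 10 0 (and (not (load 13 (var 10)))
     (lt (thresholdEx (load 12 (sub (var 4) (const 1)))) (load 16 (var 10)))),
   .scan 18 10 0 (ite (load 17 (var 10)) (load 15 (var 10)) (var 10)),
   .scan 19 10 3 (exi 11 0 (and (eq (load 18 (var 11)) (load 4 (var 10)))
     (adjEx (var 11) (load 5 (var 10))))),
   .scan 20 10 3 (exi 11 0 (and (eq (load 18 (var 11)) (load 5 (var 10)))
     (entry 19 (load 4 (var 10)) (var 11)))),
   -- 21: active vertices; 22: ranks; 23: codes; 24, 25: signatures of vertices and of classes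
   .scan 21 10 0 (and (not (load 13 (var 10))) (eq (load 18 (var 10)) (var 10))),
   .scan 22 10 0 (count 11 0 (and (lt (var 11) (var 10)) (and (load 21 (var 11))
     (eq (load 15 (var 11)) (load 15 (var 10)))))),
   .scan 23 10 0 (ite (load 13 (var 10)) (add (var 0) (var 10)) (load 22 (var 10))),
   .scan 24 10 0 (add (add
     (sum 11 0 (ite (and (entry 20 (var 10) (var 11)) (or (load 13 (var 11))
         (and (load 21 (var 11)) (eq (load 15 (var 11)) (load 15 (var 10))))))
       (load 6 (add (load 3 (load 23 (var 11))) (load 22 (var 10)))) (const 0)))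
     (load 6 (add (load 3 (add (var 0) (var 0))) (load 22 (var 10)))))
     (ite (load 17 (var 10))
       (load 6 (add (load 3 (add (add (var 0) (var 0)) (const 1))) (load 22 (var 10)))) (const 0))),
   .scan 25 10 0 (sum 11 0 (ite (and (load 21 (var 11)) (eq (load 15 (var 11)) (var 10)))
     (load 24 (var 11)) (const 0))),
   -- 26: labels of classes; 27: numbers of earlier classes; 28: kernel; 29, 30: its enumeration
   .scan 26 10 0 (exi 11 0 (and (load 21 (var 11)) (eq (load 15 (var 11)) (var 10)))),
   .scan 27 10 0 (count 11 0 (and (load 26 (var 11)) (and (lt (var 11) (var 10))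
     (eq (load 25 (var 11)) (load 25 (var 10)))))),
   .scan 28 10 0 (or (load 13 (var 10)) (and (load 21 (var 10))
     (lt (load 27 (load 15 (var 10))) (var 1)))),
   .scan 29 10 0 (count 11 0 (and (lt (var 11) (var 10)) (load 28 (var 11)))),
   .scan 30 10 0 (sum 11 0 (ite (and (load 28 (var 11)) (eq (load 29 (var 11)) (var 10)))
     (var 11) (const 0))),
   .set 5 (count 10 0 (load 28 (var 10)))]

/-- The powers of the number `N` of vertices of the kernel, up to `P = N ^ k`. -/
def progPowers : List St :=
  [.scan 31 10 6 (ite (var 10) (sum 11 5 (load 31 (sub (var 10) (const 1)))) (const 1)),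
   .set 7 (load 31 (var 1))]

/-- The registers 9 and 8 receive `P + 1 + k` and `(P + 1 + k) * P`. -/
def progSearchSizes : List St :=
  [.set 9 (add (add (var 7) (const 1)) (var 1)),
   .set 8 (sum 10 7 (var 9))]

/-- The vertex at the place `i` of the tuple with code `a`. -/
def placeEx (i a : Ex) : Ex := load 30 (entryP 36 i a)

/-- The search for a way from the source to the target. -/
def progSearch : List St :=
  -- 32: the multiples of `P`; 33, 34: quotients and remainders by `P`
  [.scan 32 10 9 (sum 11 9 (ite (lt (var 11) (var 10)) (var 7) (const 0))),
   .scan 33 10 8 (count 11 9 (le (add (load 32 (var 11)) (var 7)) (var 10))),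
   .scan 34 10 8 (sub (var 10) (load 32 (load 33 (var 10)))),
   -- 35: quotients by powers of `N`; 36: digits
   .scan 35 10 8 (count 11 7 (le (sum 12 7 (ite (le (var 12) (var 11))
     (load 31 (load 33 (var 10))) (const 0))) (load 34 (var 10)))),
   .scan 36 10 8 (sub (entryP 35 (load 33 (var 10)) (load 34 (var 10)))
     (sum 11 5 (entryP 35 (add (load 33 (var 10)) (const 1)) (load 34 (var 10))))),
   -- 37: tuples without conflicts; 38, 39: tuples of the source and of the target
   .scan 37 10 7 (all 11 1 (all 12 1 (or (eq (var 11) (var 12)) (or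
     (load 17 (placeEx (var 11) (var 10))) (or (load 17 (placeEx (var 12) (var 10)))
     (not (or (eq (placeEx (var 11) (var 10)) (placeEx (var 12) (var 10)))
       (entry 20 (placeEx (var 11) (var 10)) (placeEx (var 12) (var 10)))))))))),
   .scan 38 10 7 (all 11 5 (eq (count 12 1 (eq (entryP 36 (var 12) (var 10)) (var 11)))
     (load 1 (load 30 (var 11))))),
   .scan 39 10 7 (all 11 5 (eq (count 12 1 (eq (entryP 36 (var 12) (var 10)) (var 11)))
     (load 2 (load 30 (var 11))))),
   -- 40: tuples that have been reached after a number of rounds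
   .scan 40 10 8 (ite (load 33 (var 10)) (or (entryP 40 (sub (load 33 (var 10)) (const 1))
       (load 34 (var 10))) (and (load 37 (load 34 (var 10))) (exi 11 7 (and
         (entryP 40 (sub (load 33 (var 10)) (const 1)) (var 11)) (exi 12 1 (and
           (entry 20 (placeEx (var 12) (var 11)) (placeEx (var 12) (load 34 (var 10))))
           (all 13 1 (or (eq (var 13) (var 12)) (eq (entryP 36 (var 13) (load 34 (var 10)))
             (entryP 36 (var 13) (var 11)))))))))))
     (load 38 (load 34 (var 10)))),
   .set 19 (exi 10 7 (and (entryP 40 (var 7) (var 10)) (load 39 (var 10))))]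

/-- A program that decides Token Sliding on graphs of girth at least five. The answer is positive if
the register 19 is not zero in the end. -/
def progDecide : List St :=
  progSizes ++ (progKernel ++ (progPowers ++ (progSearchSizes ++ progSearch)))

def weightSizes (r : ℕ) : ℕ := if r = 0 then 1 else 0

def weightKernel (r : ℕ) : ℕ := if r = 0 ∨ r = 2 ∨ r = 4 then 1 else if r = 3 then 2 else 0

def weightPowers (r : ℕ) : ℕ := if r = 5 ∨ r = 6 then 1 else 0

def weightSearchSizes (r : ℕ) : ℕ := if r = 7 then 1 else 0

def weightSearch (r : ℕ) : ℕ := if r = 1 ∨ r = 5 ∨ r = 7 ∨ r = 8 ∨ r = 9 then 1 else 0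

/-- The exponents `3` and `5` become those of the running time: the kernel is computed in loops
whose lengths multiply to order `n ^ 3`, and the later phases run over registers bounded in terms of
`k`. -/
theorem check_sizes : checkList weightSizes 20 3 progSizes = true := by decide

theorem check_kernel : checkList weightKernel 20 3 progKernel = true := by decide

theorem check_powers : checkList weightPowers 20 5 progPowers = true := by decide

theorem check_searchSizes : checkList weightSearchSizes 20 5 progSearchSizes = true := by decide

theorem check_search : checkList weightSearch 20 5 progSearch = true := by decide

end Algorithm

/-! ### Connected components by merging labels -/

section Relabelling

theorem reflTransGen_symm {V : Type*} {r : V → V → Prop} (hr : SymmRel r) {u v : V}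
    (h : ReflTransGen r u v) : ReflTransGen r v u :=
  reflTransGen_swap.1 (ReflTransGen.mono (fun _ _ h => hr h) _ _ h)

theorem Within.symmRel {V : Type*} {A : V → V → Prop} (hA : SymmRel A) (U : Set V) :
    SymmRel (Within A U) :=
  fun _ _ h => ⟨hA h.1, h.2.2, h.2.1⟩

variable {n : ℕ} (A : Fin n → Fin n → Prop) (Z : Finset (Fin n))

open Classical in
/-- Labels for the components of the graph without `Z`, after the first `t` vertices have passed
their labels on to the classes of their neighbours. -/
noncomputable def relabel : ℕ → Fin n → Fin n
  | 0, w => w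
  | t + 1, w => if h : t < n then
      if (⟨t, h⟩ : Fin n) ∉ Z ∧ ∃ v, v ∉ Z ∧ A ⟨t, h⟩ v ∧ relabel t v = relabel t w then
        relabel t ⟨t, h⟩ else relabel t w
    else relabel t w

variable {A Z}

theorem relabel_connected (hA : SymmRel A) (t : ℕ) (w : Fin n) :
    ReflTransGen (Within A {x | x ∉ Z}) w (relabel A Z t w) := by
  have hs : ∀ u v, ReflTransGen (Within A {x | x ∉ Z}) u v →
      ReflTransGen (Within A {x | x ∉ Z}) v u := fun u v h =>
    reflTransGen_symm (Within.symmRel hA _) h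
  induction t generalizing w with
  | zero => exact ReflTransGen.refl
  | succ t ih =>
    rw [relabel]
    split_ifs with h hc
    · obtain ⟨hu, v, hv, huv, he⟩ := hc
      have h1 : ReflTransGen (Within A {x | x ∉ Z}) w (relabel A Z t v) := he ▸ ih w
      exact (h1.trans (hs _ _ (ih v))).trans
        ((ReflTransGen.single ⟨hA huv, hv, hu⟩).trans (ih _))
    · exact ih w
    · exact ih w

theorem relabel_congr {t t' : ℕ} (ht : t ≤ t') {u v : Fin n}
    (h : relabel A Z t u = relabel A Z t v) : relabel A Z t' u = relabel A Z t' v := by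
  induction ht with
  | refl => exact h
  | step _ ih => rw [relabel, relabel, ih]

/-- A label always stays in the component of its vertex. Conversely, when vertex `b` is processed,
the classes of all its neighbours receive the label of `b`; equal labels remain equal ever after, so
one pass over the vertices takes care of every edge. -/
theorem relabel_eq_iff (hA : SymmRel A) (u v : Fin n) :
    relabel A Z n u = relabel A Z n v ↔ ReflTransGen (Within A {x | x ∉ Z}) u v := by
  have hs : ∀ u v, ReflTransGen (Within A {x | x ∉ Z}) u v →
      ReflTransGen (Within A {x | x ∉ Z}) v u := fun u v h =>
    reflTransGen_symm (Within.symmRel hA _) h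
  constructor
  · intro h
    exact (relabel_connected hA n u).trans (h ▸ hs _ _ (relabel_connected hA n v))
  · intro h
    induction h with
    | refl => rfl
    | @tail b c _ hbc ih =>
      refine ih.trans (relabel_congr (t := b + 1) (by omega) ?_)
      -- In round `b`, the vertex `b` passes its label on to its neighbour `c`.
      have h1 : relabel A Z (b + 1) c = relabel A Z b b := by
        rw [relabel, dif_pos b.2, if_pos ⟨hbc.2.1, c, hbc.2.2, hbc.1, rfl⟩]
      rw [h1, relabel, dif_pos b.2]
      split_ifs <;> rfl

end Relabelling

/-! ### Signatures: isomorphism types encoded in binary -/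

section Signatures

variable {n : ℕ} (Q : Fin n → Fin n → Prop) (H : Set (Fin n)) (Z : Finset (Fin n))
  (ac : Fin n → Prop) (lab : Fin n → Fin n)

open Classical in
/-- The rank of a vertex among the active vertices of its class. -/
noncomputable def classRank (u : Fin n) : ℕ :=
  (Finset.univ.filter fun v => v < u ∧ ac v ∧ lab v = lab u).card

open Classical in
/-- The code of a vertex in signatures. -/
noncomputable def vertexCode (x : Fin n) : ℕ := if x ∈ Z then n + x else classRank ac lab x

open Classical in
/-- The contribution of a vertex to the signature of its class. -/
noncomputable def vertexSignature (u : Fin n) : ℕ :=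
  ∑ x, (if Q u x ∧ (x ∈ Z ∨ ac x ∧ lab x = lab u) then
      2 ^ (vertexCode Z ac lab x * n + classRank ac lab u) else 0) +
    2 ^ ((n + n) * n + classRank ac lab u) +
    if u ∈ H then 2 ^ ((n + n + 1) * n + classRank ac lab u) else 0

open Classical in
/-- The signature of the class with label `l`. -/
noncomputable def signature (l : Fin n) : ℕ :=
  ∑ u, if ac u ∧ lab u = l then vertexSignature Q H Z ac lab u else 0

variable {Q H Z ac lab}

theorem classRank_lt (u : Fin n) : classRank ac lab u < n := by
  classical
  refine lt_of_lt_of_le (Finset.card_lt_card (t := Finset.univ) ?_) (by simp)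
  rw [Finset.ssubset_univ_iff]
  intro h
  have : u ∈ (Finset.univ : Finset (Fin n)) := Finset.mem_univ u
  rw [← h] at this
  simp at this

theorem classRank_lt_of_card_le {M : ℕ} {u : Fin n} (hu : ac u)
    (hM : {v | ac v ∧ lab v = lab u}.ncard ≤ M) : classRank ac lab u < M := by
  classical
  refine lt_of_lt_of_le ?_ hM
  rw [classRank, ← Set.ncard_coe_finset]
  refine Set.ncard_lt_ncard ⟨fun v hv => ?_, fun h => ?_⟩
  · simp only [Finset.coe_filter, Finset.mem_univ, true_and, Set.mem_ofPred_eq] at hv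
    exact hv.2
  · have := h (show u ∈ {v | ac v ∧ lab v = lab u} from ⟨hu, rfl⟩)
    simp at this

theorem classRank_inj {x y : Fin n} (hx : ac x) (hy : ac y) (hl : lab x = lab y)
    (h : classRank ac lab x = classRank ac lab y) : x = y := by
  classical
  have key : ∀ x y : Fin n, ac x → lab x = lab y → x < y →
      classRank ac lab x < classRank ac lab y := by
    intro x y hx hl hxy
    refine Finset.card_lt_card ⟨fun v hv => ?_, fun h => ?_⟩
    · simp only [Finset.mem_filter, Finset.mem_univ, true_and] at hv ⊢
      exact ⟨hv.1.trans hxy, hv.2.1, hv.2.2.trans hl⟩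
    · have := h (show x ∈ _ by simp [hx, hl, hxy])
      simp at this
  rcases lt_trichotomy x y with hxy | hxy | hxy
  · exact absurd h (key x y hx hl hxy).ne
  · exact hxy
  · exact absurd h (key y x hy hl.symm hxy).ne'

/-- The places of signatures. -/
noncomputable def placeCode (Z : Finset (Fin n)) (ac : Fin n → Prop) (lab : Fin n → Fin n) :
    Option (Option (Fin n)) → ℕ
  | none => n + n
  | some none => n + n + 1
  | some (some x) => vertexCode Z ac lab x

/-- The places of the signature of its class at which a vertex is recorded. -/
def IsRecorded (Q : Fin n → Fin n → Prop) (H : Set (Fin n)) (Z : Finset (Fin n))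
    (ac : Fin n → Prop) (lab : Fin n → Fin n) (u : Fin n) : Option (Option (Fin n)) → Prop
  | none => True
  | some none => u ∈ H
  | some (some x) => Q u x ∧ (x ∈ Z ∨ ac x ∧ lab x = lab u)

open Classical in
/-- The pairs that are recorded in a signature. -/
noncomputable def records (Q : Fin n → Fin n → Prop) (H : Set (Fin n)) (Z : Finset (Fin n))
    (ac : Fin n → Prop) (lab : Fin n → Fin n) (l : Fin n) :
    Finset (Fin n × Option (Option (Fin n))) :=
  Finset.univ.filter fun p => (ac p.1 ∧ lab p.1 = l) ∧ IsRecorded Q H Z ac lab p.1 p.2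

/-- The exponent for a recorded pair. -/
noncomputable def recordCode (Z : Finset (Fin n)) (ac : Fin n → Prop) (lab : Fin n → Fin n)
    (p : Fin n × Option (Option (Fin n))) : ℕ :=
  placeCode Z ac lab p.2 * n + classRank ac lab p.1

theorem mem_records {l : Fin n} {p : Fin n × Option (Option (Fin n))} :
    p ∈ records Q H Z ac lab l ↔ (ac p.1 ∧ lab p.1 = l) ∧ IsRecorded Q H Z ac lab p.1 p.2 := by
  simp [records]

theorem signature_eq_sum (l : Fin n) : signature Q H Z ac lab l =
    ∑ p ∈ records Q H Z ac lab l, 2 ^ recordCode Z ac lab p := by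
  classical
  rw [records, Finset.sum_filter, ← Finset.univ_product_univ, Finset.sum_product, signature]
  refine Finset.sum_congr rfl fun u _ => ?_
  split_ifs with h
  · rw [Fintype.sum_option, Fintype.sum_option, vertexSignature]
    simp only [h, IsRecorded, recordCode, placeCode, and_self, true_and, if_true]
    ring
  · refine (Finset.sum_eq_zero fun j _ => if_neg fun h' => h h'.1).symm

/-- Ranks are less than `n`, so place and rank are the quotient and the remainder of the exponent.
-/
theorem recordCode_eq {p p' : Fin n × Option (Option (Fin n))}
    (h : recordCode Z ac lab p = recordCode Z ac lab p') :
    placeCode Z ac lab p.2 = placeCode Z ac lab p'.2 ∧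
      classRank ac lab p.1 = classRank ac lab p'.1 := by
  have h1 := classRank_lt (ac := ac) (lab := lab) p.1
  have h2 := classRank_lt (ac := ac) (lab := lab) p'.1
  have e : ∀ {a b : ℕ}, b < n → (a * n + b) / n = a ∧ (a * n + b) % n = b := by
    intro a b hb
    rw [mul_comm, Nat.mul_add_div (by omega), Nat.mul_add_mod, Nat.div_eq_of_lt hb,
      Nat.mod_eq_of_lt hb]
    exact ⟨rfl, rfl⟩
  unfold recordCode at h
  have h3 := e (a := placeCode Z ac lab p.2) h1
  have h4 := e (a := placeCode Z ac lab p'.2) h2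
  rw [h] at h3
  exact ⟨h3.1.symm.trans h4.1, h3.2.symm.trans h4.2⟩

/-- The codes occupy disjoint ranges: ranks below `n` for vertices of the class, `n + x` for
vertices of `Z`, and two numbers from `2 * n` on for the markers. Vertices of the class are coded by
rank, which makes signatures of different classes comparable. -/
theorem placeCode_inj {u u' : Fin n} (hl : lab u = lab u')
    {j j' : Option (Option (Fin n))} (hj : IsRecorded Q H Z ac lab u j)
    (hj' : IsRecorded Q H Z ac lab u' j') (h : placeCode Z ac lab j = placeCode Z ac lab j') :
    j = j' := by
  have hlt : ∀ x : Fin n, vertexCode Z ac lab x < n + n := by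
    intro x
    have := classRank_lt (ac := ac) (lab := lab) x
    unfold vertexCode
    split_ifs <;> omega
  rcases j with _ | _ | x <;> rcases j' with _ | _ | x' <;> simp only [placeCode] at h
  · rfl
  · omega
  · have := hlt x'; omega
  · omega
  · rfl
  · have := hlt x'; omega
  · have := hlt x; omega
  · have := hlt x; omega
  · have h1 := classRank_lt (ac := ac) (lab := lab) x
    have h2 := classRank_lt (ac := ac) (lab := lab) x'
    have hx := hj.2
    have hx' := hj'.2
    unfold vertexCode at h
    congr 2
    by_cases hz : x ∈ Z <;> by_cases hz' : x' ∈ Z <;> simp only [hz, hz', if_true, if_false] at h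
    · exact Fin.ext (by omega)
    · omega
    · omega
    · have a := hx.resolve_left hz
      have a' := hx'.resolve_left hz'
      exact classRank_inj a.1 a'.1 (by rw [a.2, a'.2, hl]) h

theorem recordCode_injOn (l : Fin n) :
    Set.InjOn (recordCode Z ac lab) (records Q H Z ac lab l) := by
  rintro ⟨u, j⟩ hp ⟨u', j'⟩ hp' h
  rw [Finset.mem_coe, mem_records] at hp hp'
  dsimp only at hp hp'
  obtain ⟨h1, h2⟩ := recordCode_eq h
  have hu : u = u' := classRank_inj hp.1.1 hp'.1.1 (hp.1.2.trans hp'.1.2.symm) h2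
  subst hu
  exact congrArg _ (placeCode_inj rfl hp.2 hp'.2 h1)

theorem signature_eq_sum_image (l : Fin n) :
    signature Q H Z ac lab l =
      ∑ c ∈ (records Q H Z ac lab l).image (recordCode Z ac lab), 2 ^ c := by
  rw [Finset.sum_image (recordCode_injOn l), signature_eq_sum]

/-- A signature is a sum of distinct powers of two, so by uniqueness of binary expansions equal
signatures record the same pairs of place and rank. -/
theorem exists_record {l l' : Fin n}
    (h : signature Q H Z ac lab l = signature Q H Z ac lab l') {u : Fin n}
    {j : Option (Option (Fin n))} (hu : ac u) (hul : lab u = l)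
    (hj : IsRecorded Q H Z ac lab u j) :
    ∃ u' j', (ac u' ∧ lab u' = l') ∧ IsRecorded Q H Z ac lab u' j' ∧
      placeCode Z ac lab j' = placeCode Z ac lab j ∧ classRank ac lab u' = classRank ac lab u := by
  rw [signature_eq_sum_image, signature_eq_sum_image] at h
  have h := Finset.geomSum_injective le_rfl h
  have hm : recordCode Z ac lab (u, j) ∈
      (records Q H Z ac lab l).image (recordCode Z ac lab) :=
    Finset.mem_image_of_mem _ (mem_records.2 ⟨⟨hu, hul⟩, hj⟩)
  rw [h] at hm
  obtain ⟨⟨u', j'⟩, hp, he⟩ := Finset.mem_image.1 hm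
  rw [mem_records] at hp
  obtain ⟨h1, h2⟩ := recordCode_eq he
  exact ⟨u', j', hp.1, hp.2, h1, h2⟩

/-- The place `none` records which ranks occur, `some none` records membership in `H`, and the other
places record adjacency to `Z` and inside the class; each axiom about copies reads off one of these
kinds of records. -/
theorem classSystem (hQ : SymmRel Q) (hZ : ∀ x, ac x → x ∉ Z)
    (hac : ∀ x y, Q x y → x ∈ Z ∨ ac x)
    (hlab : ∀ x y, Q x y → x ∉ Z → y ∉ Z → lab x = lab y) :
    ClassSystem Q H Z ac lab (classRank ac lab) (signature Q H Z ac lab) where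
  symm := hQ
  notMem := hZ
  active := hac
  lab_eq := hlab
  rk_inj _ _ := classRank_inj
  copy x l hx _ hs := by
    obtain ⟨u', j', h1, -, -, h4⟩ := exists_record hs hx rfl (j := none) trivial
    exact ⟨u', h1.1, h1.2, h4⟩
  outer x x' hx hx' hs hr := by
    constructor
    · intro hH
      obtain ⟨u', j', h1, h2, h3, h4⟩ := exists_record hs hx rfl (j := some none) hH
      obtain rfl := classRank_inj h1.1 hx' h1.2 (h4.trans hr)
      have : ∀ y : Fin n, vertexCode Z ac lab y < n + n := by
        intro y
        have := classRank_lt (ac := ac) (lab := lab) y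
        unfold vertexCode
        split_ifs <;> omega
      rcases j' with _ | _ | y
      · simp [placeCode] at h3
      · exact h2
      · have := this y
        simp only [placeCode] at h3
        omega
    · intro z hz hxz
      obtain ⟨u', j', h1, h2, h3, h4⟩ := exists_record hs hx rfl (j := some (some z))
        ⟨hxz, Or.inl hz⟩
      obtain rfl := classRank_inj h1.1 hx' h1.2 (h4.trans hr)
      simp only [placeCode, vertexCode, hz, if_true] at h3
      rcases j' with _ | _ | y <;> simp only at h3
      · omega
      · omega
      · split_ifs at h3 with hy
        · rw [show z = y from Fin.ext (by omega)]
          exact h2.1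
        · have := classRank_lt (ac := ac) (lab := lab) y
          omega
  inner x y x' y' hx hy hx' hy' hl hl' hs hr hr' hxy := by
    obtain ⟨u', j', h1, h2, h3, h4⟩ := exists_record hs hx rfl (j := some (some y))
      ⟨hxy, Or.inr ⟨hy, hl.symm⟩⟩
    obtain rfl := classRank_inj h1.1 hx' h1.2 (h4.trans hr)
    have hlt := classRank_lt (ac := ac) (lab := lab) y
    simp only [placeCode, vertexCode, hZ y hy, if_false] at h3
    rcases j' with _ | _ | v <;> simp only at h3
    · omega
    · omega
    · split_ifs at h3 with hv
      · omega
      · obtain ⟨hv1, hv2⟩ := h2.2.resolve_left hv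
        obtain rfl := classRank_inj hv1 hy' (hv2.trans hl') (h3.trans hr')
        exact h2.1

/-- There are few signatures if all classes are small. -/
theorem exists_finset_signature {M : ℕ}
    (hM : ∀ l, {v | ac v ∧ lab v = l}.ncard ≤ M) :
    ∃ U : Finset ℕ, (∀ l, signature Q H Z ac lab l ∈ U) ∧ U.card ≤ 2 ^ ((M + Z.card + 2) * M) := by
  classical
  -- Places in use are the ranks below `M`, one for each vertex of `Z`, and the two markers. A
  -- signature corresponds to a set of pairs of a place and a rank below `M`.
  set places : Finset ℕ := Finset.range M ∪ Z.image (fun z : Fin n => n + (z : ℕ)) ∪ {n + n, n + n + 1}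
    with hplaces
  set U₀ : Finset ℕ := (places ×ˢ Finset.range M).image fun p => p.1 * n + p.2 with hU₀
  have hcard : U₀.card ≤ (M + Z.card + 2) * M := by
    refine Finset.card_image_le.trans ?_
    rw [Finset.card_product, Finset.card_range]
    refine Nat.mul_le_mul_right _ ?_
    refine (Finset.card_union_le _ _).trans (add_le_add ((Finset.card_union_le _ _).trans
      (add_le_add (by simp) Finset.card_image_le)) Finset.card_le_two)
  refine ⟨U₀.powerset.image fun S => ∑ c ∈ S, 2 ^ c, fun l => ?_, Finset.card_image_le.trans ?_⟩
  · refine Finset.mem_image.2 ⟨(records Q H Z ac lab l).image (recordCode Z ac lab), ?_,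
      (signature_eq_sum_image l).symm⟩
    rw [Finset.mem_powerset]
    intro c hc
    obtain ⟨⟨u, j⟩, hp, rfl⟩ := Finset.mem_image.1 hc
    rw [mem_records] at hp
    refine Finset.mem_image.2 ⟨(placeCode Z ac lab j, classRank ac lab u), ?_, rfl⟩
    rw [Finset.mem_product, Finset.mem_range]
    refine ⟨?_, classRank_lt_of_card_le hp.1.1 (hM _)⟩
    rcases j with _ | _ | x
    · simp [hplaces, placeCode]
    · simp [hplaces, placeCode]
    · simp only [hplaces, placeCode, vertexCode, Finset.mem_union, Finset.mem_range,
        Finset.mem_image]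
      left
      split_ifs with hx
      · exact Or.inr ⟨x, hx, rfl⟩
      · exact Or.inl (classRank_lt_of_card_le (hp.2.2.resolve_left hx).1 (hM _))
  · rw [Finset.card_powerset]
    exact Nat.pow_le_pow_right (by norm_num) hcard

end Signatures

/-! ### The kernel and its equivalence with the given instance -/

section Kernel

/-- The bounds for the successive thresholds. -/
def tower (k : ℕ) : ℕ → ℕ
  | 0 => 0
  | i + 1 => 2 ^ 2 ^ (tower k i + k + 10)

theorem tower_mono (k : ℕ) : Monotone (tower k) := by
  refine monotone_nat_of_le_succ fun i => ?_
  rw [tower]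
  have h1 := (Nat.lt_two_pow_self (n := tower k i + k + 10)).le
  have h2 := (Nat.lt_two_pow_self (n := 2 ^ (tower k i + k + 10))).le
  omega

theorem sq_le_two_pow (m : ℕ) : (m + 1) * (m + 1) ≤ 4 * 2 ^ m := by
  induction m with
  | zero => norm_num
  | succ m ih =>
    rcases Nat.lt_or_ge m 2 with h | h
    · interval_cases m <;> norm_num
    · rw [pow_succ]
      nlinarith

/-- The size that `nonempty_absorber_of_card` requires, with the bound `2 * k + 2 * k * d` for the
separator and `2 * k + 1` for the number of pendant neighbours. -/
theorem pow_le_threshold (d k : ℕ) :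
    (2 * (2 * k + 2 * k * d) + (2 * k + 1) + (k + 1) * (k + 1) + 1) ^ (4 * k + 1) ≤
      2 ^ 2 ^ (d + k + 10) := by
  have h1 : 2 * (2 * k + 2 * k * d) + (2 * k + 1) + (k + 1) * (k + 1) + 1 ≤
      2 ^ (2 * (d + k) + 2) := by
    have h := Nat.lt_two_pow_self (n := d + k)
    calc 2 * (2 * k + 2 * k * d) + (2 * k + 1) + (k + 1) * (k + 1) + 1
        ≤ 4 * ((d + k + 1) * (d + k + 1)) := by nlinarith
      _ ≤ 4 * (2 ^ (d + k) * 2 ^ (d + k)) := by gcongr <;> omega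
      _ = 2 ^ (2 * (d + k) + 2) := by ring
  refine (Nat.pow_le_pow_left h1 _).trans ?_
  rw [← pow_mul]
  refine Nat.pow_le_pow_right (by norm_num) ?_
  have h2 := sq_le_two_pow (d + k)
  rw [pow_add]
  nlinarith

/-- The degree that lets tokens step aside, with the same bound for the separator and an absorber of
width `4 * k + 3`. -/
theorem add_le_threshold (d k : ℕ) :
    2 * k + 2 * k * d + 2 * (k + (4 * k + 3) + 2 * k) ≤ 2 ^ 2 ^ (d + k + 10) := by
  have h2 := sq_le_two_pow (d + k)
  have h3 := (Nat.lt_two_pow_self (n := 2 ^ (d + k + 10))).le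
  rw [pow_add 2 (d + k)] at h3 ⊢
  nlinarith

/-- The threshold that belongs to a degree, capped at the number of vertices. -/
def threshold (n k d : ℕ) : ℕ := min n (2 ^ min n (2 ^ (d + k + 10)))

theorem threshold_le (n k d : ℕ) : threshold n k d ≤ 2 ^ 2 ^ (d + k + 10) :=
  (min_le_right _ _).trans (Nat.pow_le_pow_right (by norm_num) (min_le_right _ _))

/-- If the inner cap were active, the value would be `min n (2 ^ n) = n`. So a threshold below `n`
is the true one; a threshold equal to `n` is harmless, since no component has more than `n`
vertices. -/
theorem threshold_eq_of_lt {n k d : ℕ} (h : threshold n k d < n) :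
    threshold n k d = 2 ^ 2 ^ (d + k + 10) := by
  unfold threshold at h ⊢
  rcases min_choice n (2 ^ min n (2 ^ (d + k + 10))) with h1 | h1
  · omega
  · rw [h1] at h ⊢
    rcases min_choice n (2 ^ (d + k + 10)) with h2 | h2
    · rw [h2] at h
      exact absurd h (not_lt.2 Nat.lt_two_pow_self.le)
    · rw [h2]

variable {n : ℕ} (G : SimpleGraph (Fin n)) (tok : Finset (Fin n)) (k : ℕ)

open Classical in
/-- The graph in which redundant vertices are isolated. -/
noncomputable def coreGraph : SimpleGraph (Fin n) where
  Adj := Within G.Adj {v | ¬ Redundant G tok v}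
  symm := ⟨fun _ _ h => ⟨h.1.symm, h.2.2, h.2.1⟩⟩
  loopless := ⟨fun _ h => G.loopless.1 _ h.1⟩

open Classical in
/-- The successive thresholds for the degrees of tokens. -/
noncomputable def thresholds : ℕ → ℕ
  | 0 => 0
  | i + 1 => if ∃ v ∈ tok, thresholds i < (coreGraph G tok).degree v ∧
      (coreGraph G tok).degree v ≤ threshold n k (thresholds i) then
      threshold n k (thresholds i) else thresholds i

/-- The degree up to which all neighbours of a token are singled out. -/
noncomputable def smallDegree : ℕ := thresholds G tok k (2 * k + 1)

/-- The size above which a component is large. -/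
noncomputable def largeSize : ℕ := threshold n k (smallDegree G tok k)

open Classical in
/-- The tokens and the neighbours of the tokens of small degree. -/
noncomputable def separator : Finset (Fin n) :=
  Finset.univ.filter fun u => u ∈ tok ∨ ∃ v ∈ tok,
    (coreGraph G tok).degree v ≤ smallDegree G tok k ∧ (coreGraph G tok).Adj v u

/-- The labels of the components of the graph without the separator. -/
noncomputable def label : Fin n → Fin n :=
  relabel (coreGraph G tok).Adj (separator G tok k) n

open Classical in
/-- The vertices of the large components of the graph without the separator. -/
def largeSet : Set (Fin n) :=
  {v | v ∉ separator G tok k ∧ largeSize G tok k <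
    (Finset.univ.filter fun w => label G tok k w = label G tok k v).card}

open Classical in
/-- The contraction of the large components. -/
noncomputable def contraction (v : Fin n) : Fin n :=
  if v ∈ largeSet G tok k then label G tok k v else v

/-- Adjacency in the contracted graph. -/
def ContractedAdj : Fin n → Fin n → Prop := MapAdj (coreGraph G tok).Adj (contraction G tok k)

/-- The vertices off the separator that are left after the contraction. -/
def IsActive (v : Fin n) : Prop := v ∉ separator G tok k ∧ contraction G tok k v = v

/-- The signatures of the components. -/
noncomputable def classSignature : Fin n → ℕ :=
  signature (ContractedAdj G tok k) (largeSet G tok k) (separator G tok k) (IsActive G tok k)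
    (label G tok k)

/-- The vertices of the kernel. -/
def kernelSet : Set (Fin n) :=
  keptSet (separator G tok k) (IsActive G tok k) (label G tok k) (classSignature G tok k) k

variable {G tok k}

theorem thresholds_le_tower (i : ℕ) : thresholds G tok k i ≤ tower k i := by
  induction i with
  | zero => exact le_rfl
  | succ i ih =>
    have h1 : threshold n k (thresholds G tok k i) ≤ tower k (i + 1) := by
      refine (threshold_le _ _ _).trans ?_
      rw [tower]
      exact Nat.pow_le_pow_right (by norm_num) (Nat.pow_le_pow_right (by norm_num) (by omega))
    rw [thresholds]
    split_ifs
    · exact h1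
    · exact ih.trans (tower_mono k (by omega))

open Classical in
-- Whenever the threshold is raised, it overtakes the degree of at least one more token vertex.
-- There are at most `2 * k` of these, so after `2 * k + 1` rounds no degree is left in the gap.
theorem degree_small_or_large (htok : tok.card ≤ 2 * k) {v : Fin n} (hv : v ∈ tok) :
    (coreGraph G tok).degree v ≤ smallDegree G tok k ∨
      largeSize G tok k < (coreGraph G tok).degree v := by
  set D := thresholds G tok k with hD
  let P : ℕ → Prop := fun i => ∃ v ∈ tok, D i < (coreGraph G tok).degree v ∧
      (coreGraph G tok).degree v ≤ threshold n k (D i)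
  have hstep : ∀ i, D (i + 1) = if P i then threshold n k (D i) else D i := fun i => rfl
  have hmain : ∀ i, ¬ P i ∨ i ≤ (tok.filter fun v => (coreGraph G tok).degree v ≤ D i).card := by
    intro i
    induction i with
    | zero => exact Or.inr (Nat.zero_le _)
    | succ i ih =>
      by_cases hP : P i
      · refine Or.inr (lt_of_le_of_lt (ih.resolve_left (not_not.2 hP)) (Finset.card_lt_card ?_))
        have hP' := hP
        obtain ⟨u, hu, h1, h2⟩ := hP'
        rw [hstep, if_pos hP]
        refine ⟨fun w hw => ?_, fun h => ?_⟩
        · rw [Finset.mem_filter] at hw ⊢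
          exact ⟨hw.1, hw.2.trans (h1.le.trans h2)⟩
        · have := h (Finset.mem_filter.2 ⟨hu, h2⟩)
          rw [Finset.mem_filter] at this
          omega
      · left
        have : D (i + 1) = D i := by rw [hstep, if_neg hP]
        simp only [P] at hP ⊢
        rwa [this]
  have hnot : ¬ P (2 * k + 1) := by
    refine (hmain (2 * k + 1)).resolve_right fun h => ?_
    have := h.trans (Finset.card_le_card (Finset.filter_subset _ _))
    omega
  by_contra! hcon
  exact hnot ⟨v, hv, hcon.1, hcon.2⟩

theorem card_separator_le (htok : tok.card ≤ 2 * k) :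
    (separator G tok k).card ≤ 2 * k + 2 * k * smallDegree G tok k := by
  classical
  have hsub : separator G tok k ⊆ tok ∪ (tok.filter fun v =>
      (coreGraph G tok).degree v ≤ smallDegree G tok k).biUnion
        fun v => (coreGraph G tok).neighborFinset v := by
    intro u hu
    simp only [separator, Finset.mem_filter, Finset.mem_univ, true_and] at hu
    simp only [Finset.mem_union, Finset.mem_biUnion, Finset.mem_filter,
      SimpleGraph.mem_neighborFinset]
    refine hu.imp id ?_
    rintro ⟨v, h1, h2, h3⟩
    exact ⟨v, ⟨h1, by convert h2⟩, h3⟩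
  refine (Finset.card_le_card hsub).trans ((Finset.card_union_le _ _).trans (add_le_add htok ?_))
  refine (Finset.card_biUnion_le_card_mul _ _ (smallDegree G tok k) fun v hv => ?_).trans
    (Nat.mul_le_mul_right _ ((Finset.card_le_card (Finset.filter_subset _ _)).trans htok))
  rw [SimpleGraph.card_neighborFinset_eq_degree]
  exact (Finset.mem_filter.1 hv).2

theorem tok_subset_separator : tok ⊆ separator G tok k := fun v hv => by
  simp [separator, hv]

theorem label_eq_iff (u v : Fin n) : label G tok k u = label G tok k v ↔
    ReflTransGen (Within (coreGraph G tok).Adj {x | x ∉ separator G tok k}) u v :=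
  relabel_eq_iff (fun _ _ h => h.symm) u v

theorem label_label (v : Fin n) : label G tok k (label G tok k v) = label G tok k v :=
  (label_eq_iff _ _).2 (reflTransGen_symm (Within.symmRel (fun _ _ h => h.symm) _)
    (relabel_connected (fun _ _ h => h.symm) n v))

theorem within_label (v : Fin n) :
    ReflTransGen (Within (coreGraph G tok).Adj {x | x ∉ separator G tok k}) v
      (label G tok k v) := relabel_connected (fun _ _ h => h.symm) n v

theorem notMem_separator_of_within {u v : Fin n} (hu : u ∉ separator G tok k)
    (h : ReflTransGen (Within (coreGraph G tok).Adj {x | x ∉ separator G tok k}) u v) :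
    v ∉ separator G tok k := by
  rcases ReflTransGen.cases_tail h with rfl | ⟨z, -, hz⟩
  · exact hu
  · exact hz.2.2

theorem mem_largeSet_of_within {u v : Fin n} (hu : u ∈ largeSet G tok k)
    (h : ReflTransGen (Within (coreGraph G tok).Adj {x | x ∉ separator G tok k}) u v) :
    v ∈ largeSet G tok k := by
  refine ⟨notMem_separator_of_within hu.1 h, ?_⟩
  have := hu.2
  rwa [(label_eq_iff u v).2 h] at this

theorem within_largeSet {u v : Fin n} (hu : u ∈ largeSet G tok k)
    (h : ReflTransGen (Within (coreGraph G tok).Adj {x | x ∉ separator G tok k}) u v) :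
    ReflTransGen (Within (coreGraph G tok).Adj (largeSet G tok k)) u v := by
  induction h with
  | refl => exact ReflTransGen.refl
  | tail h1 h2 ih =>
    exact ih.tail ⟨h2.1, mem_largeSet_of_within hu h1, mem_largeSet_of_within hu (h1.tail h2)⟩

theorem contraction_of_notMem {v : Fin n} (h : v ∉ largeSet G tok k) :
    contraction G tok k v = v := if_neg h

theorem contraction_mem {v : Fin n} (h : v ∈ largeSet G tok k) :
    contraction G tok k v ∈ largeSet G tok k := by
  rw [contraction, if_pos h]
  exact mem_largeSet_of_within h (within_label v)

theorem label_contraction (v : Fin n) :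
    label G tok k (contraction G tok k v) = label G tok k v := by
  unfold contraction
  split_ifs
  · exact label_label v
  · rfl

theorem contraction_contraction (v : Fin n) :
    contraction G tok k (contraction G tok k v) = contraction G tok k v := by
  by_cases h : v ∈ largeSet G tok k
  · rw [contraction, if_pos (contraction_mem h), label_contraction, contraction, if_pos h]
  · rw [contraction_of_notMem h, contraction_of_notMem h]

theorem contraction_mem_separator_iff {v : Fin n} :
    contraction G tok k v ∈ separator G tok k ↔ v ∈ separator G tok k := by
  by_cases h : v ∈ largeSet G tok k
  · exact iff_of_false (contraction_mem h).1 h.1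
  · rw [contraction_of_notMem h]

theorem contractedAdj_symm : SymmRel (ContractedAdj G tok k) :=
  MapAdj.symmRel (fun _ _ h => h.symm) _

theorem kernel_classSystem : ClassSystem (ContractedAdj G tok k) (largeSet G tok k)
    (separator G tok k) (IsActive G tok k) (label G tok k)
    (classRank (IsActive G tok k) (label G tok k)) (classSignature G tok k) := by
  refine classSystem contractedAdj_symm (fun x hx => hx.1) ?_ ?_
  · rintro _ _ ⟨x, y, rfl, rfl, -⟩
    by_cases h : contraction G tok k x ∈ separator G tok k
    · exact Or.inl h
    · exact Or.inr ⟨h, contraction_contraction x⟩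
  · rintro _ _ ⟨x, y, rfl, rfl, h⟩ hx hy
    rw [contraction_mem_separator_iff] at hx hy
    rw [label_contraction, label_contraction, label_eq_iff]
    exact ReflTransGen.single ⟨h, hx, hy⟩

/-- A large component is contracted to its label and contributes one active vertex; any other class
lies in a component that is not large. -/
theorem ncard_class_le (hn : 1 ≤ n) (l : Fin n) :
    {v | IsActive G tok k v ∧ label G tok k v = l}.ncard ≤ largeSize G tok k := by
  classical
  have h1 : 1 ≤ largeSize G tok k := by
    unfold largeSize threshold
    exact le_min hn Nat.one_le_two_pow
  by_cases h : ∃ v, (IsActive G tok k v ∧ label G tok k v = l) ∧ v ∈ largeSet G tok k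
  · obtain ⟨v, ⟨-, hv⟩, hvH⟩ := h
    refine le_trans ?_ h1
    have key : ∀ u, IsActive G tok k u ∧ label G tok k u = l → u = l := by
      rintro u ⟨hu, hul⟩
      have huH : u ∈ largeSet G tok k := mem_largeSet_of_within hvH
        ((label_eq_iff v u).1 (hv.trans hul.symm))
      have := hu.2
      rwa [contraction, if_pos huH, hul, eq_comm] at this
    refine (Set.ncard_le_ncard (t := {l}) fun u hu => key u hu).trans ?_
    simp
  · by_cases hne : ∃ v, IsActive G tok k v ∧ label G tok k v = l
    · obtain ⟨v, hv, rfl⟩ := hne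
      have hvH : v ∉ largeSet G tok k := fun h' => h ⟨v, ⟨hv, rfl⟩, h'⟩
      have : (Finset.univ.filter fun w => label G tok k w = label G tok k v).card ≤
          largeSize G tok k := by
        by_contra! hlt
        exact hvH ⟨hv.1, hlt⟩
      refine le_trans ?_ this
      rw [← Set.ncard_coe_finset]
      exact Set.ncard_le_ncard fun w hw => by simpa using hw.2
    · have : {v | IsActive G tok k v ∧ label G tok k v = l} = ∅ :=
        Set.eq_empty_iff_forall_notMem.2 fun v hv => hne ⟨v, hv⟩
      simp [this]

/-- A bound for the size of the kernel. -/
theorem ncard_kernelSet_le (hn : 1 ≤ n) (htok : tok.card ≤ 2 * k) :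
    (kernelSet G tok k).ncard ≤ 2 * k + 2 * k * smallDegree G tok k + k *
      2 ^ ((largeSize G tok k + (2 * k + 2 * k * smallDegree G tok k) + 2) *
        largeSize G tok k) * largeSize G tok k := by
  have hM := ncard_class_le (G := G) (tok := tok) (k := k) hn
  obtain ⟨U, hU, hUc⟩ := exists_finset_signature (Q := ContractedAdj G tok k)
    (H := largeSet G tok k) (Z := separator G tok k) hM
  have hZ := card_separator_le (G := G) htok
  refine (ClassSystem.ncard_keptSet_le (Z := separator G tok k) (k := k) hM U
    (fun y _ => hU _) (hUc.trans (Nat.pow_le_pow_right (by norm_num)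
      (Nat.mul_le_mul_right _ (Nat.add_le_add_right (Nat.add_le_add_left hZ _) _))))).trans ?_
  exact Nat.add_le_add_right hZ _

theorem conflictFree_contracted {m : Multiset (Fin n)}
    (hm : ConflictFree (Clash (coreGraph G tok).Adj ∅) m) :
    ConflictFree (Clash (ContractedAdj G tok k) (largeSet G tok k)) m := by
  intro u v r hr hc
  refine hm u v r hr ⟨id, id, hc.2.2.imp id ?_⟩
  rintro ⟨u', v', h1, h2, h⟩
  have h1' : u' ∉ largeSet G tok k := fun h' => hc.1 (h1 ▸ contraction_mem h')
  have h2' : v' ∉ largeSet G tok k := fun h' => hc.2.1 (h2 ▸ contraction_mem h')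
  rw [contraction_of_notMem h1'] at h1
  rw [contraction_of_notMem h2'] at h2
  rwa [← h1, ← h2]

open Classical in
/-- Sliding in the kernel is equivalent to sliding in the given graph. -/
theorem slides_kernel_iff (hG : 5 ≤ G.egirth) {S T : Finset (Fin n)} (hST : S ∪ T = tok)
    (hS : S.card = k) (hT : T.card = k) (hSi : G.IsIndepSet S) (hTi : G.IsIndepSet T) :
    Slides (Within (ContractedAdj G tok k) (kernelSet G tok k))
      (Clash (ContractedAdj G tok k) (largeSet G tok k)) S.val T.val ↔
      Slides G.Adj (Clash G.Adj ∅) S.val T.val := by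
  have htok : tok.card ≤ 2 * k := by
    rw [← hST]
    exact (Finset.card_union_le _ _).trans (by omega)
  have hStok : ∀ x ∈ S.val, x ∈ tok := fun x hx => by
    rw [← hST]; exact Finset.mem_union_left _ (by simpa using hx)
  have hTtok : ∀ x ∈ T.val, x ∈ tok := fun x hx => by
    rw [← hST]; exact Finset.mem_union_right _ (by simpa using hx)
  have hSZ : ∀ x ∈ S.val, x ∈ separator G tok k := fun x hx => tok_subset_separator (hStok x hx)
  have hTZ : ∀ x ∈ T.val, x ∈ separator G tok k := fun x hx => tok_subset_separator (hTtok x hx)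
  have hcore : ∀ u v, (coreGraph G tok).Adj u v → G.Adj u v := fun _ _ h => h.1
  have hSF : ConflictFree (Clash (coreGraph G tok).Adj ∅) S.val :=
    conflictFree_val_iff.2 fun u hu v hv huv h => hSi hu hv huv (hcore _ _ h)
  have hTF : ConflictFree (Clash (coreGraph G tok).Adj ∅) T.val :=
    conflictFree_val_iff.2 fun u hu v hv huv h => hTi hu hv huv (hcore _ _ h)
  have hsymm : SymmRel (coreGraph G tok).Adj := fun _ _ h => h.symm
  -- In the order of the construction, `e1` removes redundant vertices, `e2` grants the licence on
  -- large components, `e3` contracts them, and `e4` restricts to the kept classes.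
  have e1 := slides_within_notRedundant_iff (G := G) hStok hTtok (conflictFree_val_iff.2 hSi)
  have e3 := slides_mapAdj_iff (A := (coreGraph G tok).Adj) (H := largeSet G tok k)
    (φ := contraction G tok k) hsymm (fun _ => contraction_of_notMem) (fun _ => contraction_mem)
    (fun v hv => by
      rw [contraction, if_pos hv]
      exact within_largeSet hv (within_label v)) (s := S.val) (t := T.val)
    (fun x hx h => h.1 (hSZ x hx)) (fun x hx h => h.1 (hTZ x hx))
  have e4 := (kernel_classSystem (G := G) (tok := tok) (k := k)).slides_iff (k := k) (s := S.val)
    (t := T.val) hS hSZ hTZ (conflictFree_contracted hSF)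
  have e2 : Slides (coreGraph G tok).Adj (Clash (coreGraph G tok).Adj (largeSet G tok k)) S.val
      T.val ↔ Slides (coreGraph G tok).Adj (Clash (coreGraph G tok).Adj ∅) S.val T.val := by
    constructor
    · intro h
      -- If the threshold reaches the cap `n`, there is no large component and the licence is void.
      by_cases hlt : largeSize G tok k < n
      · have hlarge := threshold_eq_of_lt hlt
        set d := smallDegree G tok k
        refine slides_of_slides_large (G := coreGraph G tok) (k := k) (p := 2 * k + 1)
          (D := 2 * (2 * k + 2 * k * d) + (2 * k + 1) + (k + 1) * (k + 1))
          (M := largeSize G tok k)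
          (fun a b c hab hbc hac => not_adj_of_five_le_egirth hG a b c (hcore _ _ hab)
            (hcore _ _ hbc) (hcore _ _ hac))
          (fun a b c d hac hab hbc had hdc => eq_of_five_le_egirth hG a b c d hac (hcore _ _ hab)
            (hcore _ _ hbc) (hcore _ _ had) (hcore _ _ hdc)) ?_ (separator G tok k)
          (label G tok k) label_eq_iff ?_ ?_ ?_ hS hSZ hSF hT hTZ hTF ?_ ?_
        · intro c
          obtain ⟨P, hP, hP'⟩ := exists_pendant_bound (G := G) (tok := tok) c
          exact ⟨P, hP.trans (by omega), hP'⟩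
        · have := card_separator_le (G := G) htok
          change (separator G tok k).card ≤ 2 * k + 2 * k * d at this
          omega
        · exact (pow_le_threshold d k).trans hlarge.ge
        · have := card_separator_le (G := G) htok
          exact (Nat.add_le_add_right this _).trans ((add_le_threshold d k).trans hlarge.ge)
        · intro b hb
          have hbtok : b ∈ tok := hb.elim (hStok b) (hTtok b)
          refine (degree_small_or_large htok hbtok).imp (fun h y hy => ?_) id
          simp only [separator, Finset.mem_filter, Finset.mem_univ, true_and]
          exact Or.inr ⟨b, hbtok, h, hy⟩
        · convert h
          ext v
          simp only [largeSet, Set.mem_ofPred_eq]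
          refine and_congr_right fun _ => iff_of_eq ?_
          congr!
      · have : largeSet G tok k = ∅ := by
          refine Set.eq_empty_iff_forall_notMem.2 fun v hv => ?_
          have h1 := hv.2
          have h2 := Finset.card_le_univ (Finset.univ.filter fun w =>
            label G tok k w = label G tok k v)
          rw [Fintype.card_fin] at h2
          omega
        rwa [this] at h
    · intro h
      exact h.mono (fun _ _ => id) (Clash.anti (Set.empty_subset _))
  exact e4.trans (e3.trans (e2.trans e1))

end Kernel

/-! ### Correctness of the program: tables, pendant vertices and degrees -/

section KernelComputation

theorem exists_lt_iff_fin {n : ℕ} {p : ℕ → Prop} : (∃ i, i < n ∧ p i) ↔ ∃ i : Fin n, p i :=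
  ⟨fun ⟨i, hi, h⟩ => ⟨⟨i, hi⟩, h⟩, fun ⟨i, h⟩ => ⟨i, i.2, h⟩⟩

theorem card_filter_range_eq_fin {n : ℕ} {p : ℕ → Prop} [DecidablePred p] :
    ((Finset.range n).filter p).card = (Finset.univ.filter fun i : Fin n => p i).card := by
  rw [Finset.card_filter, Finset.card_filter, Finset.sum_range]

theorem card_filter_range_lt {m i : ℕ} (h : i ≤ m) :
    ((Finset.range m).filter (· < i)).card = i := by
  have : (Finset.range m).filter (· < i) = Finset.range i := by
    ext j
    simp only [Finset.mem_filter, Finset.mem_range]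
    omega
  rw [this, Finset.card_range]

namespace TokenSlidingInstance

variable (x : TokenSlidingInstance)

/-- The state after the program, started on the instance `x`. -/
noncomputable def final : RamState := execList progDecide x.encode

/-- The vertices with a token of the source or of the target. -/
abbrev tokens : Finset (Fin x.n) := x.source ∪ x.target

theorem k_le : x.k ≤ x.n := by
  have := Finset.card_le_univ x.source
  rwa [x.source_indep.card_eq, Fintype.card_fin] at this

theorem n_pos : 1 ≤ x.n := x.k_pos.trans x.k_le

theorem card_tokens_le : x.tokens.card ≤ 2 * x.k := by
  refine (Finset.card_union_le _ _).trans ?_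
  rw [x.source_indep.card_eq, x.target_indep.card_eq]
  omega

/-- All facts about the program are derived from this equation in the final memory; the syntactic
side conditions hold by evaluation. -/
theorem final_scan_of_self {j a r : ℕ} {e : Ex} (hj : progDecide[j]? = some (.scan a 10 r e))
    (hl : checkScan a 10 r e (progDecide.drop (j + 1)) = true) {c : ℕ} (hc : c < x.final.reg r)
    (he : ∀ f, (∀ i < c, f i = x.final.arr a i) →
      e.eval ((x.final.withArr a f).setReg 10 c) = e.eval (x.final.setReg 10 c)) :
    x.final.arr a c = e.eval (x.final.setReg 10 c) :=
  execList_scan_of_self hj hl _ hc he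

theorem final_scan {j a r : ℕ} {e : Ex} (hj : progDecide[j]? = some (.scan a 10 r e))
    (hl : checkScan a 10 r e (progDecide.drop (j + 1)) = true) (ha : e.arrs.elem a = false) {c : ℕ}
    (hc : c < x.final.reg r) : x.final.arr a c = e.eval (x.final.setReg 10 c) :=
  execList_scan hj hl ha _ hc

@[simp] theorem final_reg_zero : x.final.reg 0 = x.n := reg_execList _ _ (by decide)

@[simp] theorem final_reg_one : x.final.reg 1 = x.k := reg_execList _ _ (by decide)

theorem final_arr_input {a : ℕ} (ha : a < 3) : x.final.arr a = x.encode.arr a := by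
  refine arr_execList _ _ ?_
  interval_cases a <;> decide

@[simp] theorem final_reg_two : x.final.reg 2 = x.n + x.n + 20 := by
  have := execList_set (l := progDecide) (j := 0) rfl rfl rfl rfl x.encode
  rw [← final] at this
  simpa using this

@[simp] theorem final_reg_three : x.final.reg 3 = x.n * (x.n + x.n + 20) := by
  have := execList_set (l := progDecide) (j := 1) rfl rfl rfl rfl x.encode
  rw [← final] at this
  simpa using this

@[simp] theorem final_reg_four : x.final.reg 4 = x.k + x.k + 2 := by
  have := execList_set (l := progDecide) (j := 2) rfl rfl rfl rfl x.encode
  rw [← final] at this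
  simpa using this

@[simp] theorem final_reg_six : x.final.reg 6 = x.k + 1 := by
  have := execList_set (l := progDecide) (j := 3) rfl rfl rfl rfl x.encode
  rw [← final] at this
  simpa using this

@[simp] theorem final_adj (u v : Fin x.n) : x.final.arr 0 (u * x.n + v) = 0 ↔ ¬ x.G.Adj u v := by
  rw [final_arr_input x (by norm_num)]
  have e : ∀ i j : Fin x.n, x.G.Adj i j ∧ (u : ℕ) * x.n + v = i * x.n + j ↔
      x.G.Adj i j ∧ i = u ∧ j = v := by
    intro i j
    refine and_congr_right fun _ => ⟨fun h => ?_, fun h => by rw [h.1, h.2]⟩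
    have hn := x.n_pos
    have d : ∀ a b : Fin x.n, ((a : ℕ) * x.n + b) / x.n = a := fun a b => by
      rw [mul_comm, Nat.mul_add_div (by omega), Nat.div_eq_of_lt b.2, add_zero]
    have h1 := d u v
    rw [h, d i j] at h1
    have h2 : (i : ℕ) * x.n = u * x.n := by rw [h1]
    exact ⟨Fin.ext h1, Fin.ext (by omega)⟩
  simp [encode, e]

@[simp] theorem final_source (u : Fin x.n) : x.final.arr 1 u = if u ∈ x.source then 1 else 0 := by
  rw [final_arr_input x (by norm_num)]
  simp [encode, Fin.val_inj]

@[simp] theorem final_target (u : Fin x.n) : x.final.arr 2 u = if u ∈ x.target then 1 else 0 := by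
  rw [final_arr_input x (by norm_num)]
  simp [encode, Fin.val_inj]

theorem final_isToken (u : Fin x.n) :
    (¬ x.final.arr 1 u = 0 ∨ ¬ x.final.arr 2 u = 0) ↔ u ∈ x.tokens := by
  simp

theorem final_row {i : ℕ} (hi : i < x.n + x.n + 20) : x.final.arr 3 i = i * x.n := by
  rw [x.final_scan (j := 4) rfl rfl rfl (by simpa using hi)]
  simp [← Finset.sum_filter, card_filter_range_lt hi.le]

@[simp] theorem final_row_fin (u : Fin x.n) : x.final.arr 3 u = u * x.n :=
  x.final_row (by omega)

/-- Division is done by counting: `c / n` is the number of `i` with `(i + 1) * n ≤ c`. -/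
theorem final_div {c : ℕ} (hc : c < x.n * (x.n + x.n + 20)) : x.final.arr 4 c = c / x.n := by
  have hn := x.n_pos
  have hlt : c / x.n < x.n + x.n + 20 := Nat.div_lt_of_lt_mul hc
  rw [x.final_scan (j := 5) rfl rfl rfl (by simpa using hc)]
  refine Eq.trans ?_ (card_filter_range_lt hlt.le)
  simp only [Ex.eval_count, RamState.reg_setReg, final_reg_two, Ex.holds_le, Ex.eval_add,
    Ex.eval_load, Ex.eval_var, RamState.arr_setReg]
  refine congrArg Finset.card (Finset.filter_congr fun i hi => ?_)
  simp only [x.final_row (Finset.mem_range.1 hi), if_true, OfNat.zero_ne_ofNat,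
    if_false, final_reg_zero, Nat.reduceEqDiff]
  rw [Nat.lt_iff_add_one_le, Nat.le_div_iff_mul_le (by omega), add_mul, one_mul]

theorem final_mod {c : ℕ} (hc : c < x.n * (x.n + x.n + 20)) : x.final.arr 5 c = c % x.n := by
  have hlt : c / x.n < x.n + x.n + 20 := Nat.div_lt_of_lt_mul hc
  rw [x.final_scan (j := 6) rfl rfl rfl (by simpa using hc)]
  simp [x.final_div hc, x.final_row hlt]
  have := Nat.div_add_mod c x.n
  rw [mul_comm] at this
  omega

theorem cell_lt {t : ℕ} (ht : t < x.n + x.n + 20) (v : Fin x.n) :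
    t * x.n + v < x.n * (x.n + x.n + 20) := by
  have := v.2
  nlinarith

theorem final_div_cell {t : ℕ} (ht : t < x.n + x.n + 20) (v : Fin x.n) :
    x.final.arr 4 (t * x.n + v) = t := by
  have hn := x.n_pos
  rw [x.final_div (x.cell_lt ht v), mul_comm, Nat.mul_add_div (by omega), Nat.div_eq_of_lt v.2,
    add_zero]

theorem final_mod_cell {t : ℕ} (ht : t < x.n + x.n + 20) (v : Fin x.n) :
    x.final.arr 5 (t * x.n + v) = v := by
  rw [x.final_mod (x.cell_lt ht v), mul_comm, Nat.mul_add_mod, Nat.mod_eq_of_lt v.2]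

@[simp] theorem final_div_fin (u v : Fin x.n) : x.final.arr 4 (u * x.n + v) = u :=
  x.final_div_cell (by omega) v

@[simp] theorem final_mod_fin (u v : Fin x.n) : x.final.arr 5 (u * x.n + v) = v :=
  x.final_mod_cell (by omega) v

theorem final_pow {c : ℕ} (hc : c < x.n * (x.n + x.n + 20)) : x.final.arr 6 c = 2 ^ c := by
  induction c with
  | zero =>
    rw [x.final_scan_of_self (j := 7) rfl rfl (by simpa using hc) (by intro f _; simp)]
    simp
  | succ c ih =>
    rw [x.final_scan_of_self (j := 7) rfl rfl (by simpa using hc) (by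
      intro f hf
      simp [hf c (by omega)])]
    simp [ih (by omega)]
    ring

/-- The inner cap keeps the outer exponent inside the table of powers; `d ≤ n` does the same for the
inner one. -/
theorem final_threshold {d : ℕ} (hd : d ≤ x.n) : min x.n (x.final.arr 6
    (min x.n (x.final.arr 6 (d + x.k + 10)))) = threshold x.n x.k d := by
  have h1 := x.n_pos
  have h2 := x.k_le
  have h3 : d + x.k + 10 < x.n * (x.n + x.n + 20) := by nlinarith
  rw [x.final_pow h3, x.final_pow (lt_of_le_of_lt (min_le_left _ _) (by nlinarith)), threshold]

@[simp] theorem final_freePendant (u : Fin x.n) [DecidableRel x.G.Adj] :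
    x.final.arr 8 u = 0 ↔ ¬ FreePendant x.G x.tokens u := by
  have hdeg : x.final.arr 7 u = x.G.degree u := by
    rw [x.final_scan (j := 8) rfl rfl rfl (by simp)]
    simp only [entry, Ex.eval_count, Ex.holds_load, Ex.eval_add, Ex.eval_load, Ex.eval_var,
      RamState.reg_setReg, RamState.arr_setReg, final_reg_zero, card_filter_range_eq_fin]
    simp [← SimpleGraph.card_neighborFinset_eq_degree, SimpleGraph.neighborFinset_eq_filter]
  have := x.final_scan (j := 9) rfl rfl rfl (c := u) (by simp)
  rw [← not_iff_not, ← ne_eq, this, ← Ex.Holds]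
  simp [isToken, hdeg, FreePendant, and_assoc]

theorem final_core (u : Fin x.n) [DecidableRel x.G.Adj] :
    x.final.arr 10 u = 0 ↔ Redundant x.G x.tokens u := by
  have := x.final_scan (j := 10) rfl rfl rfl (c := u) (by simp)
  rw [← not_iff_not, ← ne_eq, this, ← Ex.Holds]
  simp [entry, exists_lt_iff_fin, Redundant]

theorem holds_adjEx {s : RamState} {e e' : Ex} {u v : Fin x.n} (hs : s.arr = x.final.arr)
    (he : e.eval s = u) (he' : e'.eval s = v) :
    (adjEx e e').Holds s ↔ (coreGraph x.G x.tokens).Adj u v := by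
  classical
  simp only [adjEx, entry, Ex.holds_and, Ex.holds_load, Ex.eval_add, Ex.eval_load, he, he', hs,
    ne_eq, final_row_fin, final_adj, final_core, not_not]
  simp only [coreGraph, Within, Set.mem_ofPred_eq]
  constructor
  · rintro ⟨h1, h2, h3⟩
    exact ⟨h3, by convert h1, by convert h2⟩
  · rintro ⟨h1, h2, h3⟩
    exact ⟨by convert h2, by convert h3, h1⟩

open Classical in
@[simp] theorem final_degree (u : Fin x.n) :
    x.final.arr 11 u = (coreGraph x.G x.tokens).degree u := by
  rw [x.final_scan (j := 11) rfl rfl rfl (by simp)]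
  simp only [Ex.eval_count, RamState.reg_setReg, final_reg_zero, card_filter_range_eq_fin,
    Nat.reduceEqDiff, if_false]
  rw [← SimpleGraph.card_neighborFinset_eq_degree]
  refine congrArg Finset.card (Finset.ext fun v => ?_)
  rw [Finset.mem_filter, SimpleGraph.mem_neighborFinset,
    x.holds_adjEx (u := u) (v := v) (by simp) (by simp) (by simp)]
  simp

end TokenSlidingInstance

end KernelComputation

/-! ### Correctness of the program: separator, components and signatures -/

section KernelComputation

theorem Ex.eval_ite_of_iff {c a b : Ex} {s : RamState} {p : Prop} [Decidable p]
    (h : c.Holds s ↔ p) : (ite c a b).eval s = if p then a.eval s else b.eval s :=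
  if_congr h rfl rfl

theorem Ex.eval_count_of_iff {y r m : ℕ} {e : Ex} {s : RamState} {p : Fin m → Prop}
    {dp : DecidablePred p} (hr : s.reg r = m) (h : ∀ i : Fin m, e.Holds (s.setReg y i) ↔ p i) :
    (count y r e).eval s = (Finset.univ.filter p).card := by
  rw [eval_count, hr, card_filter_range_eq_fin]
  exact congrArg Finset.card (Finset.filter_congr fun i _ => h i)

theorem Ex.eval_sum_ite_of_iff {y r m : ℕ} {c a b : Ex} {s : RamState} {p : Fin m → Prop}
    [DecidablePred p] (hr : s.reg r = m) (h : ∀ i : Fin m, c.Holds (s.setReg y i) ↔ p i) :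
    (sum y r (ite c a b)).eval s =
      ∑ i : Fin m, if p i then a.eval (s.setReg y i) else b.eval (s.setReg y i) := by
  rw [eval_sum, hr, Finset.sum_range]
  exact Finset.sum_congr rfl fun i _ => eval_ite_of_iff (h i)

namespace TokenSlidingInstance

variable (x : TokenSlidingInstance)

theorem thresholds_le {n : ℕ} (G : SimpleGraph (Fin n)) (tok : Finset (Fin n)) (k i : ℕ) :
    thresholds G tok k i ≤ n := by
  induction i with
  | zero => exact Nat.zero_le _
  | succ i ih =>
    rw [thresholds]
    split_ifs
    · exact min_le_left _ _
    · exact ih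

theorem final_thresholds {i : ℕ} (hi : i < x.k + x.k + 2) :
    x.final.arr 12 i = thresholds x.G x.tokens x.k i := by
  induction i with
  | zero =>
    rw [x.final_scan_of_self (j := 12) rfl rfl (by simp) (by intro f _; simp)]
    simp [thresholds]
  | succ i ih =>
    have h := ih (by omega)
    have ht := x.final_threshold (thresholds_le x.G x.tokens x.k i)
    rw [x.final_scan_of_self (j := 12) rfl rfl (by simpa using hi) (by
      intro f hf
      simp [thresholdEx, isToken, hf i (by omega)])]
    simp only [thresholdEx, isToken, Ex.eval_ite, Ex.holds_var, RamState.reg_setReg, if_true,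
      Ex.holds_exi, Ex.holds_and, Ex.holds_or, Ex.holds_load, Ex.holds_lt, Ex.holds_le,
      Ex.eval_load, Ex.eval_sub, Ex.eval_var, Ex.eval_const, Ex.eval_min, Ex.eval_add,
      RamState.arr_setReg, final_reg_zero, final_reg_one, Nat.reduceEqDiff, if_false,
      OfNat.zero_ne_ofNat, OfNat.one_ne_ofNat, Nat.add_sub_cancel, h, ht, exists_lt_iff_fin,
      final_degree, ne_eq, final_isToken, Nat.add_eq_zero_iff, one_ne_zero, and_false,
      not_false_iff, thresholds]

theorem final_smallDegree : x.final.arr 12 (x.k + x.k + 1) = smallDegree x.G x.tokens x.k := by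
  rw [x.final_thresholds (by omega), smallDegree, two_mul]

theorem eval_thresholdEx {s : RamState} {e : Ex} (h0 : s.reg 0 = x.n) (h1 : s.reg 1 = x.k)
    (hs : s.arr = x.final.arr) (he : e.eval s = smallDegree x.G x.tokens x.k) :
    (thresholdEx e).eval s = largeSize x.G x.tokens x.k := by
  simp only [thresholdEx, Ex.eval_min, Ex.eval_var, Ex.eval_load, Ex.eval_add, Ex.eval_const, h0, h1,
    hs, he]
  exact x.final_threshold (thresholds_le _ _ _ _)

@[simp] theorem final_separator (u : Fin x.n) :
    x.final.arr 13 u = 0 ↔ u ∉ separator x.G x.tokens x.k := by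
  have h := x.final_scan (j := 13) rfl rfl rfl (c := u) (by simp)
  rw [← not_iff_not, ← ne_eq, h, ← Ex.Holds]
  have hadj : ∀ v : Fin x.n, (adjEx (.var 11) (.var 10)).Holds ((x.final.setReg 10 u).setReg 11 v) ↔
      (coreGraph x.G x.tokens).Adj v u := fun v => x.holds_adjEx (by simp) (by simp) (by simp)
  simp [isToken, exists_lt_iff_fin, hadj, final_smallDegree, separator]
  rw [← and_imp, ← not_or, ← or_iff_not_imp_left]

/-- The expression for the label of a vertex after a number of merges. -/
def mergeEx : Ex :=
  .ite (.load 4 (.var 10)) (.ite (.and (.not (.load 13 (.sub (.load 4 (.var 10)) (.const 1))))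
      (.exi 11 0 (.and (.not (.load 13 (.var 11))) (.and
        (adjEx (.sub (.load 4 (.var 10)) (.const 1)) (.var 11))
        (.eq (entry 14 (.sub (.load 4 (.var 10)) (.const 1)) (.var 11))
          (entry 14 (.sub (.load 4 (.var 10)) (.const 1)) (.load 5 (.var 10))))))))
      (entry 14 (.sub (.load 4 (.var 10)) (.const 1)) (.sub (.load 4 (.var 10)) (.const 1)))
      (entry 14 (.sub (.load 4 (.var 10)) (.const 1)) (.load 5 (.var 10))))
    (.load 5 (.var 10))

theorem final_relabel {t : ℕ} (ht : t ≤ x.n) (w : Fin x.n) : x.final.arr 14 (t * x.n + w) =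
    relabel (coreGraph x.G x.tokens).Adj (separator x.G x.tokens x.k) t w := by
  classical
  induction t generalizing w with
  | zero =>
    have hc := x.cell_lt (t := 0) (by omega) w
    have hd := x.final_div_cell (t := 0) (by omega) w
    have hm := x.final_mod_cell (t := 0) (by omega) w
    simp only [zero_mul, zero_add] at hc hd hm ⊢
    rw [x.final_scan_of_self (j := 14) rfl rfl (by simpa using hc)
      (by intro f _; simp only [Ex.eval_ite, Ex.holds_load, Ex.eval_var, Ex.eval_load]; simp [hd])]
    simp only [Ex.eval_ite, Ex.holds_load, Ex.eval_var, Ex.eval_load]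
    simp [hd, hm, relabel]
  | succ t ih =>
    have hc := x.cell_lt (t := t + 1) (by omega) w
    have hd := x.final_div_cell (t := t + 1) (by omega) w
    have hm := x.final_mod_cell (t := t + 1) (by omega) w
    let u : Fin x.n := ⟨t, ht⟩
    have hr : x.final.arr 3 t = t * x.n := x.final_row (by omega)
    have hcell : ∀ v : Fin x.n, t * x.n + v < (t + 1) * x.n + w := fun v => by
      have := v.2; rw [add_mul]; omega
    have hadj : ∀ (f : ℕ → ℕ) (v : Fin x.n), (adjEx (.sub (.load 4 (.var 10)) (.const 1)) (.var 11)).Holds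
        (((x.final.withArr 14 f).setReg 10 ((t + 1) * x.n + w)).setReg 11 v) ↔
        (coreGraph x.G x.tokens).Adj u v := by
      intro f v
      have h := x.holds_adjEx (s := (x.final.setReg 10 ((t + 1) * x.n + w)).setReg 11 v)
        (e := .sub (.load 4 (.var 10)) (.const 1)) (e' := .var 11) (u := u) (v := v) (by simp)
        (by simp [hd, u]) (by simp)
      rw [← h]
      simp [adjEx, entry]
    have hadj' : ∀ v : Fin x.n, (adjEx (.sub (.load 4 (.var 10)) (.const 1)) (.var 11)).Holds
        ((x.final.setReg 10 ((t + 1) * x.n + w)).setReg 11 v) ↔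
        (coreGraph x.G x.tokens).Adj u v := fun v =>
      x.holds_adjEx (by simp) (by simp [hd, u]) (by simp)
    have hZ : x.final.arr 13 t = 0 ↔ u ∉ separator x.G x.tokens x.k := x.final_separator u
    have hu : x.final.arr 14 (t * x.n + t) = _ := ih (by omega) u
    -- The value depends on array `14` only through row `t`. So the same computation serves the
    -- final memory and a memory whose array `14` is correct only below the current cell.
    have key : ∀ s : RamState, s.arr 3 = x.final.arr 3 → s.arr 4 = x.final.arr 4 →
        s.arr 5 = x.final.arr 5 → s.arr 13 = x.final.arr 13 → s.reg 0 = x.n →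
        s.reg 10 = (t + 1) * x.n + w → (∀ v : Fin x.n, (adjEx (.sub (.load 4 (.var 10)) (.const 1))
          (.var 11)).Holds (s.setReg 11 v) ↔ (coreGraph x.G x.tokens).Adj u v) →
        (∀ v : Fin x.n, s.arr 14 (t * x.n + v) = x.final.arr 14 (t * x.n + v)) →
        mergeEx.eval s = relabel (coreGraph x.G x.tokens).Adj (separator x.G x.tokens x.k) (t + 1)
          w := by
      intro s h3 h4 h5 h13 h0 h10 ha h14
      have h14u : s.arr 14 (t * x.n + t) = _ := (h14 u).trans hu
      rw [mergeEx, Ex.eval_ite_of_iff (p := True) (by simp [h4, h10, hd]), if_pos trivial,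
        Ex.eval_ite_of_iff (p := u ∉ separator x.G x.tokens x.k ∧ ∃ v,
          v ∉ separator x.G x.tokens x.k ∧ (coreGraph x.G x.tokens).Adj u v ∧
          relabel (coreGraph x.G x.tokens).Adj (separator x.G x.tokens x.k) t v =
          relabel (coreGraph x.G x.tokens).Adj (separator x.G x.tokens x.k) t w), relabel,
        dif_pos (show t < x.n from ht), apply_ite Fin.val]
      · simp [entry, h4, h5, h3, h10, hd, hm, hr, h14, h14u, ih (by omega : t ≤ x.n), u]
      · simp only [Ex.holds_and, Ex.holds_not, Ex.holds_load, Ex.holds_exi, ha, h0,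
          exists_lt_iff_fin, Ex.holds_eq, entry, Ex.eval_load, Ex.eval_add, Ex.eval_sub, Ex.eval_var,
          Ex.eval_const, RamState.arr_setReg, RamState.reg_setReg, h3, h4, h5, h10, hd, hm, hr, h13,
          h14, ih (by omega : t ≤ x.n), if_true, Nat.add_sub_cancel, ne_eq, not_not, hZ,
          final_separator, Nat.reduceEqDiff, if_false, Fin.val_inj]
    rw [x.final_scan_of_self (j := 14) rfl rfl (by simpa using hc) fun f hf =>
      (key _ (by simp) (by simp) (by simp) (by simp) (by simp) (by simp) (hadj f)
        fun v => by simp [hf _ (hcell v)]).trans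
      (key _ (by simp) (by simp) (by simp) (by simp) (by simp) (by simp) hadj' fun v => by simp).symm]
    exact key _ (by simp) (by simp) (by simp) (by simp) (by simp) (by simp) hadj' fun v => by simp

@[simp] theorem final_label (u : Fin x.n) :
    x.final.arr 15 u = label x.G x.tokens x.k u := by
  rw [x.final_scan (j := 15) rfl rfl rfl (by simp)]
  simp [entry, x.final_row (i := x.n) (by omega), x.final_relabel le_rfl, label]

@[simp] theorem final_large (u : Fin x.n) :
    x.final.arr 17 u = 0 ↔ u ∉ largeSet x.G x.tokens x.k := by
  classical
  have h16 : x.final.arr 16 u = (Finset.univ.filter fun w =>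
      label x.G x.tokens x.k w = label x.G x.tokens x.k u).card := by
    rw [x.final_scan (j := 16) rfl rfl rfl (by simp)]
    simp [card_filter_range_eq_fin, Fin.val_inj]
  have h := x.final_scan (j := 17) rfl rfl rfl (c := u) (by simp)
  rw [← not_iff_not, ← ne_eq, h, ← Ex.Holds]
  have ht := x.eval_thresholdEx (s := x.final.setReg 10 u)
    (e := .load 12 (.sub (.var 4) (.const 1))) (by simp) (by simp) (by simp)
    (by simp [final_smallDegree])
  simp only [Ex.holds_and, Ex.holds_not, Ex.holds_load, Ex.holds_lt, Ex.eval_load, Ex.eval_var,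
    RamState.reg_setReg, RamState.arr_setReg, if_true, ht, h16, final_separator, ne_eq, not_not,
    largeSet, Set.mem_ofPred_eq]

@[simp] theorem final_contraction (u : Fin x.n) :
    x.final.arr 18 u = contraction x.G x.tokens x.k u := by
  classical
  rw [x.final_scan (j := 18) rfl rfl rfl (by simp), contraction, apply_ite Fin.val,
    Ex.eval_ite_of_iff (p := u ∈ largeSet x.G x.tokens x.k) (by simp)]
  simp

theorem final_contractedAdj (u v : Fin x.n) :
    x.final.arr 20 (u * x.n + v) = 0 ↔ ¬ ContractedAdj x.G x.tokens x.k u v := by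
  have hc : ∀ u v : Fin x.n, (u : ℕ) * x.n + v < x.final.reg 3 := fun u v => by
    simpa using x.cell_lt (by omega) v
  have h19 : ∀ u v : Fin x.n, x.final.arr 19 (u * x.n + v) = 0 ↔
      ¬ ∃ u', contraction x.G x.tokens x.k u' = u ∧ (coreGraph x.G x.tokens).Adj u' v := by
    intro u v
    have h := x.final_scan (j := 19) rfl rfl rfl (hc u v)
    rw [← not_iff_not, ← ne_eq, h, ← Ex.Holds]
    have hadj : ∀ u' : Fin x.n, (adjEx (.var 11) (.load 5 (.var 10))).Holds
        ((x.final.setReg 10 (u * x.n + v)).setReg 11 u') ↔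
        (coreGraph x.G x.tokens).Adj u' v := fun u' =>
      x.holds_adjEx (by simp) (by simp) (by simp)
    simp [exists_lt_iff_fin, hadj, Fin.val_inj]
  have h := x.final_scan (j := 20) rfl rfl rfl (hc u v)
  rw [← not_iff_not, ← ne_eq, h, ← Ex.Holds]
  simp only [Ex.holds_exi, Ex.holds_and, Ex.holds_eq, entry, Ex.holds_load, Ex.eval_load,
    Ex.eval_add, Ex.eval_var, RamState.reg_setReg, RamState.arr_setReg, if_true, final_reg_zero,
    OfNat.zero_ne_ofNat, if_false, Nat.reduceEqDiff, exists_lt_iff_fin, final_contraction,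
    final_mod_fin, final_div_fin, final_row_fin, Fin.val_inj, ne_eq, h19, not_not, ContractedAdj,
    MapAdj]
  exact ⟨fun ⟨v', h1, u', h2, h3⟩ => ⟨u', v', h2, h1, h3⟩,
    fun ⟨u', v', h2, h1, h3⟩ => ⟨v', h1, u', h2, h3⟩⟩

@[simp] theorem final_active (u : Fin x.n) :
    x.final.arr 21 u = 0 ↔ ¬ IsActive x.G x.tokens x.k u := by
  have h := x.final_scan (j := 21) rfl rfl rfl (c := u) (by simp)
  rw [← not_iff_not, ← ne_eq, h, ← Ex.Holds]
  simp [IsActive, Fin.val_inj]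

@[simp] theorem final_rank (u : Fin x.n) : x.final.arr 22 u =
    classRank (IsActive x.G x.tokens x.k) (label x.G x.tokens x.k) u := by
  rw [x.final_scan (j := 22) rfl rfl rfl (by simp), classRank]
  exact Ex.eval_count_of_iff (by simp) fun v => by simp [Fin.val_inj]

@[simp] theorem final_vertexCode (u : Fin x.n) : x.final.arr 23 u =
    vertexCode (separator x.G x.tokens x.k) (IsActive x.G x.tokens x.k) (label x.G x.tokens x.k)
      u := by
  classical
  rw [x.final_scan (j := 23) rfl rfl rfl (by simp), vertexCode,
    Ex.eval_ite_of_iff (p := u ∈ separator x.G x.tokens x.k) (by simp)]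
  simp

theorem final_pow_cell {t : ℕ} (ht : t < x.n + x.n + 20) (u : Fin x.n) :
    x.final.arr 6 (x.final.arr 3 t + classRank (IsActive x.G x.tokens x.k)
      (label x.G x.tokens x.k) u) = 2 ^ (t * x.n + classRank (IsActive x.G x.tokens x.k)
      (label x.G x.tokens x.k) u) := by
  rw [x.final_row ht, x.final_pow]
  exact x.cell_lt ht ⟨_, classRank_lt u⟩

theorem final_vertexSignature (u : Fin x.n) : x.final.arr 24 u =
    vertexSignature (ContractedAdj x.G x.tokens x.k) (largeSet x.G x.tokens x.k)
      (separator x.G x.tokens x.k) (IsActive x.G x.tokens x.k) (label x.G x.tokens x.k) u := by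
  have hcode : ∀ v : Fin x.n, vertexCode (separator x.G x.tokens x.k)
      (IsActive x.G x.tokens x.k) (label x.G x.tokens x.k) v < x.n + x.n + 20 := by
    intro v
    have := classRank_lt (ac := IsActive x.G x.tokens x.k) (lab := label x.G x.tokens x.k) v
    unfold vertexCode
    split_ifs <;> omega
  classical
  rw [x.final_scan (j := 24) rfl rfl rfl (by simp), vertexSignature, Ex.eval_add, Ex.eval_add,
    Ex.eval_sum_ite_of_iff (m := x.n) (p := fun v => ContractedAdj x.G x.tokens x.k u v ∧
      (v ∈ separator x.G x.tokens x.k ∨ IsActive x.G x.tokens x.k v ∧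
        label x.G x.tokens x.k v = label x.G x.tokens x.k u)) (by simp),
    Ex.eval_ite_of_iff (p := u ∈ largeSet x.G x.tokens x.k) (by simp)]
  · simp only [Ex.eval_add, Ex.eval_load, Ex.eval_var, Ex.eval_const, RamState.reg_setReg,
      RamState.arr_setReg, if_true, final_reg_zero, OfNat.zero_ne_ofNat, if_false,
      Nat.reduceEqDiff, final_rank, final_vertexCode, fun v => x.final_pow_cell (hcode v),
      x.final_pow_cell (t := x.n + x.n) (by omega),
      x.final_pow_cell (t := x.n + x.n + 1) (by omega)]
  · intro v
    simp [entry, final_contractedAdj, Fin.val_inj]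

@[simp] theorem final_signature (u : Fin x.n) :
    x.final.arr 25 u = classSignature x.G x.tokens x.k u := by
  classical
  rw [x.final_scan (j := 25) rfl rfl rfl (by simp), classSignature, signature,
    Ex.eval_sum_ite_of_iff (m := x.n) (p := fun v => IsActive x.G x.tokens x.k v ∧
      label x.G x.tokens x.k v = u) (by simp) fun v => by simp [Fin.val_inj]]
  simp [final_vertexSignature]

@[simp] theorem final_kernel (u : Fin x.n) :
    x.final.arr 28 u = 0 ↔ u ∉ kernelSet x.G x.tokens x.k := by
  classical
  have h26 : ∀ u : Fin x.n, x.final.arr 26 u = 0 ↔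
      ¬ ∃ v, IsActive x.G x.tokens x.k v ∧ label x.G x.tokens x.k v = u := by
    intro u
    have h := x.final_scan (j := 26) rfl rfl rfl (c := u) (by simp)
    rw [← not_iff_not, ← ne_eq, h, ← Ex.Holds]
    simp [exists_lt_iff_fin, Fin.val_inj]
  have h27 : ∀ u : Fin x.n, x.final.arr 27 u = (earlier (IsActive x.G x.tokens x.k)
      (label x.G x.tokens x.k) (classSignature x.G x.tokens x.k) u).card := by
    intro u
    rw [x.final_scan (j := 27) rfl rfl rfl (by simp)]
    exact Ex.eval_count_of_iff (by simp) fun v => by simp [h26]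
  have h := x.final_scan (j := 28) rfl rfl rfl (c := u) (by simp)
  rw [← not_iff_not, ← ne_eq, h, ← Ex.Holds]
  simp [h27, kernelSet, keptSet]
  tauto

end TokenSlidingInstance

end KernelComputation

/-! ### The enumeration of the kernel -/

section Search

namespace TokenSlidingInstance

variable (x : TokenSlidingInstance)

/-- The number of vertices of the kernel. -/
noncomputable def kernelCard : ℕ := x.final.reg 5

@[simp] theorem final_reg_five : x.final.reg 5 = x.kernelCard := rfl

/-- The rank of a vertex among the vertices of the kernel. -/
noncomputable def kernelRank (u : Fin x.n) : ℕ :=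
  {v | v < u ∧ v ∈ kernelSet x.G x.tokens x.k}.ncard

theorem final_kernelCard : x.kernelCard = (kernelSet x.G x.tokens x.k).ncard := by
  classical
  have := execList_set (l := progDecide) (j := 31) rfl rfl rfl rfl x.encode
  rw [← final] at this
  rw [kernelCard, this, Ex.eval_count_of_iff (m := x.n) (dp := Classical.decPred _)
    (p := fun u => u ∈ kernelSet x.G x.tokens x.k) (by simp) fun u => by simp,
    ← Set.ncard_coe_finset]
  simp

@[simp] theorem final_kernelRank (u : Fin x.n) : x.final.arr 29 u = x.kernelRank u := by
  classical
  rw [x.final_scan (j := 29) rfl rfl rfl (by simp), Ex.eval_count_of_iff (m := x.n) (dp := Classical.decPred _)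
    (p := fun v => v < u ∧ v ∈ kernelSet x.G x.tokens x.k) (by simp) fun v => by simp,
    ← Set.ncard_coe_finset, kernelRank]
  simp

theorem kernelRank_lt_kernelRank {u v : Fin x.n} (hu : u ∈ kernelSet x.G x.tokens x.k)
    (huv : u < v) : x.kernelRank u < x.kernelRank v :=
  Set.ncard_lt_ncard ⟨fun _ hw => ⟨hw.1.trans huv, hw.2⟩,
    fun h => lt_irrefl u (h (show u ∈ _ from ⟨huv, hu⟩)).1⟩

theorem kernelRank_lt {u : Fin x.n} (hu : u ∈ kernelSet x.G x.tokens x.k) :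
    x.kernelRank u < x.kernelCard := by
  rw [final_kernelCard]
  exact Set.ncard_lt_ncard ⟨fun _ hw => hw.2, fun h => lt_irrefl u (h hu).1⟩

/-- The rank is strictly increasing on the kernel and less than its size, hence a bijection; the
enumeration is its inverse. -/
theorem exists_kernelVertex : ∃ e : Fin x.kernelCard → Fin x.n, Function.Injective e ∧
    Set.range e = kernelSet x.G x.tokens x.k ∧ ∀ z, x.kernelRank (e z) = z := by
  classical
  let f : kernelSet x.G x.tokens x.k → Fin x.kernelCard := fun u =>
    ⟨x.kernelRank u, x.kernelRank_lt u.2⟩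
  have hf : Function.Injective f := by
    intro u v h
    have h : x.kernelRank u = x.kernelRank v := congrArg Fin.val h
    rcases lt_trichotomy u v with h' | h' | h'
    · exact absurd h (x.kernelRank_lt_kernelRank u.2 h').ne
    · exact h'
    · exact absurd h (x.kernelRank_lt_kernelRank v.2 h').ne'
  have hb : Function.Bijective f := (Fintype.bijective_iff_injective_and_card f).2
    ⟨hf, by rw [Fintype.card_fin, final_kernelCard, ← Nat.card_coe_set_eq, Nat.card_eq_fintype_card]⟩
  let E := Equiv.ofBijective f hb
  refine ⟨fun z => (E.symm z).1, fun z w h => E.symm.injective (Subtype.ext h), ?_, fun z => ?_⟩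
  · ext u
    constructor
    · rintro ⟨z, rfl⟩
      exact (E.symm z).2
    · exact fun hu => ⟨E ⟨u, hu⟩, by simp⟩
  · exact congrArg Fin.val (E.apply_symm_apply z)

/-- The enumeration of the kernel. -/
noncomputable def kernelVertex : Fin x.kernelCard → Fin x.n := x.exists_kernelVertex.choose

theorem kernelVertex_injective : Function.Injective x.kernelVertex :=
  x.exists_kernelVertex.choose_spec.1

theorem range_kernelVertex : Set.range x.kernelVertex = kernelSet x.G x.tokens x.k :=
  x.exists_kernelVertex.choose_spec.2.1

theorem kernelRank_kernelVertex (z : Fin x.kernelCard) : x.kernelRank (x.kernelVertex z) = z :=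
  x.exists_kernelVertex.choose_spec.2.2 z

theorem kernelCard_le : x.kernelCard ≤ x.n := by
  simpa using Fintype.card_le_of_injective _ x.kernelVertex_injective

@[simp] theorem final_kernelVertex (z : Fin x.kernelCard) :
    x.final.arr 30 z = x.kernelVertex z := by
  classical
  have hz := z.2.trans_le x.kernelCard_le
  rw [x.final_scan (j := 30) rfl rfl rfl (by simpa using hz), Ex.eval_sum_ite_of_iff (m := x.n)
    (p := fun v => v = x.kernelVertex z) (by simp)]
  · simp
  · intro v
    have hv : v ∈ kernelSet x.G x.tokens x.k ↔ ∃ w, x.kernelVertex w = v := by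
      rw [← range_kernelVertex, Set.mem_range]
    simp only [Ex.holds_and, Ex.holds_load, Ex.eval_var, RamState.reg_setReg, RamState.arr_setReg,
      if_true, ne_eq, final_kernel, not_not, Ex.holds_eq, Ex.eval_load, final_kernelRank, hv,
      Nat.reduceEqDiff, if_false]
    constructor
    · rintro ⟨⟨w, rfl⟩, h⟩
      rw [kernelRank_kernelVertex, Fin.val_inj] at h
      rw [h]
    · rintro rfl
      exact ⟨⟨z, rfl⟩, x.kernelRank_kernelVertex z⟩

/-- The relation of sliding between numbers of vertices of the kernel. -/
def KernelAdj (z w : Fin x.kernelCard) : Prop :=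
  ContractedAdj x.G x.tokens x.k (x.kernelVertex z) (x.kernelVertex w)

/-- The relation of conflict between numbers of vertices of the kernel. -/
def KernelClash (z w : Fin x.kernelCard) : Prop :=
  Clash (ContractedAdj x.G x.tokens x.k) (largeSet x.G x.tokens x.k) (x.kernelVertex z)
    (x.kernelVertex w)

theorem kernelClash_symm : SymmRel x.KernelClash :=
  fun _ _ h => Clash.symmRel contractedAdj_symm _ h

theorem subset_tokens : x.source ⊆ x.tokens ∧ x.target ⊆ x.tokens :=
  ⟨Finset.subset_union_left, Finset.subset_union_right⟩

theorem exists_map_kernelVertex {S : Finset (Fin x.n)} (hS : S ⊆ x.tokens) :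
    ∃ s : Multiset (Fin x.kernelCard), s.map x.kernelVertex = S.val := by
  classical
  refine ⟨(Finset.univ.filter fun z => x.kernelVertex z ∈ S).val, ?_⟩
  refine (Finset.map_val ⟨_, x.kernelVertex_injective⟩ _).symm.trans (congrArg Finset.val ?_)
  ext u
  simp only [Finset.mem_map, Finset.mem_filter, Finset.mem_univ, true_and,
    Function.Embedding.coeFn_mk]
  constructor
  · rintro ⟨z, h, rfl⟩
    exact h
  · intro hu
    have : u ∈ kernelSet x.G x.tokens x.k := Or.inl (tok_subset_separator (hS hu))
    rw [← range_kernelVertex] at this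
    obtain ⟨z, rfl⟩ := this
    exact ⟨z, hu, rfl⟩

/-- The source, given by numbers of vertices of the kernel. -/
noncomputable def kernelSource : Multiset (Fin x.kernelCard) :=
  (x.exists_map_kernelVertex x.subset_tokens.1).choose

/-- The target, given by numbers of vertices of the kernel. -/
noncomputable def kernelTarget : Multiset (Fin x.kernelCard) :=
  (x.exists_map_kernelVertex x.subset_tokens.2).choose

theorem map_kernelSource : x.kernelSource.map x.kernelVertex = x.source.val :=
  (x.exists_map_kernelVertex x.subset_tokens.1).choose_spec

theorem map_kernelTarget : x.kernelTarget.map x.kernelVertex = x.target.val :=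
  (x.exists_map_kernelVertex x.subset_tokens.2).choose_spec

theorem isYes_iff_slides_kernel (hG : 5 ≤ x.G.egirth) :
    x.IsYes ↔ Slides x.KernelAdj x.KernelClash x.kernelSource x.kernelTarget := by
  rw [isYes_iff, ← slides_kernel_iff hG (tok := x.tokens) rfl x.source_indep.card_eq
    x.target_indep.card_eq x.source_indep.isIndepSet x.target_indep.isIndepSet,
    ← range_kernelVertex, ← map_kernelSource, ← map_kernelTarget]
  exact slides_within_range_iff (Clash.symmRel contractedAdj_symm _) x.kernelVertex_injective

theorem conflictFree_kernelSource : ConflictFree x.KernelClash x.kernelSource := by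
  have h : ConflictFree (Clash (coreGraph x.G x.tokens).Adj ∅) x.source.val :=
    conflictFree_val_iff.2 fun u hu v hv huv h => x.source_indep.isIndepSet hu hv huv h.1
  have h := conflictFree_contracted (k := x.k) h
  rw [← map_kernelSource] at h
  intro u v r e hc
  exact h _ _ _ (by rw [e, Multiset.map_cons, Multiset.map_cons]) hc

theorem card_kernelSource : x.kernelSource.card = x.k := by
  rw [← Multiset.card_map x.kernelVertex, map_kernelSource]
  exact x.source_indep.card_eq

theorem kernelCard_pos : 1 ≤ x.kernelCard := by
  have h : 0 < x.kernelSource.card := by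
    rw [card_kernelSource]; exact x.k_pos
  obtain ⟨z, -⟩ := Multiset.card_pos_iff_exists_mem.1 h
  exact z.pos

end TokenSlidingInstance

end Search

/-! ### Correctness of the search over tuples -/

section Search

theorem Ex.eval_count_eq {y r c : ℕ} {e : Ex} {s : RamState} (hc : c ≤ s.reg r)
    (h : ∀ i < s.reg r, e.Holds (s.setReg y i) ↔ i < c) : (count y r e).eval s = c := by
  rw [eval_count]
  refine Eq.trans (congrArg Finset.card (Finset.filter_congr fun i hi => ?_))
    (card_filter_range_lt hc)
  exact h i (Finset.mem_range.1 hi)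

theorem Ex.eval_sum_eq {y r c m : ℕ} {e : Ex} {s : RamState} (hc : c ≤ s.reg r)
    (h : ∀ i < s.reg r, e.eval (s.setReg y i) = if i < c then m else 0) :
    (sum y r e).eval s = c * m := by
  rw [eval_sum, Finset.sum_congr rfl fun i hi => h i (Finset.mem_range.1 hi), ← Finset.sum_filter,
    Finset.sum_const, card_filter_range_lt hc, smul_eq_mul]

namespace TokenSlidingInstance

variable (x : TokenSlidingInstance)

/-- The number of tuples of vertices of the kernel. -/
noncomputable def tupleCard : ℕ := x.kernelCard ^ x.k

theorem final_kernelPow {i : ℕ} (hi : i < x.k + 1) : x.final.arr 31 i = x.kernelCard ^ i := by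
  induction i with
  | zero =>
    rw [x.final_scan_of_self (j := 32) rfl rfl (by simp) (by intro f _; simp)]
    simp
  | succ i ih =>
    rw [x.final_scan_of_self (j := 32) rfl rfl (by simpa using hi) (by
      intro f hf
      simp [hf i (by omega)])]
    simp [ih (by omega), pow_succ, mul_comm]

@[simp] theorem final_reg_seven : x.final.reg 7 = x.tupleCard := by
  have := execList_set (l := progDecide) (j := 33) rfl rfl rfl rfl x.encode
  rw [← final] at this
  rw [this]
  simp [x.final_kernelPow (i := x.k) (by omega), tupleCard]

@[simp] theorem final_reg_nine : x.final.reg 9 = x.tupleCard + 1 + x.k := by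
  have := execList_set (l := progDecide) (j := 34) rfl rfl rfl rfl x.encode
  rw [← final] at this
  rw [this]
  simp

@[simp] theorem final_reg_eight : x.final.reg 8 = x.tupleCard * (x.tupleCard + 1 + x.k) := by
  have := execList_set (l := progDecide) (j := 35) rfl rfl rfl rfl x.encode
  rw [← final] at this
  rw [this]
  simp

theorem tupleCard_pos : 1 ≤ x.tupleCard := Nat.one_le_pow _ _ x.kernelCard_pos

theorem final_tupleRow {i : ℕ} (hi : i < x.tupleCard + 1 + x.k) :
    x.final.arr 32 i = i * x.tupleCard := by
  rw [x.final_scan (j := 36) rfl rfl rfl (by simpa using hi)]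
  exact Ex.eval_sum_eq (by simpa using hi.le) fun j _ => by simp

theorem tupleCell_lt {i : ℕ} (hi : i < x.tupleCard + 1 + x.k) (a : Fin x.tupleCard) :
    i * x.tupleCard + a < x.final.reg 8 := by
  have := a.2
  rw [final_reg_eight]
  nlinarith

theorem final_tupleDiv {i : ℕ} (hi : i < x.tupleCard + 1 + x.k) (a : Fin x.tupleCard) :
    x.final.arr 33 (i * x.tupleCard + a) = i := by
  rw [x.final_scan (j := 37) rfl rfl rfl (x.tupleCell_lt hi a)]
  refine Ex.eval_count_eq (by simpa using hi.le) fun j hj => ?_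
  have ha := a.2
  simp only [RamState.reg_setReg, final_reg_nine, Nat.reduceEqDiff, if_false] at hj
  simp only [Ex.holds_le, Ex.eval_add, Ex.eval_load, Ex.eval_var, RamState.reg_setReg,
    RamState.arr_setReg, if_true, Nat.reduceEqDiff, if_false,
    x.final_tupleRow hj, final_reg_seven]
  rw [← Nat.succ_mul]
  constructor
  · intro h
    by_contra! hij
    have := Nat.mul_le_mul_right x.tupleCard (Nat.succ_le_succ hij)
    rw [Nat.succ_mul i] at this
    omega
  · intro h
    have := Nat.mul_le_mul_right x.tupleCard (Nat.succ_le_of_lt h)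
    omega

theorem final_tupleMod {i : ℕ} (hi : i < x.tupleCard + 1 + x.k) (a : Fin x.tupleCard) :
    x.final.arr 34 (i * x.tupleCard + a) = a := by
  rw [x.final_scan (j := 38) rfl rfl rfl (x.tupleCell_lt hi a)]
  simp [x.final_tupleDiv hi a, x.final_tupleRow hi]

/-- Again division by counting: `b` is counted if `(b + 1) * kernelCard ^ i ≤ a`, where the product
is computed as a sum with `b + 1` nonzero terms. -/
theorem final_tupleQuo {i : ℕ} (hi : i < x.k + 1) (a : Fin x.tupleCard) :
    x.final.arr 35 (i * x.tupleCard + a) = a / x.kernelCard ^ i := by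
  have hi' : i < x.tupleCard + 1 + x.k := by omega
  have hpos : 0 < x.kernelCard ^ i := Nat.one_le_pow _ _ x.kernelCard_pos
  rw [x.final_scan (j := 39) rfl rfl rfl (x.tupleCell_lt hi' a)]
  refine Ex.eval_count_eq ?_ fun b hb => ?_
  · simpa using (Nat.div_le_self _ _).trans a.2.le
  · simp only [RamState.reg_setReg, final_reg_seven, Nat.reduceEqDiff, if_false] at hb
    rw [Ex.holds_le, Ex.eval_sum_eq (c := b + 1) (m := x.kernelCard ^ i)]
    · simp only [Ex.eval_load, Ex.eval_var, RamState.reg_setReg, RamState.arr_setReg,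
        Nat.reduceEqDiff, if_false, if_true, x.final_tupleMod hi' a]
      rw [Nat.lt_iff_add_one_le, Nat.le_div_iff_mul_le hpos]
    · simpa using hb
    · intro c _
      simp [x.final_tupleDiv hi' a, x.final_kernelPow hi]

/-- The tuple with a given code. -/
noncomputable def tuple (a : Fin x.tupleCard) : Fin x.k → Fin x.kernelCard := finFunctionFinEquiv.symm a

theorem tuple_val (a : Fin x.tupleCard) (i : Fin x.k) :
    (x.tuple a i : ℕ) = a / x.kernelCard ^ (i : ℕ) % x.kernelCard :=
  finFunctionFinEquiv_symm_apply_val a i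

theorem final_digit (i : Fin x.k) (a : Fin x.tupleCard) :
    x.final.arr 36 (i * x.tupleCard + a) = x.tuple a i := by
  have hi : (i : ℕ) < x.tupleCard + 1 + x.k := by omega
  have hi' : (i : ℕ) + 1 < x.tupleCard + 1 + x.k := by have := x.tupleCard_pos; omega
  rw [x.final_scan (j := 40) rfl rfl rfl (x.tupleCell_lt hi a), tuple_val]
  simp only [entryP, Ex.eval_sub, Ex.eval_load, Ex.eval_add, Ex.eval_var, Ex.eval_sum,
    Ex.eval_const, RamState.reg_setReg, RamState.arr_setReg, if_true, Nat.reduceEqDiff, if_false,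
    x.final_tupleDiv hi a, x.final_tupleMod hi a, x.final_tupleRow hi, x.final_tupleRow hi',
    Finset.sum_const, Finset.card_range, smul_eq_mul, x.final_tupleQuo (i := i) (by omega) a,
    x.final_tupleQuo (i := i + 1) (by omega) a, final_reg_five]
  have := Nat.div_add_mod ((a : ℕ) / x.kernelCard ^ (i : ℕ)) x.kernelCard
  rw [Nat.div_div_eq_div_mul, ← pow_succ] at this
  omega

theorem eval_entryP_digit {s : RamState} {e e' : Ex} {i : Fin x.k} {a : Fin x.tupleCard}
    (hs : s.arr = x.final.arr) (he : e.eval s = i) (he' : e'.eval s = a) :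
    (entryP 36 e e').eval s = x.tuple a i := by
  simp only [entryP, Ex.eval_load, Ex.eval_add, hs, he, he',
    x.final_tupleRow (i := i) (by omega), final_digit]

theorem eval_placeEx {s : RamState} {e e' : Ex} {i : Fin x.k} {a : Fin x.tupleCard}
    (hs : s.arr = x.final.arr) (he : e.eval s = i) (he' : e'.eval s = a) :
    (placeEx e e').eval s = x.kernelVertex (x.tuple a i) := by
  rw [placeEx, Ex.eval_load, x.eval_entryP_digit hs he he', hs, final_kernelVertex]

theorem forall_lt_iff_fin {n : ℕ} {p : ℕ → Prop} : (∀ i, i < n → p i) ↔ ∀ i : Fin n, p i :=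
  ⟨fun h i => h i i.2, fun h i hi => h ⟨i, hi⟩⟩

theorem final_valid (a : Fin x.tupleCard) :
    x.final.arr 37 a = 0 ↔ ¬ TupleFree x.KernelClash (x.tuple a) := by
  have h := x.final_scan (j := 41) rfl rfl rfl (c := a) (by simp)
  rw [← not_iff_not, ← ne_eq, h, ← Ex.Holds, not_not]
  simp only [Ex.holds_all, RamState.reg_setReg, OfNat.one_ne_ofNat, if_false, final_reg_one,
    forall_lt_iff_fin, TupleFree]
  refine forall_congr' fun i => forall_congr' fun j => ?_
  have hi := x.eval_placeEx (s := ((x.final.setReg 10 a).setReg 11 i).setReg 12 j)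
    (e := .var 11) (e' := .var 10) (i := i) (a := a) (by simp) (by simp) (by simp)
  have hj := x.eval_placeEx (s := ((x.final.setReg 10 a).setReg 11 i).setReg 12 j)
    (e := .var 12) (e' := .var 10) (i := j) (a := a) (by simp) (by simp) (by simp)
  simp only [Ex.holds_or, Ex.holds_not, Ex.holds_eq, Ex.holds_load, entry, Ex.eval_load,
    Ex.eval_add, hi, hj, Ex.eval_var, RamState.reg_setReg, RamState.arr_setReg, if_true,
    Nat.reduceEqDiff, if_false, final_large, ne_eq, not_not, final_row_fin, final_contractedAdj,
    Fin.val_inj, KernelClash, Clash]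
  constructor
  · rintro (h | h | h | h) hne ⟨h1, h2, h3⟩
    exacts [hne h, h1 h, h2 h, h h3]
  · intro h
    by_contra! h'
    exact h h'.1 ⟨h'.2.1, h'.2.2.1, h'.2.2.2⟩

/-- Tokens are indistinguishable, so a tuple is compared with a set by counting how often each
vertex of the kernel occurs. -/
theorem holds_tupleEx (S : Finset (Fin x.n)) {m : Multiset (Fin x.kernelCard)}
    (hm : m.map x.kernelVertex = S.val) {b : ℕ} [DecidableEq (Fin x.n)]
    (hb : ∀ u : Fin x.n, x.final.arr b u = if u ∈ S then 1 else 0) (a : Fin x.tupleCard) :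
    (Ex.all 11 5 (.eq (.count 12 1 (.eq (entryP 36 (.var 12) (.var 10)) (.var 11)))
      (.load b (.load 30 (.var 11))))).Holds (x.final.setReg 10 a) ↔ entries (x.tuple a) = m := by
  rw [Multiset.ext, Ex.holds_all]
  simp only [RamState.reg_setReg, Nat.reduceEqDiff, if_false, final_reg_five, forall_lt_iff_fin]
  refine forall_congr' fun z => ?_
  rw [Ex.holds_eq, Ex.eval_count_of_iff (m := x.k) (p := fun i => x.tuple a i = z)
    (dp := fun i => decEq _ _) (by simp)]
  · have h1 : (entries (x.tuple a)).count z =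
        (Finset.univ.filter fun i => x.tuple a i = z).card := by
      rw [entries, Multiset.count_map]
      simp only [eq_comm (a := z)]
      rfl
    have h2 : m.count z = if x.kernelVertex z ∈ S then 1 else 0 := by
      rw [← Multiset.count_map_eq_count' _ _ x.kernelVertex_injective, hm,
        Multiset.count_eq_of_nodup S.nodup]
      rfl
    rw [h1, h2]
    simp only [hb, Ex.eval_load, Ex.eval_var, RamState.reg_setReg, RamState.arr_setReg, if_true,
      final_kernelVertex]
    convert Iff.rfl
  · intro i
    rw [Ex.holds_eq, x.eval_entryP_digit (i := i) (a := a) (by simp) (by simp) (by simp)]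
    simp [Fin.val_inj]

theorem final_tupleSource (a : Fin x.tupleCard) :
    x.final.arr 38 a = 0 ↔ ¬ entries (x.tuple a) = x.kernelSource := by
  have h := x.final_scan (j := 42) rfl rfl rfl (c := a) (by simp)
  rw [← not_iff_not, ← ne_eq, h, ← Ex.Holds, not_not]
  exact x.holds_tupleEx x.source x.map_kernelSource x.final_source a

theorem final_tupleTarget (a : Fin x.tupleCard) :
    x.final.arr 39 a = 0 ↔ ¬ entries (x.tuple a) = x.kernelTarget := by
  have h := x.final_scan (j := 43) rfl rfl rfl (c := a) (by simp)
  rw [← not_iff_not, ← ne_eq, h, ← Ex.Holds, not_not]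
  exact x.holds_tupleEx x.target x.map_kernelTarget x.final_target a

/-- One round of the search. -/
def CodeStep (b a : Fin x.tupleCard) : Prop :=
  TupleStep x.KernelAdj (x.tuple b) (x.tuple a) ∧ TupleFree x.KernelClash (x.tuple a)

/-- The tuples that have been reached after a number of rounds. -/
def Reached : ℕ → Fin x.tupleCard → Prop
  | 0, a => entries (x.tuple a) = x.kernelSource
  | i + 1, a => Reached i a ∨ ∃ b, Reached i b ∧ x.CodeStep b a

/-- The expression for a slide from the tuple with the code in register 11. -/
def stepEx : Ex :=
  .exi 12 1 (.and
    (entry 20 (placeEx (.var 12) (.var 11)) (placeEx (.var 12) (.load 34 (.var 10))))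
    (.all 13 1 (.or (.eq (.var 13) (.var 12)) (.eq
      (entryP 36 (.var 13) (.load 34 (.var 10))) (entryP 36 (.var 13) (.var 11))))))

/-- The expression for the reached tuples. -/
def reachEx : Ex :=
  .ite (.load 33 (.var 10)) (.or (entryP 40 (.sub (.load 33 (.var 10)) (.const 1))
      (.load 34 (.var 10))) (.and (.load 37 (.load 34 (.var 10))) (.exi 11 7 (.and
        (entryP 40 (.sub (.load 33 (.var 10)) (.const 1)) (.var 11)) stepEx))))
    (.load 38 (.load 34 (.var 10)))

theorem tupleStep_iff {b a : Fin x.tupleCard} : TupleStep x.KernelAdj (x.tuple b) (x.tuple a) ↔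
    ∃ i, x.KernelAdj (x.tuple b i) (x.tuple a i) ∧ ∀ j, j = i ∨ x.tuple a j = x.tuple b j :=
  exists_congr fun _ => and_congr_right fun _ => forall_congr' fun _ => or_iff_not_imp_left.symm

/-- The expression reads array `40` only in the preceding row, which is complete when the current
cell is written. -/
theorem eval_reachEx_congr {s s' : RamState} {i : ℕ} {a : Fin x.tupleCard} (hr : s.reg = s'.reg)
    (h : ∀ b, b ≠ 40 → s.arr b = s'.arr b) (h7 : s'.reg 7 = x.tupleCard)
    (hrow : s'.arr 32 (s'.arr 33 (s'.reg 10) - 1) = i * x.tupleCard)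
    (hcol : s'.arr 34 (s'.reg 10) = a)
    (h40 : ∀ b : Fin x.tupleCard, s.arr 40 (i * x.tupleCard + b) =
      s'.arr 40 (i * x.tupleCard + b)) : reachEx.eval s = reachEx.eval s' := by
  have inner : ∀ (e : Ex), e.arrs.elem 40 = false → ∀ b, e.eval (s.setReg 11 b) =
      e.eval (s'.setReg 11 b) := by
    intro e he b
    refine e.eval_congr (fun q _ => by simp [hr]) fun c hc => ?_
    simp only [RamState.arr_setReg]
    refine h c ?_
    rintro rfl
    simp [hc] at he
  have hload : ∀ b : ℕ, b < x.tupleCard →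
      s.arr 40 (i * x.tupleCard + b) = s'.arr 40 (i * x.tupleCard + b) := fun b hb => h40 ⟨b, hb⟩
  rw [reachEx, Ex.eval_ite, Ex.eval_ite]
  refine if_congr (by simp [hr, h]) ?_ (by simp [hr, h])
  rw [Ex.or, Ex.eval_add, Ex.eval_add]
  congr 1
  · simp [entryP, hr, h, hrow, hcol, h40]
  · rw [Ex.and, Ex.eval_ite, Ex.eval_ite]
    refine if_congr (by simp [hr, h]) ?_ rfl
    rw [Ex.exi, Ex.eval_sum, Ex.eval_sum, hr]
    refine Finset.sum_congr rfl fun b hb => ?_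
    rw [h7, Finset.mem_range] at hb
    rw [Ex.and, Ex.eval_ite, Ex.eval_ite]
    exact if_congr (by simp [entryP, hr, h, hrow, hload b hb]) (inner _ rfl b) rfl

theorem final_reached {i : ℕ} (hi : i ≤ x.tupleCard) (a : Fin x.tupleCard) :
    x.final.arr 40 (i * x.tupleCard + a) = 0 ↔ ¬ x.Reached i a := by
  classical
  have hlt : ∀ {i}, i ≤ x.tupleCard → i < x.tupleCard + 1 + x.k := fun h => by omega
  induction i generalizing a with
  | zero =>
    have hd := x.final_tupleDiv (hlt hi) a
    have hm := x.final_tupleMod (hlt hi) a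
    have hc := x.tupleCell_lt (hlt hi) a
    simp only [zero_mul, zero_add] at hd hm hc ⊢
    rw [x.final_scan_of_self (j := 44) rfl rfl hc fun f _ => by
      rw [Ex.eval_ite_of_iff (p := False) (by simp [hd]),
        Ex.eval_ite_of_iff (p := False) (by simp [hd])]
      simp, Ex.eval_ite_of_iff (p := False) (by simp [hd])]
    simp [hm, final_tupleSource, Reached]
  | succ i ih =>
    have hd := x.final_tupleDiv (hlt hi) a
    have hm := x.final_tupleMod (hlt hi) a
    have hc := x.tupleCell_lt (hlt hi) a
    have hr := x.final_tupleRow (hlt (by omega : i ≤ x.tupleCard))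
    have hi' : i ≤ x.tupleCard := by omega
    have hself : ∀ f : ℕ → ℕ, (∀ c < (i + 1) * x.tupleCard + a, f c = x.final.arr 40 c) →
        reachEx.eval ((x.final.withArr 40 f).setReg 10 ((i + 1) * x.tupleCard + a)) =
        reachEx.eval (x.final.setReg 10 ((i + 1) * x.tupleCard + a)) := fun f hf =>
      x.eval_reachEx_congr (s := (x.final.withArr 40 f).setReg 10 ((i + 1) * x.tupleCard + a))
        (s' := x.final.setReg 10 ((i + 1) * x.tupleCard + a)) (i := i) (a := a)
        (by simp only [RamState.setReg, RamState.reg_withArr]) (fun b hb => by simp [hb]) (by simp)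
        (by simp [hd, hr]) (by simp [hm]) fun b => by
          have hb := b.2
          simp [hf (i * x.tupleCard + b) (by rw [add_mul]; omega)]
    have h := x.final_scan_of_self (e := reachEx) (j := 44) rfl rfl hc hself
    rw [← not_iff_not, ← ne_eq, h, ← Ex.Holds, not_not]
    have hite : ∀ {c a b : Ex} {s : RamState}, c.Holds s → ((Ex.ite c a b).Holds s ↔ a.Holds s) :=
      fun h => by rw [Ex.Holds, Ex.eval_ite, if_pos h]; rfl
    set s := x.final.setReg 10 ((i + 1) * x.tupleCard + a) with hs
    have p1 : ∀ (b : Fin x.tupleCard) (j : Fin x.k), (placeEx (.var 12) (.var 11)).eval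
        ((s.setReg 11 b).setReg 12 j) = x.kernelVertex (x.tuple b j) := fun b j =>
      x.eval_placeEx (by simp [s]) (by simp) (by simp)
    have p2 : ∀ (b : Fin x.tupleCard) (j : Fin x.k), (placeEx (.var 12) (.load 34 (.var 10))).eval
        ((s.setReg 11 b).setReg 12 j) = x.kernelVertex (x.tuple a j) := fun b j =>
      x.eval_placeEx (by simp [s]) (by simp) (by simp [s, hm])
    have p3 : ∀ (b : Fin x.tupleCard) (j j' : Fin x.k), (entryP 36 (.var 13) (.var 11)).eval
        (((s.setReg 11 b).setReg 12 j).setReg 13 j') = x.tuple b j' := fun b j j' =>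
      x.eval_entryP_digit (by simp [s]) (by simp) (by simp)
    have p4 : ∀ (b : Fin x.tupleCard) (j j' : Fin x.k),
        (entryP 36 (.var 13) (.load 34 (.var 10))).eval
        (((s.setReg 11 b).setReg 12 j).setReg 13 j') = x.tuple a j' := fun b j j' =>
      x.eval_entryP_digit (by simp [s]) (by simp) (by simp [s, hm])
    have hs1 : s.reg 1 = x.k := by simp [s]
    have hs7 : s.reg 7 = x.tupleCard := by simp [s]
    have hs10 : s.reg 10 = (i + 1) * x.tupleCard + a := by simp [s]
    have hsa : s.arr = x.final.arr := by simp only [s, RamState.arr_setReg]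
    have inner : ∀ b : Fin x.tupleCard, stepEx.Holds (s.setReg 11 b) ↔
        TupleStep x.KernelAdj (x.tuple b) (x.tuple a) := by
      intro b
      rw [tupleStep_iff, stepEx]
      simp only [Ex.holds_exi, RamState.reg_setReg, OfNat.one_ne_ofNat, Nat.reduceEqDiff,
        if_false, hs1, exists_lt_iff_fin, Ex.holds_and, entry, Ex.holds_load, Ex.eval_add,
        Ex.eval_load, p1, p2, RamState.arr_setReg, hsa, final_row_fin, ne_eq, final_contractedAdj,
        not_not, Ex.holds_all, forall_lt_iff_fin, Ex.holds_or, Ex.holds_eq, p3, p4, Ex.eval_var,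
        if_true, Fin.val_inj, KernelAdj]
    rw [reachEx, hite]
    · simp only [Ex.holds_or, Ex.holds_exi, Ex.holds_and, inner, Ex.holds_load, entryP, Ex.eval_load,
        Ex.eval_add, Ex.eval_sub, Ex.eval_var, Ex.eval_const, RamState.reg_setReg,
        RamState.arr_setReg, if_true, Nat.reduceEqDiff, if_false, hsa, hs10, hs7, hd, hm, hr,
        Nat.add_sub_cancel, exists_lt_iff_fin, ih hi', ne_eq, not_not, final_valid, Reached,
        CodeStep]
      refine or_congr Iff.rfl ⟨?_, ?_⟩
      · rintro ⟨h1, b, h2, h3⟩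
        exact ⟨b, h2, h3, h1⟩
      · rintro ⟨b, h2, h3, h1⟩
        exact ⟨h1, b, h2, h3⟩
    · simp [hs10, hsa, hd]

theorem final_answer : x.final.reg 19 = 0 ↔
    ¬ ∃ a, x.Reached x.tupleCard a ∧ entries (x.tuple a) = x.kernelTarget := by
  have := execList_set (l := progDecide) (j := 45) rfl rfl rfl rfl x.encode
  rw [← final] at this
  rw [← not_iff_not, ← ne_eq, this, ← Ex.Holds, not_not]
  simp only [Ex.holds_exi, Ex.holds_and, entryP, Ex.holds_load, Ex.eval_load, Ex.eval_add,
    Ex.eval_var, RamState.reg_setReg, RamState.arr_setReg, if_true, Nat.reduceEqDiff, if_false,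
    final_reg_seven, exists_lt_iff_fin, x.final_tupleRow (i := x.tupleCard) (by omega), ne_eq,
    x.final_reached le_rfl, not_not, final_tupleTarget]

theorem exists_entries {k : ℕ} {V : Type*} {m : Multiset V} (hm : m.card = k) :
    ∃ f : Fin k → V, entries f = m := by
  induction m using Quotient.inductionOn with
  | h l =>
    have hl : l.length = k := hm
    subst hl
    refine ⟨l.get, ?_⟩
    rw [entries]
    simp

/-- The search starts from all orderings of the source and accepts any ordering of the target. By
`rounds_iff`, as many rounds as there are tuples suffice. -/
theorem final_answer_iff (hG : 5 ≤ x.G.egirth) : x.final.reg 19 ≠ 0 ↔ x.IsYes := by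
  have hr := rounds_iff (R := x.Reached) (step := x.CodeStep) (fun i c => Iff.rfl)
    (m := x.tupleCard) (by simp)
  obtain ⟨f, hf⟩ := exists_entries x.card_kernelSource
  have hfree := x.conflictFree_kernelSource
  rw [x.isYes_iff_slides_kernel hG, ne_eq, final_answer, not_not]
  have hto : ∀ f : Fin x.k → Fin x.kernelCard, ∃ a, x.tuple a = f := fun f =>
    ⟨finFunctionFinEquiv f, finFunctionFinEquiv.symm_apply_apply f⟩
  have hinj : Function.Injective x.tuple := finFunctionFinEquiv.symm.injective
  have hlift : ∀ a b, ReflTransGen x.CodeStep a b ↔ ReflTransGen (fun f g =>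
      TupleStep x.KernelAdj f g ∧ TupleFree x.KernelClash g) (x.tuple a) (x.tuple b) := by
    intro a b
    refine ⟨fun h => h.lift x.tuple fun _ _ => id, fun h => ?_⟩
    generalize hg : x.tuple b = g at h
    induction h generalizing b with
    | refl => rw [hinj hg]
    | @tail g' g'' _ h ih =>
      obtain ⟨c, rfl⟩ := hto g'
      subst hg
      exact (ih c rfl).tail h
  constructor
  · rintro ⟨b, hb, ht⟩
    obtain ⟨a, ha, hab⟩ := (hr b).1 hb
    have ha : entries (x.tuple a) = x.kernelSource := ha
    rw [← ha, slides_entries_iff x.kernelClash_symm]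
    · exact ⟨_, ht, (hlift a b).1 hab⟩
    · rw [← conflictFree_entries_iff x.kernelClash_symm, ha]
      exact hfree
  · intro h
    rw [← hf, conflictFree_entries_iff x.kernelClash_symm] at hfree
    rw [← hf, slides_entries_iff x.kernelClash_symm hfree] at h
    obtain ⟨g, hg, hfg⟩ := h
    obtain ⟨a, rfl⟩ := hto f
    obtain ⟨b, rfl⟩ := hto g
    exact ⟨b, (hr b).2 ⟨a, hf, (hlift a b).2 hfg⟩, hg⟩

end TokenSlidingInstance

end Search

/-! ### Running time -/

section RunningTime

theorem primrec_pow : Primrec₂ ((· ^ ·) : ℕ → ℕ → ℕ) := Primrec₂.unpaired'.1 Nat.Primrec.pow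

/-- A bound for the number of vertices of the kernel. -/
def kernelBound (k : ℕ) : ℕ :=
  2 * k + 2 * k * tower k (2 * k + 2) + k * 2 ^ ((tower k (2 * k + 2) +
    (2 * k + 2 * k * tower k (2 * k + 2)) + 2) * tower k (2 * k + 2)) * tower k (2 * k + 2)

/-- A bound for the registers that control the search in the kernel. -/
def searchBound (k : ℕ) : ℕ := (kernelBound k ^ k + kernelBound k + k + 2) ^ 2

theorem primrec_tower : Primrec₂ tower := by
  have h : Primrec₂ fun k i : ℕ =>
      Nat.rec (motive := fun _ => ℕ) 0 (fun _ t => 2 ^ 2 ^ (t + k + 10)) i :=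
    Primrec.nat_rec (f := fun _ => 0) (g := fun (k : ℕ) (p : ℕ × ℕ) => 2 ^ 2 ^ (p.2 + k + 10))
      (Primrec.const 0) (primrec_pow.comp (Primrec.const 2) (primrec_pow.comp (Primrec.const 2)
        (Primrec.nat_add.comp (Primrec.nat_add.comp (Primrec.snd.comp Primrec.snd) Primrec.fst)
          (Primrec.const 10)))).to₂
  refine h.of_eq fun k i => ?_
  induction i with
  | zero => rfl
  | succ i ih => exact congrArg (fun t => 2 ^ 2 ^ (t + k + 10)) ih

theorem primrec_kernelBound : Primrec kernelBound := by
  have hk : Primrec fun k : ℕ => 2 * k := Primrec.nat_mul.comp (Primrec.const 2) Primrec.id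
  have ht : Primrec fun k : ℕ => tower k (2 * k + 2) :=
    primrec_tower.comp Primrec.id (Primrec.nat_add.comp hk (Primrec.const 2))
  have hz : Primrec fun k : ℕ => 2 * k + 2 * k * tower k (2 * k + 2) :=
    Primrec.nat_add.comp hk (Primrec.nat_mul.comp hk ht)
  exact Primrec.nat_add.comp hz (Primrec.nat_mul.comp (Primrec.nat_mul.comp Primrec.id
    (primrec_pow.comp (Primrec.const 2) (Primrec.nat_mul.comp (Primrec.nat_add.comp
      (Primrec.nat_add.comp ht hz) (Primrec.const 2)) ht))) ht)

theorem primrec_searchBound : Primrec searchBound :=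
  primrec_pow.comp (Primrec.nat_add.comp (Primrec.nat_add.comp (Primrec.nat_add.comp
    (primrec_pow.comp primrec_kernelBound Primrec.id) primrec_kernelBound) Primrec.id)
    (Primrec.const 2)) (Primrec.const 2)

/-- The constant factor for the cubic part of the running time. -/
def cubicFactor : ℕ := ((progSizes.map St.size).sum + (progKernel.map St.size).sum) * 23 ^ 3

/-- The part of the running time that depends on the number of tokens only. -/
def searchTime (k : ℕ) : ℕ := ((progPowers.map St.size).sum + (progSearchSizes.map St.size).sum +
  (progSearch.map St.size).sum) * searchBound k ^ 5 + 5

theorem primrec_searchTime : Primrec searchTime :=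
  Primrec.nat_add.comp (Primrec.nat_mul.comp (Primrec.const _)
    (primrec_pow.comp primrec_searchBound (Primrec.const 5))) (Primrec.const 5)

namespace TokenSlidingInstance

variable (x : TokenSlidingInstance)

theorem kernelCard_le_kernelBound : x.kernelCard ≤ kernelBound x.k := by
  have hd : smallDegree x.G x.tokens x.k ≤ tower x.k (2 * x.k + 2) :=
    (thresholds_le_tower _).trans (tower_mono _ (by omega))
  have hM : largeSize x.G x.tokens x.k ≤ tower x.k (2 * x.k + 2) := by
    refine (threshold_le _ _ _).trans ?_
    rw [tower]
    exact Nat.pow_le_pow_right (by norm_num) (Nat.pow_le_pow_right (by norm_num)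
      (Nat.add_le_add_right (Nat.add_le_add_right (thresholds_le_tower _) _) _))
  rw [final_kernelCard]
  refine (ncard_kernelSet_le x.n_pos x.card_tokens_le).trans ?_
  unfold kernelBound
  gcongr
  norm_num

/-- The phases are timed separately, because the bounds of the loops of a phase are computed in
earlier phases. Loops of the first two phases are bounded in terms of `n`, those of the others by
the size of the kernel and `k`. -/
theorem runsWithin_progDecide :
    RunsWithin 20 progDecide x.encode (cubicFactor * x.n ^ 3 + searchTime x.k) := by
  have hn := x.n_pos
  have hk := x.k_le
  set s1 := execList progSizes x.encode with hs1
  set s2 := execList progKernel s1 with hs2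
  set s3 := execList progPowers s2 with hs3
  set s4 := execList progSearchSizes s3 with hs4
  have f4 : x.final = execList progSearch s4 := by
    rw [final, progDecide, execList_append, execList_append, execList_append, execList_append]
  have f3 : x.final = execList (progSearchSizes ++ progSearch) s3 := by
    rw [f4, hs4, execList_append]
  have f2 : x.final = execList (progPowers ++ (progSearchSizes ++ progSearch)) s2 := by
    rw [f3, hs3, execList_append progPowers]
  have f1 : x.final = execList (progKernel ++ (progPowers ++ (progSearchSizes ++ progSearch))) s1 := by
    rw [f2, hs2, execList_append progKernel]
  have r4 : ∀ q ∈ [1, 5, 7, 8, 9], s4.reg q = x.final.reg q := fun q hq => by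
    rw [f4, reg_execList _ _ ((by decide : ∀ q ∈ [1, 5, 7, 8, 9], q ∉
      progSearch.flatMap St.regsOut) q hq)]
  have r3 : ∀ q ∈ [7], s3.reg q = x.final.reg q := fun q hq => by
    rw [f3, reg_execList _ _ ((by decide : ∀ q ∈ [7], q ∉
      (progSearchSizes ++ progSearch).flatMap St.regsOut) q hq)]
  have r2 : ∀ q ∈ [5, 6], s2.reg q = x.final.reg q := fun q hq => by
    rw [f2, reg_execList _ _ ((by decide : ∀ q ∈ [5, 6], q ∉
      (progPowers ++ (progSearchSizes ++ progSearch)).flatMap St.regsOut) q hq)]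
  have r1 : ∀ q ∈ [0, 2, 3, 4], s1.reg q = x.final.reg q := fun q hq => by
    rw [f1, reg_execList _ _ ((by decide : ∀ q ∈ [0, 2, 3, 4], q ∉
      (progKernel ++ (progPowers ++ (progSearchSizes ++ progSearch))).flatMap St.regsOut) q hq)]
  set N := x.kernelCard with hN
  have hNk := x.kernelCard_le_kernelBound
  have hP : x.tupleCard ≤ kernelBound x.k ^ x.k := Nat.pow_le_pow_left hNk _
  have hB : 1 ≤ searchBound x.k := Nat.one_le_pow _ _ (by omega)
  have hB1 : kernelBound x.k ^ x.k + kernelBound x.k + x.k + 2 ≤ searchBound x.k :=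
    Nat.le_self_pow (by norm_num) _
  -- Register `8` holds this product, which explains the square in `searchBound`.
  have hB2 : x.tupleCard * (x.tupleCard + 1 + x.k) + 1 ≤ searchBound x.k := by
    unfold searchBound
    nlinarith
  have b0 : x.encode.Bounded weightSizes (23 * x.n) := by
    refine ⟨by omega, fun r hr => ?_⟩
    have hr : r = 0 := by simpa [weightSizes] using hr
    subst hr
    simp only [encode, weightSizes, if_true, pow_one]
    omega
  -- Since `n ≥ 1` and `k ≤ n`, both `2 * n + 21` and `2 * k + 3` are at most `23 * n`.
  have b1 : s1.Bounded weightKernel (23 * x.n) := by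
    refine ⟨by omega, fun r hr => ?_⟩
    have hr : r = 0 ∨ r = 2 ∨ r = 3 ∨ r = 4 := by
      unfold weightKernel at hr
      split_ifs at hr <;> omega
    rcases hr with rfl | rfl | rfl | rfl <;> rw [r1 _ (by simp)] <;> simp [weightKernel]
    · omega
    · omega
    · nlinarith
    · omega
  have b2 : s2.Bounded weightPowers (searchBound x.k) := by
    refine ⟨hB, fun r hr => ?_⟩
    have hr : r = 5 ∨ r = 6 := by
      unfold weightPowers at hr
      split_ifs at hr <;> omega
    rcases hr with rfl | rfl <;> rw [r2 _ (by simp)] <;> simp [weightPowers] <;> omega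
  have b3 : s3.Bounded weightSearchSizes (searchBound x.k) := by
    refine ⟨hB, fun r hr => ?_⟩
    have hr : r = 7 := by
      unfold weightSearchSizes at hr
      split_ifs at hr <;> omega
    rcases hr with rfl
    rw [r3 _ (by simp)]
    simp [weightSearchSizes]
    omega
  have b4 : s4.Bounded weightSearch (searchBound x.k) := by
    refine ⟨hB, fun r hr => ?_⟩
    have hr : r = 1 ∨ r = 5 ∨ r = 7 ∨ r = 8 ∨ r = 9 := by
      unfold weightSearch at hr
      split_ifs at hr <;> omega
    rcases hr with rfl | rfl | rfl | rfl | rfl <;> rw [r4 _ (by simp)] <;>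
      simp [weightSearch] <;> omega
  have t1 := runsWithin_of_check (d := 20) (by unfold weightSizes; intro r; split_ifs <;> omega) _
    check_sizes b0
  have t2 := runsWithin_of_check (d := 20) (by unfold weightKernel; intro r; split_ifs <;> omega) _
    check_kernel b1
  have t3 := runsWithin_of_check (d := 20) (by unfold weightPowers; intro r; split_ifs <;> omega) _
    check_powers b2
  have t4 := runsWithin_of_check (d := 20)
    (by unfold weightSearchSizes; intro r; split_ifs <;> omega) _ check_searchSizes b3
  have t5 := runsWithin_of_check (d := 20) (by unfold weightSearch; intro r; split_ifs <;> omega) _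
    check_search b4
  have h := t1.append (t2.append (t3.append (t4.append t5)))
  have e : ∀ a b c d e n k : ℕ, a * (23 * n) ^ 3 + 1 + (b * (23 * n) ^ 3 + 1 + (c * k ^ 5 + 1 +
      (d * k ^ 5 + 1 + (e * k ^ 5 + 1)))) = (a + b) * 23 ^ 3 * n ^ 3 + ((c + d + e) * k ^ 5 + 5) := by
    intros
    ring
  rw [e] at h
  exact h

end TokenSlidingInstance

end RunningTime

/-! ### The answer and the reduced instance -/

section Reduction

open Ex

theorem RunsWithin.ramRuns {l : List St} {s : RamState} {T : ℕ} (h : RunsWithin 20 l s T) :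
    ∃ t s', RamRuns (codeList 20 l) s t s' ∧ t ≤ T ∧ (∀ r < 20, s'.reg r = (execList l s).reg r) ∧
      s'.arr = (execList l s).arr := by
  obtain ⟨t, s', h1, h2, h3⟩ := h s ⟨fun _ _ => rfl, rfl⟩
  exact ⟨t, s', h1, h3, h2.1, h2.2⟩

/-- The register 0 receives the answer. -/
def progAnswer : List St := [.set 0 (ite (var 19) (const 1) (const 0))]

/-- The registers 0 and 3 receive the number of vertices of the output and `(k + 1) * (k + 1)`. -/
def progOutputSizes : List St :=
  [.set 0 (add (var 1) (ite (var 19) (const 0) (const 1))), .set 3 (sum 10 6 (var 6))]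

/-- Write an edgeless graph with two sets of vertices that are equal if the answer is positive. -/
def progOutput : List St :=
  [.scan 0 10 3 (const 0), .scan 1 10 6 (ite (lt (var 10) (var 1)) (const 1) (const 0)),
   .scan 2 10 6 (ite (var 19) (ite (lt (var 10) (var 1)) (const 1) (const 0))
     (ite (var 10) (const 1) (const 0)))]

def weightOutputSizes (r : ℕ) : ℕ := if r = 6 then 1 else 0

def weightOutput (r : ℕ) : ℕ := if r = 3 then 2 else if r = 6 then 1 else 0

/-- The time for the output of the answer. -/
def answerTime : ℕ := (progAnswer.map St.size).sum * 1 ^ 0 + 1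

/-- The constant factor for the time of the output. -/
def outputFactor : ℕ := (progOutputSizes.map St.size).sum + (progOutput.map St.size).sum

namespace TokenSlidingInstance

/-- An instance without edges. -/
def edgeless {n k : ℕ} (hk : 1 ≤ k) (S T : Finset (Fin n)) (hS : S.card = k) (hT : T.card = k) :
    TokenSlidingInstance where
  n := n
  G := ⊥
  k := k
  k_pos := hk
  source := S
  target := T
  source_indep := ⟨fun _ _ _ _ _ h => h, hS⟩
  target_indep := ⟨fun _ _ _ _ _ h => h, hT⟩

theorem isYes_edgeless {n k : ℕ} (hk : 1 ≤ k) {S T : Finset (Fin n)} (hS : S.card = k)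
    (hT : T.card = k) : (edgeless hk S T hS hT).IsYes ↔ S = T := by
  constructor
  · rintro ⟨l, I, h0, hl, -, h⟩
    cases l with
    | zero => exact h0.symm.trans hl
    | succ l =>
      obtain ⟨u, v, huv, -⟩ := h 0 (Nat.succ_pos l)
      exact huv.elim
  · rintro rfl
    exact ⟨0, fun _ => S, rfl, rfl, fun _ _ => ⟨fun _ _ _ _ _ h => h, hS⟩,
      fun i hi => absurd hi (Nat.not_lt_zero i)⟩

theorem girth_edgeless {n k : ℕ} (hk : 1 ≤ k) {S T : Finset (Fin n)} (hS : S.card = k)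
    (hT : T.card = k) : 5 ≤ (edgeless hk S T hS hT).G.egirth := by
  have : (edgeless hk S T hS hT).G.egirth = ⊤ := SimpleGraph.egirth_bot
  rw [this]
  exact le_top

theorem isOutput_edgeless {n k : ℕ} (hk : 1 ≤ k) {S T : Finset (Fin n)} (hS : S.card = k)
    (hT : T.card = k) {s : RamState} (h0 : s.reg 0 = n) (h1 : s.reg 1 = k)
    (ha : ∀ c < n * n, s.arr 0 c = 0) (hs : ∀ u : Fin n, s.arr 1 u = if u ∈ S then 1 else 0)
    (ht : ∀ u : Fin n, s.arr 2 u = if u ∈ T then 1 else 0) :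
    (edgeless hk S T hS hT).IsOutput s := by
  have key : ∀ (U : Finset (Fin n)) (u : Fin n), (∃ i ∈ U, (u : ℕ) = i) ↔ u ∈ U := fun U u =>
    ⟨fun ⟨i, hi, h⟩ => Fin.ext h ▸ hi, fun h => ⟨u, h, rfl⟩⟩
  refine ⟨h0, h1, fun c hc => ?_, fun c hc => ?_, fun c hc => ?_⟩
  · rw [ha c hc]
    simp [encode, edgeless]
  · refine (hs ⟨c, hc⟩).trans ?_
    simp only [encode, if_true, one_ne_zero, if_false]
    exact if_congr (key S ⟨c, hc⟩).symm rfl rfl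
  · refine (ht ⟨c, hc⟩).trans ?_
    simp only [encode, if_true, two_ne_zero, if_false, OfNat.ofNat_ne_one]
    exact if_congr (key T ⟨c, hc⟩).symm rfl rfl

variable (x : TokenSlidingInstance)

theorem execList_progDecide_append (l : List St) :
    execList (progDecide ++ l) x.encode = execList l x.final := by
  rw [execList_append, ← final]

theorem runsWithin_answer : RunsWithin 20 (progDecide ++ progAnswer) x.encode
    (cubicFactor * x.n ^ 3 + searchTime x.k + answerTime) :=
  x.runsWithin_progDecide.append (runsWithin_of_check (w := fun _ => 0) (fun r hr => absurd rfl hr)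
    _ (by decide) ⟨le_rfl, fun r hr => absurd rfl hr⟩)

theorem runsWithin_output : RunsWithin 20 (progDecide ++ (progOutputSizes ++ progOutput)) x.encode
    (cubicFactor * x.n ^ 3 + searchTime x.k + (outputFactor * (x.k + 2) ^ 2 + 2)) := by
  have b1 : x.final.Bounded weightOutputSizes (x.k + 2) := by
    refine ⟨by omega, fun r hr => ?_⟩
    have hr : r = 6 := by simpa [weightOutputSizes] using hr
    subst hr
    simp [weightOutputSizes]
  have b2 : (execList progOutputSizes x.final).Bounded weightOutput (x.k + 2) := by
    refine ⟨by omega, fun r hr => ?_⟩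
    have hr : r = 3 ∨ r = 6 := by
      unfold weightOutput at hr
      split_ifs at hr <;> omega
    rcases hr with rfl | rfl
    · simp [execList, progOutputSizes, St.exec, weightOutput]
      nlinarith
    · simp [execList, progOutputSizes, St.exec, weightOutput]
  have t1 := runsWithin_of_check (d := 20) (m := 2)
    (by unfold weightOutputSizes; intro r; split_ifs <;> omega) progOutputSizes (by decide) b1
  have t2 := runsWithin_of_check (d := 20) (m := 2)
    (by unfold weightOutput; intro r; split_ifs <;> omega) progOutput (by decide) b2
  have h := x.runsWithin_progDecide.append (t1.append t2)
  have e : ∀ a b c d : ℕ, a + (b * d + 1 + (c * d + 1)) = a + ((b + c) * d + 2) := by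
    intros
    ring
  rw [e] at h
  exact h

/-- The instance has already been decided, so an edgeless instance with the right answer can be
written. Without edges nothing moves: the answer is positive exactly if source and target coincide.
-/
theorem exists_output (hG : 5 ≤ x.G.egirth) {s : RamState}
    (hr : ∀ r < 20, s.reg r =
      (execList (progDecide ++ (progOutputSizes ++ progOutput)) x.encode).reg r)
    (ha : s.arr = (execList (progDecide ++ (progOutputSizes ++ progOutput)) x.encode).arr) :
    ∃ y : GirthFiveInstance, y.1.IsOutput s ∧ y.1.k = x.k ∧ (y.1.IsYes ↔ x.IsYes) ∧
      y.1.n ≤ x.k + 1 := by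
  have hk := x.k_pos
  rw [execList_progDecide_append] at hr ha
  set w := execList (progOutputSizes ++ progOutput) x.final with hw
  have w1 : w.reg 1 = x.k := (reg_execList _ _ (by decide)).trans x.final_reg_one
  have w6 : w.reg 6 = x.k + 1 := (reg_execList _ _ (by decide)).trans x.final_reg_six
  have w19 : w.reg 19 = x.final.reg 19 := reg_execList _ _ (by decide)
  have w3 : w.reg 3 = (x.k + 1) * (x.k + 1) := by
    have := execList_set (l := progOutputSizes ++ progOutput) (j := 1) rfl rfl rfl rfl x.final
    rw [← hw] at this
    simp [this, w6]
  have w0 : w.reg 0 = x.k + if x.final.reg 19 ≠ 0 then 0 else 1 := by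
    have := execList_set (l := progOutputSizes ++ progOutput) (j := 0) rfl rfl rfl rfl x.final
    rw [← hw] at this
    rw [this, eval_add, eval_ite_of_iff (p := x.final.reg 19 ≠ 0) (by simp [w19])]
    simp [w1]
  have a0 : ∀ c < (x.k + 1) * (x.k + 1), w.arr 0 c = 0 := fun c hc =>
    execList_scan (l := progOutputSizes ++ progOutput) (j := 2) rfl rfl rfl x.final
      (hc.trans_eq w3.symm)
  have a1 : ∀ c < x.k + 1, w.arr 1 c = if c < x.k then 1 else 0 := fun c hc => by
    have := execList_scan (l := progOutputSizes ++ progOutput) (j := 3) rfl rfl rfl x.final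
      (hc.trans_eq w6.symm)
    rw [← hw] at this
    rw [this, eval_ite_of_iff (p := c < x.k) (by simp [w1])]
    simp
  have a2 : ∀ c < x.k + 1, w.arr 2 c = if x.final.reg 19 ≠ 0 then if c < x.k then 1 else 0 else
      if c ≠ 0 then 1 else 0 := fun c hc => by
    have := execList_scan (l := progOutputSizes ++ progOutput) (j := 4) rfl rfl rfl x.final
      (hc.trans_eq w6.symm)
    rw [← hw] at this
    rw [this, eval_ite_of_iff (p := x.final.reg 19 ≠ 0) (by simp [w19]),
      eval_ite_of_iff (p := c < x.k) (by simp [w1]), eval_ite_of_iff (p := c ≠ 0) (by simp)]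
    simp
  rw [← ha] at a0 a1 a2
  rw [← hr 0 (by norm_num)] at w0
  rw [← hr 1 (by norm_num)] at w1
  by_cases h : x.final.reg 19 ≠ 0
  · simp only [h, if_true, ne_eq, not_false_eq_true] at w0 a2
    have hc : (Finset.univ : Finset (Fin x.k)).card = x.k := by simp
    refine ⟨⟨edgeless hk Finset.univ Finset.univ hc hc, girth_edgeless hk hc hc⟩,
      isOutput_edgeless hk hc hc w0 w1 (fun c hc => a0 c (by nlinarith))
        (fun u => ?_) (fun u => ?_), rfl, ?_, Nat.le_succ _⟩
    · simp [a1 u (by omega)]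
    · simp [a2 u (by omega)]
    · exact iff_of_true ((isYes_edgeless hk hc hc).2 rfl) ((x.final_answer_iff hG).1 h)
  -- On `k + 1` vertices, the source omits the last vertex and the target omits `0`; these sets
  -- differ because `k ≥ 1`.
  · simp only [h, if_false] at w0 a2
    have hS : (Finset.univ.erase (Fin.last x.k)).card = x.k := by simp
    have hT : (Finset.univ.erase (0 : Fin (x.k + 1))).card = x.k := by simp
    refine ⟨⟨edgeless hk _ _ hS hT, girth_edgeless hk hS hT⟩,
      isOutput_edgeless hk hS hT w0 w1 a0 (fun u => ?_) (fun u => ?_), rfl, ?_, le_rfl⟩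
    · rw [a1 u u.2]
      refine if_congr ?_ rfl rfl
      simp only [Finset.mem_erase, Finset.mem_univ, and_true, ne_eq, Fin.ext_iff, Fin.val_last]
      omega
    · rw [a2 u u.2]
      refine if_congr ?_ rfl rfl
      simp only [Finset.mem_erase, Finset.mem_univ, and_true, ne_eq, Fin.ext_iff, Fin.val_zero]
    · refine iff_of_false (fun h' => ?_) fun h' => h ((x.final_answer_iff hG).2 h')
      have := (isYes_edgeless hk hS hT).1 h'
      have h0 : (0 : Fin (x.k + 1)) ∈ Finset.univ.erase (Fin.last x.k) := by
        simp only [Finset.mem_erase, Finset.mem_univ, and_true, ne_eq, Fin.ext_iff, Fin.val_zero,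
          Fin.val_last]
        omega
      rw [this] at h0
      simp at h0

/-- For `k = 1` both sides are `2`; in general `k + 1 ≤ 2 ^ k`, and the exponent `C * k ^ 3` is at
least one. -/
theorem succ_le_two_pow_pow {k C : ℕ} (hk : 1 ≤ k) (hC : 1 ≤ C) :
    k + 1 ≤ 2 ^ k ^ (C * k ^ 3) := by
  have h : k ≤ k ^ (C * k ^ 3) :=
    Nat.le_self_pow (Nat.mul_pos hC (Nat.pow_pos hk)).ne' k
  exact Nat.lt_two_pow_self.trans_le (Nat.pow_le_pow_right (by norm_num) h)

theorem ramDecidesIn (hG : 5 ≤ x.G.egirth) :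
    RamDecidesIn (codeList 20 (progDecide ++ progAnswer)) x.encode x.IsYes
      (cubicFactor * x.n ^ 3 + searchTime x.k + answerTime) := by
  obtain ⟨t, s, h1, h2, h3, -⟩ := x.runsWithin_answer.ramRuns
  have h0 : s.reg 0 = if x.final.reg 19 ≠ 0 then 1 else 0 := by
    rw [h3 0 (by norm_num), execList_progDecide_append]
    simp only [execList, progAnswer, List.foldl_cons, List.foldl_nil, St.exec,
      RamState.reg_setReg, if_true]
    exact eval_ite_of_iff (holds_var)
  refine ⟨t, s, h1, h2, fun h => ?_, fun h => ?_⟩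
  · rw [h0, if_pos ((x.final_answer_iff hG).2 h)]
  · rw [h0, if_neg fun h' => h ((x.final_answer_iff hG).1 h')]

end TokenSlidingInstance

end Reduction

/-! ### The main theorem -/

theorem RamDecidesIn.mono {p : RamProg} {s : RamState} {yes : Prop} {T T' : ℕ}
    (h : RamDecidesIn p s yes T) (hT : T ≤ T') : RamDecidesIn p s yes T' := by
  obtain ⟨t, s', h1, h2, h3⟩ := h
  exact ⟨t, s', h1, h2.trans hT, h3⟩

theorem mainTheorem1 :
    -- Token Sliding, parameterized by `k`, is FPT on graphs of girth at least five
    FixedParameterTractable (X := GirthFiveInstance)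
      (fun x => x.1.encode) (fun x => x.1.n) (fun x => x.1.k) (fun x => x.1.IsYes) ∧
    -- more precisely, it is decided in time `O(k n ^ 3) + g(k)` with `g` computable
    (∃ (p : RamProg) (C : ℕ) (g : ℕ → ℕ), Computable g ∧
      ∀ x : GirthFiveInstance,
        RamDecidesIn p x.1.encode x.1.IsYes (C * (x.1.k * x.1.n ^ 3) + g x.1.k)) ∧
    -- and in such a time an instance is reduced to an equivalent one, with the same `k` and
    -- again of girth at least five, that has `2 ^ (k ^ O(k ^ 3))` vertices
    (∃ (p : RamProg) (C : ℕ) (g : ℕ → ℕ), Computable g ∧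
      ∀ x : GirthFiveInstance, ∃ (y : GirthFiveInstance) (t : ℕ) (s : RamState),
        RamRuns p x.1.encode t s ∧ t ≤ C * (x.1.k * x.1.n ^ 3) + g x.1.k ∧
        y.1.IsOutput s ∧ y.1.k = x.1.k ∧ (y.1.IsYes ↔ x.1.IsYes) ∧
        y.1.n ≤ 2 ^ (x.1.k ^ (C * x.1.k ^ 3))) := by
  -- A bound `c * n ^ 3 + g` is at most `(c + g) * (n ^ 3 + 1)`, which gives the product form; the
  -- factor `k` of the sharper bounds is free, as `k ≥ 1`. In the reduction, `cubicFactor + 1` also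
  -- ensures a positive constant in the exponent of the size bound.
  refine ⟨⟨codeList 20 (progDecide ++ progAnswer), fun k => cubicFactor + (searchTime k + answerTime),
    Polynomial.X ^ 3 + 1, ?_, fun x => ?_⟩, ⟨codeList 20 (progDecide ++ progAnswer), cubicFactor,
    fun k => searchTime k + answerTime, ?_, fun x => ?_⟩,
    ⟨codeList 20 (progDecide ++ (progOutputSizes ++ progOutput)), cubicFactor + 1,
    fun k => searchTime k + (outputFactor * (k + 2) ^ 2 + 2), ?_, fun x => ?_⟩⟩
  · exact (Primrec.nat_add.comp (Primrec.const _)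
      (Primrec.nat_add.comp primrec_searchTime (Primrec.const _))).to_comp
  · refine (x.1.ramDecidesIn x.2).mono ?_
    simp only [Polynomial.eval_add, Polynomial.eval_pow, Polynomial.eval_X, Polynomial.eval_one]
    nlinarith [Nat.zero_le ((searchTime x.1.k + answerTime) * x.1.n ^ 3)]
  · exact (Primrec.nat_add.comp primrec_searchTime (Primrec.const _)).to_comp
  · refine (x.1.ramDecidesIn x.2).mono ?_
    have := Nat.mul_le_mul_left cubicFactor (Nat.le_mul_of_pos_left (x.1.n ^ 3) x.1.k_pos)
    dsimp only
    omega
  · exact (Primrec.nat_add.comp primrec_searchTime (Primrec.nat_add.comp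
      (Primrec.nat_mul.comp (Primrec.const _) (primrec_pow.comp
        (Primrec.nat_add.comp Primrec.id (Primrec.const 2)) (Primrec.const 2)))
      (Primrec.const 2))).to_comp
  · obtain ⟨t, s, h1, h2, h3, h4⟩ := x.1.runsWithin_output.ramRuns
    obtain ⟨y, y1, y2, y3, y4⟩ := x.1.exists_output x.2 h3 h4
    refine ⟨y, t, s, h1, h2.trans ?_, y1, y2, y3,
      y4.trans (TokenSlidingInstance.succ_le_two_pow_pow x.1.k_pos (Nat.succ_pos _))⟩
    have := Nat.mul_le_mul (Nat.le_add_right cubicFactor 1)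
      (Nat.le_mul_of_pos_left (x.1.n ^ 3) x.1.k_pos)
    dsimp only at this ⊢
    omega
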